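/- Let $n,M,N\ge 1$ be integers, let $1<p<\infty$ and $q=p/(p-1)$, and let $f:\mathbb R^n\to\mathbb C^M$ and $g:\mathbb R^n\to\mathbb C^N$ be of class $C_c^\infty$. Let $L=-\Delta+|x|^2$ be the Hermite operator on $\mathbb R^n$, and let $P_t=e^{-t\sqrt L}$, $t>0$, be the associated Poisson semigroup, i.e. $P_tu=\sum_{\alpha\in\mathbb N_0^n}e^{-t\sqrt{2|\alpha|+n}}\,\langle u,h_\alpha\rangle\,h_\alpha$ (componentwise for vector-valued $u$), where $h_\alpha=h_{\alpha_1}\otimes\cdots\otimes h_{\alpha_n}$ and $h_m(x)=(2^m m!\sqrt\pi)^{-1/2}(-1)^m e^{x^2/2}\frac{d^m}{dx^m}e^{-x^2}$ are the $L^2$-normalised Hermite functions, $Lh_\alpha=(2|\alpha|+n)h_\alpha$. Put $L'=\frac{\partial^2}{\partial t^2}-L$, acting on functions of $(x,t)\in\mathbb R^n\times(0,\infty)$. If $p\ge 2$, put $\delta=q(q-1)/8$, $$Q(\zeta,\eta,Z,H)=2(Z+H)-|\zeta|^p-|\eta|^q-\delta\,\widetilde Q(\zeta,\eta),\qquad \widetilde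 Q(\zeta,\eta)=\begin{cases}|\zeta|^2|\eta|^{2-q}, & |\zeta|^p\le|\eta|^q,\\[2pt] \frac2p|\zeta|^p+\big(\frac2q-1\big)|\eta|^q, & |\zeta|^p\ge|\eta|^q,\end{cases}$$ and $$b(x,t)=Q\big(P_tf(x),\,P_tg(x),\,P_t|f|^p(x),\,P_t|g|^q(x)\big).$$ If $1<p<2$, define $b$ in the same way after exchanging the roles of $(f,p)$ and $(g,q)$, i.e. $b=Q(P_tg,P_tf,P_t|g|^q,P_t|f|^p)$ with the function $Q$ that belongs to the exponent $q>2$ and its conjugate $p$. Then $b$ is twice differentiable at almost every point of $\mathbb R^n\times(0,\infty)$, the function $t\,L'b(x,t)$ is integrable on $\mathbb R^n\times(0,\infty)$, and $$-\int_0^\infty\int_{\mathbb R^n}L'b(x,t)\,dx\,t\,dt\;\le\;6\Big(\int_{\mathbb R^n}|f|^p\,dx+\int_{\mathbb R^n}|g|^q\,dx\Big)=6\big(\|f\|_p^p+\|g\|_q^q\big).$$ -/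

import Mathlib

open scoped ContDiff Nat

noncomputable section

/-- The `L²(ℝ)`-normalised Hermite function
`h_m(x) = (2^m m! √π)^{-1/2} (-1)^m e^{x²/2} (d/dx)^m e^{-x²}`. -/
def hermiteFun (m : ℕ) (x : ℝ) : ℝ :=
  (√(2 ^ m * (m ! : ℝ) * √Real.pi))⁻¹ * (-1) ^ m * Real.exp (x ^ 2 / 2) *
    iteratedDeriv m (fun y : ℝ => Real.exp (-y ^ 2)) x

/-- The Hermite function `h_α = h_{α_1} ⊗ ⋯ ⊗ h_{α_n}` on `ℝⁿ`. -/
def hermiteFunMulti {n : ℕ} (α : Fin n → ℕ) (x : EuclideanSpace ℝ (Fin n)) : ℝ :=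
  ∏ j, hermiteFun (α j) (x j)

/-- The Hermite--Poisson semigroup `P_t = e^{-t√L}`, `L = -Δ + |x|²`, given by the spectral
decomposition `L h_α = (2|α| + n) h_α`:
`P_t u (x) = ∑_α e^{-t √(2|α|+n)} ⟨u, h_α⟩ h_α(x)`.
It acts on functions with values in a vector space (componentwise, when there are components). -/
def hermitePoisson {n : ℕ} {F : Type*} [NormedAddCommGroup F] [NormedSpace ℝ F]
    (t : ℝ) (u : EuclideanSpace ℝ (Fin n) → F) (x : EuclideanSpace ℝ (Fin n)) : F :=
  ∑' α : Fin n → ℕ,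
    (Real.exp (-t * √(2 * (∑ j, (α j : ℝ)) + n)) * hermiteFunMulti α x) •
      ∫ y, hermiteFunMulti α y • u y

/-- The function `Q̃(ζ, η)` with exponents `p, q`. -/
def bellmanQTilde {E F : Type*} [NormedAddCommGroup E] [NormedAddCommGroup F]
    (p q : ℝ) (ζ : E) (η : F) : ℝ :=
  if ‖ζ‖ ^ p ≤ ‖η‖ ^ q then ‖ζ‖ ^ 2 * ‖η‖ ^ (2 - q)
  else 2 / p * ‖ζ‖ ^ p + (2 / q - 1) * ‖η‖ ^ q

/-- The Nazarov--Treil Bellman function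
`Q(ζ, η, Z, H) = 2 (Z + H) - |ζ|^p - |η|^q - δ Q̃(ζ, η)`, `δ = q (q - 1) / 8`
(meant for `p ≥ 2` and `q = p / (p - 1)`). -/
def bellmanQ {E F : Type*} [NormedAddCommGroup E] [NormedAddCommGroup F]
    (p q : ℝ) (ζ : E) (η : F) (Z H : ℝ) : ℝ :=
  2 * (Z + H) - ‖ζ‖ ^ p - ‖η‖ ^ q - q * (q - 1) / 8 * bellmanQTilde p q ζ η

/-- The function `b = Q(P_t f, P_t g, P_t|f|^p, P_t|g|^q)` on `ℝⁿ × (0, ∞)`.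
The Bellman function is attached to an exponent that is at least `2`, paired with the function
that has this exponent; so for `p < 2` the pairs `(f, p)` and `(g, q)` exchange their roles. -/
def bellmanExt {n M N : ℕ} (p q : ℝ)
    (f : EuclideanSpace ℝ (Fin n) → EuclideanSpace ℂ (Fin M))
    (g : EuclideanSpace ℝ (Fin n) → EuclideanSpace ℂ (Fin N))
    (x : EuclideanSpace ℝ (Fin n)) (t : ℝ) : ℝ :=
  if 2 ≤ p then
    bellmanQ p q (hermitePoisson t f x) (hermitePoisson t g x)
      (hermitePoisson t (fun y => ‖f y‖ ^ p) x) (hermitePoisson t (fun y => ‖g y‖ ^ q) x)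
  else
    bellmanQ q p (hermitePoisson t g x) (hermitePoisson t f x)
      (hermitePoisson t (fun y => ‖g y‖ ^ q) x) (hermitePoisson t (fun y => ‖f y‖ ^ p) x)

/-- The Hermite operator `L u = -Δ u + |x|² u` on functions on `ℝⁿ`. -/
def hermiteOp {n : ℕ} (u : EuclideanSpace ℝ (Fin n) → ℝ) (x : EuclideanSpace ℝ (Fin n)) : ℝ :=
  -Laplacian.laplacian u x + ‖x‖ ^ 2 * u x

/-- The operator `L' = ∂²/∂t² - L` on functions on `ℝⁿ × (0, ∞)`. -/
def hermiteOpExt {n : ℕ} (b : EuclideanSpace ℝ (Fin n) → ℝ → ℝ)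
    (x : EuclideanSpace ℝ (Fin n)) (t : ℝ) : ℝ :=
  iteratedDeriv 2 (fun s => b x s) t - hermiteOp (fun y => b y t) x

/-- `B` is twice (Fréchet) differentiable at the point `z`: it is differentiable near `z` and its
derivative is differentiable at `z`. -/
def TwiceDifferentiableAt {E : Type*} [NormedAddCommGroup E] [NormedSpace ℝ E]
    (B : E → ℝ) (z : E) : Prop :=
  (∀ᶠ w in nhds z, DifferentiableAt ℝ B w) ∧ DifferentiableAt ℝ (fderiv ℝ B) z

end

/-! Write $Q = 2(Z+H) - \Phi$ with $\Phi = |\zeta|^p + |\eta|^q + \delta\widetilde Q$. Every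
Hermite-Poisson extension $u$ satisfies $L'u = 0$ for $t>0$, so the $Z$ and $H$ terms drop out. With
$c = \Phi(P_tf, P_tg)$ one has $-L'b = \Delta_{x,t}c - |x|^2c$ almost everywhere. Two properties of
$\Phi$ then suffice: it is convex with $\Phi(0,0)=0$, and $0\le\Phi\le\frac54(|\zeta|^p+|\eta|^q)$.

Sign. Let $(\sigma,\tau)$ be a subgradient of $\Phi$ at $(P_tf,P_tg)$. A symmetric second difference
of $c$ is at least $\sigma$ and $\tau$ applied to those of $P_tf$ and $P_tg$
(`le_secondDiff_bellmanFlow`). In the limit, $\Delta_{x,t}c \ge |x|^2(\sigma P_tf+\tau P_tg) \ge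
|x|^2\Phi$, where the last step is the subgradient inequality tested at the origin. Hence $0\le
-L'b\le\Delta_{x,t}c$ (`norm_sq_mul_bellmanFlow_le`).

Size. It remains to bound $\int\!\!\int t\,\Delta_{x,t}c$, formally $\int c(x,0)\,dx$ by parts.
Since $c$ has second derivatives only almost everywhere, the integration by parts is carried out for
the discrete Laplacian of step $h$. This operator is symmetric, and it is moved onto the weight
$t\,1_{t>h}$. Its second difference there is at most $2/h$ on $0<t\le h$ and nonpositive beyond.
This leaves $\frac2h\int_{0<t\le h}c \to 2\int\Phi(f,g)$. Fatou's lemma, with an integrable minorant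
supplied by bounded subgradients, passes to $h\to0$ (`integral_time_mul_laplacian_bellmanFlow_le`).
The final constant is $2\cdot\frac54=\frac52\le6$.

Convexity. $\Phi$ is a function of the two norms, nondecreasing in each, so tangent planes of the
scalar profile composed with norming functionals are subgradients. On the region
$|\zeta|\le|\eta|^{q-1}$, which is convex, the second derivative along segments is nonnegative by
completing a square. The other branch is a positive combination of convex powers. A segment joining
the two regions is cut at a point of the interface, where both branches agree to first order
(`bellmanProfile_support`).

Regularity. The differential of $c$ is a combination of $D|\zeta|^2$ and $D|\eta|^2$, with
coefficients built from powers of norms and one maximum and one minimum. Off the zero sets these are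
locally Lipschitz, so Rademacher's theorem applies. At almost every zero of $\zeta$ or $\eta$ its
differential vanishes, and this compensates for the singular or merely continuous coefficients
(`ae_twiceDifferentiableAt_bellmanPhi`).

Analysis of the semigroup. Bounds on Hermite functions that are polynomial in the degree allow
termwise differentiation for $t>0$. For test functions the coefficients decay rapidly, which gives
decay in space and time and convergence as $t\to0$. The boundary value is identified by completeness
of the Hermite functions. -/

/-! ### Convexity of the scalar Bellman profile -/

section BellmanConvexity

/-- The scalar profile `φ(a, b) = a ^ p + b ^ q + δ Q̃(a, b)` of the concave part of the Bellman
function, as a function of the norms `a = ‖ζ‖` and `b = ‖η‖`. -/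
noncomputable def bellmanProfile (p q a b : ℝ) : ℝ :=
  a ^ p + b ^ q + q * (q - 1) / 8 *
    (if a ≤ b ^ (q - 1) then a ^ 2 * b ^ (2 - q) else 2 / p * a ^ p + (2 / q - 1) * b ^ q)

/-- The partial derivative of `bellmanProfile` in the first variable. -/
noncomputable def bellmanProfileFst (p q a b : ℝ) : ℝ :=
  p * a ^ (p - 1) + q * (q - 1) / 8 *
    (2 * if a ≤ b ^ (q - 1) then a * b ^ (2 - q) else a ^ (p - 1))

/-- The partial derivative of `bellmanProfile` in the second variable. -/
noncomputable def bellmanProfileSnd (q a b : ℝ) : ℝ :=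
  q * b ^ (q - 1) + q * (q - 1) / 8 *
    ((2 - q) * if a ≤ b ^ (q - 1) then a ^ 2 * b ^ (1 - q) else b ^ (q - 1))

/-- Bernoulli's inequality for the ratio $y/x$; the case $x=0$ is separate because the ratio is
meaningless there. -/
theorem rpow_support {r x y : ℝ} (hr : 1 ≤ r) (hx : 0 ≤ x) (hy : 0 ≤ y) :
    x ^ r + r * x ^ (r - 1) * (y - x) ≤ y ^ r := by
  rcases hx.eq_or_lt with rfl | hx
  · rcases hr.eq_or_lt with rfl | hr
    · simp
    · rw [Real.zero_rpow (by linarith), Real.zero_rpow (by linarith)]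
      simpa using Real.rpow_nonneg hy r
  · have h := one_add_mul_self_le_rpow_one_add (s := y / x - 1)
      (by have := div_nonneg hy hx.le; linarith) hr
    have e : 1 + (y / x - 1) = y / x := by ring
    rw [e, Real.div_rpow hy hx.le, le_div_iff₀ (Real.rpow_pos_of_pos hx r)] at h
    have e2 : x ^ r = x ^ (r - 1) * x := by
      rw [Real.rpow_sub_one hx.ne']; field_simp
    calc x ^ r + r * x ^ (r - 1) * (y - x) = (1 + r * (y / x - 1)) * x ^ r := by
          rw [e2]; field_simp
      _ ≤ y ^ r := h

variable {p q : ℝ}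

/-- First-order convexity of `b ^ q + δ a² b ^ (2 - q)` along segments of `{a ≤ b ^ (q - 1)}`. -/
theorem inner_region_support (hq1 : 1 < q) (hq2 : q ≤ 2) {a b a' b' : ℝ} (ha : 0 ≤ a) (hb : 0 < b)
    (ha' : 0 ≤ a') (hb' : 0 ≤ b') (h : a ≤ b ^ (q - 1)) (h' : a' ≤ b' ^ (q - 1)) :
    b ^ q + q * (q - 1) / 8 * (a ^ 2 * b ^ (2 - q)) +
      (q * (q - 1) / 8 * (2 * (a * b ^ (2 - q))) * (a' - a) +
      (q * b ^ (q - 1) + q * (q - 1) / 8 * ((2 - q) * (a ^ 2 * b ^ (1 - q)))) * (b' - b)) ≤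
      b' ^ q + q * (q - 1) / 8 * (a' ^ 2 * b' ^ (2 - q)) := by
  have hq8 : 2 * (2 - q) ^ 2 + (2 - q) * (q - 1) ≤ 8 := by nlinarith
  have hδ0 : 0 ≤ q * (q - 1) / 8 := by nlinarith
  set A := a' - a with hA
  set B := b' - b with hB
  set δ := q * (q - 1) / 8 with hδ
  let α : ℝ → ℝ := fun τ => a + τ * A
  let β : ℝ → ℝ := fun τ => b + τ * B
  have hα : ∀ τ, HasDerivAt α A τ := fun τ => by
    simpa [α] using ((hasDerivAt_id τ).mul_const A).const_add a
  have hβ : ∀ τ, HasDerivAt β B τ := fun τ => by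
    simpa [β] using ((hasDerivAt_id τ).mul_const B).const_add b
  -- The endpoint $b'$ may vanish, so negative powers of $\beta$ are controlled only on $[0,1)$; at
  -- $\tau=1$ continuity takes over.
  have βpos : ∀ τ, 0 ≤ τ → τ < 1 → 0 < β τ := fun τ h0 h1 => by
    have : β τ = (1 - τ) * b + τ * b' := by simp only [β, hB]; ring
    rw [this]
    have := mul_pos (sub_pos.2 h1) hb
    have := mul_nonneg h0 hb'
    linarith
  have αnn : ∀ τ, 0 ≤ τ → τ ≤ 1 → 0 ≤ α τ := fun τ h0 h1 => by
    have : α τ = (1 - τ) * a + τ * a' := by simp only [α, hA]; ring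
    rw [this]
    have := mul_nonneg (sub_nonneg.2 h1) ha
    have := mul_nonneg h0 ha'
    linarith
  have αβ : ∀ τ, 0 ≤ τ → τ ≤ 1 → α τ ≤ β τ ^ (q - 1) := fun τ h0 h1 => by
    have e1 : α τ = (1 - τ) * a + τ * a' := by simp only [α, hA]; ring
    have e2 : β τ = (1 - τ) * b + τ * b' := by simp only [β, hB]; ring
    have := (Real.concaveOn_rpow (p := q - 1) (by linarith) (by linarith)).2
      (Set.mem_Ici.2 hb.le) (Set.mem_Ici.2 hb') (sub_nonneg.2 h1) h0 (by ring)
    simp only [smul_eq_mul] at this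
    rw [e1, e2]
    refine le_trans ?_ this
    exact add_le_add (mul_le_mul_of_nonneg_left h (sub_nonneg.2 h1))
      (mul_le_mul_of_nonneg_left h' h0)
  let f : ℝ → ℝ := fun τ => β τ ^ q + δ * (α τ ^ 2 * β τ ^ (2 - q))
  let f' : ℝ → ℝ := fun τ => B * q * β τ ^ (q - 1) + δ * (2 * α τ * A * β τ ^ (2 - q) +
    α τ ^ 2 * (B * (2 - q) * β τ ^ (1 - q)))
  let f'' : ℝ → ℝ := fun τ => B * q * (B * (q - 1) * β τ ^ (q - 2)) +
    δ * ((2 * A * A * β τ ^ (2 - q) + 2 * α τ * A * (B * (2 - q) * β τ ^ (1 - q))) +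
    (2 * α τ * A * (B * (2 - q) * β τ ^ (1 - q)) +
      α τ ^ 2 * (B * (2 - q) * (B * (1 - q) * β τ ^ (-q)))))
  have rp : ∀ τ, 0 < β τ → ∀ r s : ℝ, r - 1 = s →
      HasDerivAt (fun τ => β τ ^ r) (B * r * β τ ^ s) τ := fun τ hτ r s hs => by
    rw [← hs]; exact (hβ τ).rpow_const (Or.inl hτ.ne')
  have hα2 : ∀ τ, HasDerivAt (fun τ => α τ ^ 2) (2 * α τ * A) τ := fun τ => by
    simpa using (hα τ).fun_pow 2
  have hf : ∀ τ, 0 < β τ → HasDerivAt f (f' τ) τ := fun τ hτ =>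
    (rp τ hτ q (q - 1) rfl).add
      (((hα2 τ).mul (rp τ hτ (2 - q) (1 - q) (by ring))).const_mul δ)
  have hf' : ∀ τ, 0 < β τ → HasDerivAt f' (f'' τ) τ := fun τ hτ =>
    ((rp τ hτ (q - 1) (q - 2) (by ring)).const_mul (B * q)).add
      (((((((hα τ).const_mul 2).mul_const A)).mul (rp τ hτ (2 - q) (1 - q) (by ring))).add
      ((hα2 τ).mul ((rp τ hτ (1 - q) (-q) (by ring)).const_mul (B * (2 - q))))).const_mul δ)
  have hf'' : ∀ τ, 0 ≤ τ → τ < 1 → 0 ≤ f'' τ := fun τ h0 h1 => by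
    have hb0 := βpos τ h0 h1
    have ha0 := αnn τ h0 h1.le
    have hab := αβ τ h0 h1.le
    have hX := Real.rpow_pos_of_pos hb0 (q - 2)
    set X := β τ ^ (q - 2) with hXdef
    have e1 : β τ ^ (2 - q) = X⁻¹ := by rw [hXdef, ← Real.rpow_neg hb0.le]; congr 1; ring
    have e2 : β τ ^ (1 - q) = X⁻¹ * (β τ)⁻¹ := by
      rw [← e1, ← Real.rpow_neg_one (β τ), ← Real.rpow_add hb0]; congr 1; ring
    have e3 : β τ ^ (-q) = X⁻¹ * (β τ)⁻¹ ^ 2 := by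
      rw [sq, ← mul_assoc, ← e2, ← Real.rpow_neg_one (β τ), ← Real.rpow_add hb0]; congr 1; ring
    have e4 : β τ ^ (q - 1) = X * β τ := by
      rw [hXdef, ← Real.rpow_add_one hb0.ne']; congr 1; ring
    -- Homogenising: with $\alpha = w\beta$ and $X=\beta^{q-2}$ the region condition reads $w\le X$,
    -- and $f''$ becomes $\delta X^{-1}$ times a quadratic form in $A, B$.
    obtain ⟨w, hw0, hw⟩ : ∃ w, 0 ≤ w ∧ α τ = w * β τ :=
      ⟨α τ / β τ, div_nonneg ha0 hb0.le, by field_simp⟩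
    have hwX : w ≤ X := by
      rw [e4, hw] at hab
      exact le_of_mul_le_mul_right hab hb0
    -- Complete the square in $A$. The coefficient 8 is $q(q-1)/\delta$; it dominates the negative
    -- remainder $2(2-q)^2+(2-q)(q-1)$ because $w\le X$.
    have key : f'' τ = δ * X⁻¹ * (8 * X ^ 2 * B ^ 2 + 2 * (A + (2 - q) * w * B) ^ 2
        - (2 * (2 - q) ^ 2 + (2 - q) * (q - 1)) * (w ^ 2 * B ^ 2)) := by
      simp only [f'', e1, e2, e3, hw, hδ, ← hXdef]
      field_simp
      ring
    rw [key]
    have hw2 : w ^ 2 ≤ X ^ 2 := pow_le_pow_left₀ hw0 hwX 2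
    have h3 : w ^ 2 * B ^ 2 ≤ X ^ 2 * B ^ 2 := mul_le_mul_of_nonneg_right hw2 (sq_nonneg B)
    have h4 : 2 * (2 - q) ^ 2 + (2 - q) * (q - 1) ≤ 8 := hq8
    have h5 := mul_le_mul_of_nonneg_right h4 (mul_nonneg (sq_nonneg w) (sq_nonneg B))
    have := sq_nonneg (A + (2 - q) * w * B)
    exact mul_nonneg (mul_nonneg hδ0 (inv_nonneg.2 hX.le)) (by linarith)
  have hcont : ContinuousOn f (Set.Icc 0 1) := by
    have hβc : Continuous β := by fun_prop
    have hαc : Continuous α := by fun_prop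
    have := hβc.rpow_const (p := q) fun _ => Or.inr (by linarith)
    have := hβc.rpow_const (p := 2 - q) fun _ => Or.inr (by linarith)
    exact Continuous.continuousOn (by fun_prop)
  have hint : ∀ τ ∈ interior (Set.Icc (0 : ℝ) 1), 0 ≤ τ ∧ τ < 1 := fun τ hτ => by
    rw [interior_Icc] at hτ; exact ⟨hτ.1.le, hτ.2⟩
  have hconv := convexOn_of_hasDerivWithinAt2_nonneg (convex_Icc (0 : ℝ) 1) hcont
    (fun τ hτ => (hf τ (βpos τ (hint τ hτ).1 (hint τ hτ).2)).hasDerivWithinAt)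
    (fun τ hτ => (hf' τ (βpos τ (hint τ hτ).1 (hint τ hτ).2)).hasDerivWithinAt)
    (fun τ hτ => hf'' τ (hint τ hτ).1 (hint τ hτ).2)
  have hs := hconv.le_slope_of_hasDerivAt (x := 0) (y := 1) (by simp) (by simp) one_pos
    (hf 0 (βpos 0 le_rfl one_pos))
  simp only [slope_def_field, f, f', α, β, hA, hB] at hs
  simp only [zero_mul, add_zero, one_mul, add_sub_cancel, sub_zero, div_one] at hs
  rw [hA, hB]
  linarith

/-- The relations between the exponents that are used throughout. -/
theorem rpow_conj_eq (hpq : p.HolderConjugate q) {b : ℝ} (hb : 0 ≤ b) :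
    (b ^ (q - 1)) ^ p = b ^ q ∧ (b ^ (q - 1)) ^ (p - 1) = b := by
  have h1 : (q - 1) * p = q := hpq.symm.sub_one_mul_conj
  have h2 := hpq.mul_eq_add
  constructor
  · rw [← Real.rpow_mul hb, h1]
  · rw [← Real.rpow_mul hb]
    have : (q - 1) * (p - 1) = 1 := by linarith
    rw [this, Real.rpow_one]

theorem le_rpow_conj_iff (hpq : p.HolderConjugate q) {a b : ℝ} (ha : 0 ≤ a) (hb : 0 ≤ b) :
    a ^ p ≤ b ^ q ↔ a ≤ b ^ (q - 1) := by
  rw [← (rpow_conj_eq hpq hb).1]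
  exact Real.rpow_le_rpow_iff ha (Real.rpow_nonneg hb _) hpq.pos

/-- On the interface the two branches and their derivatives agree. -/
theorem interface_eq (hpq : p.HolderConjugate q) {a b : ℝ} (hb : 0 < b)
    (h : a = b ^ (q - 1)) :
    a ^ p = b ^ q ∧ a ^ 2 * b ^ (2 - q) = b ^ q ∧ a * b ^ (2 - q) = a ^ (p - 1) ∧
      a ^ 2 * b ^ (1 - q) = b ^ (q - 1) := by
  subst h
  refine ⟨(rpow_conj_eq hpq hb.le).1, ?_, ?_, ?_⟩
  · rw [sq, ← Real.rpow_add hb, ← Real.rpow_add hb]; congr 1; ring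
  · rw [(rpow_conj_eq hpq hb.le).2, ← Real.rpow_add hb]; ring_nf; exact Real.rpow_one b
  · rw [sq, ← Real.rpow_add hb, ← Real.rpow_add hb]; congr 1; ring

theorem bellmanProfile_nonneg (hp : 2 ≤ p) (hpq : p.HolderConjugate q) (hq2 : q ≤ 2) {a b : ℝ}
    (ha : 0 ≤ a) (hb : 0 ≤ b) : 0 ≤ bellmanProfile p q a b := by
  have hq1 := hpq.symm.lt
  have : 0 ≤ 2 / q - 1 := by rw [sub_nonneg, le_div_iff₀ hpq.symm.pos]; linarith
  have : 0 ≤ q * (q - 1) / 8 := by nlinarith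
  unfold bellmanProfile
  split_ifs <;> positivity

/-- The signs of the two partial derivatives are what allow a tangent plane of the profile to be
composed with functionals bounded by the norms. -/
theorem bellmanProfileFst_nonneg (hp : 2 ≤ p) (hpq : p.HolderConjugate q) {a b : ℝ}
    (ha : 0 ≤ a) (hb : 0 ≤ b) : 0 ≤ bellmanProfileFst p q a b := by
  have hq1 := hpq.symm.lt
  have : 0 ≤ q * (q - 1) / 8 := by nlinarith
  unfold bellmanProfileFst
  split_ifs <;> positivity

theorem bellmanProfileSnd_nonneg (hpq : p.HolderConjugate q) (hq2 : q ≤ 2) {a b : ℝ}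
    (hb : 0 ≤ b) : 0 ≤ bellmanProfileSnd q a b := by
  have hq1 := hpq.symm.lt
  have : 0 ≤ q * (q - 1) / 8 := by nlinarith
  have : 0 ≤ 2 - q := by linarith
  have := hpq.symm.pos
  unfold bellmanProfileSnd
  split_ifs <;> positivity

/-- Support inequality when both points lie in `{a ≤ b ^ (q - 1)}`. -/
theorem bellmanProfile_support_inner (hp : 2 ≤ p) (hpq : p.HolderConjugate q) (hq2 : q ≤ 2)
    {a b a' b' : ℝ} (ha : 0 ≤ a) (hb : 0 ≤ b) (ha' : 0 ≤ a') (hb' : 0 ≤ b')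
    (h : a ≤ b ^ (q - 1)) (h' : a' ≤ b' ^ (q - 1)) :
    bellmanProfile p q a b + (bellmanProfileFst p q a b * (a' - a) +
      bellmanProfileSnd q a b * (b' - b)) ≤ bellmanProfile p q a' b' := by
  have hq1 := hpq.symm.lt
  rcases hb.eq_or_lt with rfl | hb
  · rw [Real.zero_rpow (by linarith)] at h
    obtain rfl : a = 0 := le_antisymm h ha
    have : bellmanProfile p q 0 0 + (bellmanProfileFst p q 0 0 * (a' - 0) +
        bellmanProfileSnd q 0 0 * (b' - 0)) = 0 := by
      simp [bellmanProfile, bellmanProfileFst, bellmanProfileSnd, hpq.ne_zero,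
        hpq.symm.ne_zero, hpq.sub_one_ne_zero, hpq.symm.sub_one_ne_zero]
    rw [this]
    exact bellmanProfile_nonneg hp hpq hq2 ha' hb'
  · have h1 := inner_region_support hq1 hq2 ha hb ha' hb' h h'
    have h2 := rpow_support (by linarith : 1 ≤ p) ha ha'
    simp only [bellmanProfile, bellmanProfileFst, bellmanProfileSnd, if_pos h, if_pos h']
    linarith

/-- Support inequality when both points lie in `{b ^ (q - 1) ≤ a}`. -/
theorem bellmanProfile_support_outer (hp : 2 ≤ p) (hpq : p.HolderConjugate q) (hq2 : q ≤ 2)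
    {a b a' b' : ℝ} (ha : 0 ≤ a) (hb : 0 ≤ b) (ha' : 0 ≤ a') (hb' : 0 ≤ b')
    (h : b ^ (q - 1) ≤ a) (h' : b' ^ (q - 1) ≤ a') :
    bellmanProfile p q a b + (bellmanProfileFst p q a b * (a' - a) +
      bellmanProfileSnd q a b * (b' - b)) ≤ bellmanProfile p q a' b' := by
  have hq1 := hpq.symm.lt
  have hδ : 0 ≤ q * (q - 1) / 8 := by nlinarith
  have hq3 : 0 ≤ 2 / q - 1 := by rw [sub_nonneg, le_div_iff₀ hpq.symm.pos]; linarith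
  have key : ∀ {a b : ℝ}, 0 ≤ a → 0 ≤ b → b ^ (q - 1) ≤ a →
      bellmanProfile p q a b = a ^ p + b ^ q +
        q * (q - 1) / 8 * (2 / p * a ^ p + (2 / q - 1) * b ^ q) ∧
      bellmanProfileFst p q a b = p * a ^ (p - 1) + q * (q - 1) / 8 * (2 * a ^ (p - 1)) ∧
      bellmanProfileSnd q a b = q * b ^ (q - 1) + q * (q - 1) / 8 * ((2 - q) * b ^ (q - 1)) := by
    intro a b ha hb h
    rcases h.lt_or_eq with h | h
    · simp [bellmanProfile, bellmanProfileFst, bellmanProfileSnd, not_le.2 h]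
    · rcases hb.eq_or_lt with rfl | hb
      · rw [Real.zero_rpow (by linarith)] at h
        subst h
        simp [bellmanProfile, bellmanProfileFst, bellmanProfileSnd, hpq.ne_zero,
          hpq.symm.ne_zero, hpq.sub_one_ne_zero, hpq.symm.sub_one_ne_zero]
      -- At equality the definitions select the inner formulas, so first-order agreement on the
      -- interface is needed to use the outer ones.
      · obtain ⟨e1, e2, e3, e4⟩ := interface_eq hpq hb h.symm
        simp only [bellmanProfile, bellmanProfileFst, bellmanProfileSnd, if_pos h.ge]
        rw [e1, e2, e3, e4]
        refine ⟨?_, rfl, rfl⟩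
        have := hpq.inv_add_inv_eq_one
        have e : 2 / p + (2 / q - 1) = 1 := by
          rw [div_eq_mul_inv, div_eq_mul_inv]; linarith
        linear_combination (-(q * (q - 1) / 8 * b ^ q)) * e
  obtain ⟨k1, k2, k3⟩ := key ha hb h
  rw [k1, k2, k3, (key ha' hb' h').1]
  have h1 := rpow_support (by linarith : 1 ≤ p) ha ha'
  have h2 := rpow_support hq1.le hb hb'
  have c1 : 0 ≤ 2 / p := div_nonneg (by norm_num) hpq.nonneg
  have h3 := mul_le_mul_of_nonneg_left h1 (mul_nonneg hδ c1)
  have h4 := mul_le_mul_of_nonneg_left h2 (mul_nonneg hδ hq3)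
  have e1 : 2 / p * p = 2 := div_mul_cancel₀ _ hpq.ne_zero
  have e2 : (2 / q - 1) * q = 2 - q := by
    rw [sub_mul, div_mul_cancel₀ _ hpq.symm.ne_zero]; ring
  -- The outer branch is a nonnegative combination of $a^p$ and $b^q$, so only the tangent
  -- inequalities of these powers matter; the segment itself may leave the region.
  calc _ = (a ^ p + p * a ^ (p - 1) * (a' - a)) + (b ^ q + q * b ^ (q - 1) * (b' - b)) +
        q * (q - 1) / 8 * (2 / p) * (a ^ p + p * a ^ (p - 1) * (a' - a)) +
        q * (q - 1) / 8 * (2 / q - 1) * (b ^ q + q * b ^ (q - 1) * (b' - b)) := by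
        linear_combination (-(q * (q - 1) / 8 * a ^ (p - 1) * (a' - a))) * e1 -
          (q * (q - 1) / 8 * b ^ (q - 1) * (b' - b)) * e2
    _ ≤ a' ^ p + b' ^ q + q * (q - 1) / 8 * (2 / p) * a' ^ p +
        q * (q - 1) / 8 * (2 / q - 1) * b' ^ q := by linarith
    _ = _ := by ring

/-- `bellmanProfile` lies above its tangent planes on the whole quadrant. -/
theorem bellmanProfile_support (hp : 2 ≤ p) (hpq : p.HolderConjugate q) (hq2 : q ≤ 2)
    {a b a' b' : ℝ} (ha : 0 ≤ a) (hb : 0 ≤ b) (ha' : 0 ≤ a') (hb' : 0 ≤ b') :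
    bellmanProfile p q a b + (bellmanProfileFst p q a b * (a' - a) +
      bellmanProfileSnd q a b * (b' - b)) ≤ bellmanProfile p q a' b' := by
  have hq1 := hpq.symm.lt
  have glue : ∀ u v τ : ℝ, 0 ≤ τ → τ ≤ 1 → u = a + τ * (a' - a) → v = b + τ * (b' - b) →
      (bellmanProfile p q a b + (bellmanProfileFst p q a b * (u - a) +
        bellmanProfileSnd q a b * (v - b)) ≤ bellmanProfile p q u v) →
      (bellmanProfile p q u v + (bellmanProfileFst p q u v * (a - u) +
        bellmanProfileSnd q u v * (b - v)) ≤ bellmanProfile p q a b) →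
      (bellmanProfile p q u v + (bellmanProfileFst p q u v * (a' - u) +
        bellmanProfileSnd q u v * (b' - v)) ≤ bellmanProfile p q a' b') →
      bellmanProfile p q a b + (bellmanProfileFst p q a b * (a' - a) +
        bellmanProfileSnd q a b * (b' - b)) ≤ bellmanProfile p q a' b' := by
    intro u v τ h0 h1 hu hv h2 h3 h4
    rcases h0.eq_or_lt with rfl | h0
    · obtain rfl : u = a := by rw [hu]; ring
      obtain rfl : v = b := by rw [hv]; ring
      exact h4
    have hu1 : u - a = τ * (a' - a) := by rw [hu]; ring
    have hv1 : v - b = τ * (b' - b) := by rw [hv]; ring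
    have hu2 : a - u = -(τ * (a' - a)) := by rw [hu]; ring
    have hv2 : b - v = -(τ * (b' - b)) := by rw [hv]; ring
    have hu3 : a' - u = (1 - τ) * (a' - a) := by rw [hu]; ring
    have hv3 : b' - v = (1 - τ) * (b' - b) := by rw [hv]; ring
    rw [hu1, hv1] at h2
    rw [hu2, hv2] at h3
    rw [hu3, hv3] at h4
    set G := bellmanProfileFst p q a b * (a' - a) + bellmanProfileSnd q a b * (b' - b) with hG
    set G' := bellmanProfileFst p q u v * (a' - a) + bellmanProfileSnd q u v * (b' - b) with hG'
    -- Adding the support inequalities in both directions between $(a,b)$ and the crossing point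
    -- $(u,v)$ shows that the slope along the segment increases from $G$ to $G'$.
    have h5 : τ * G ≤ τ * G' := by rw [hG, hG']; linarith
    have h6 : G ≤ G' := le_of_mul_le_mul_left h5 h0
    have h7 := mul_le_mul_of_nonneg_left h6 (sub_nonneg.2 h1)
    have h8 : bellmanProfile p q a b + τ * G ≤ bellmanProfile p q u v := by
      rw [hG]; linarith
    have h9 : bellmanProfile p q u v + (1 - τ) * G' ≤ bellmanProfile p q a' b' := by
      rw [hG']; linarith
    linarith
  -- A zero of $F$ is a crossing of the interface; $F$ has opposite weak signs at the ends when they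
  -- lie in different regions.
  let F : ℝ → ℝ := fun τ => (b + τ * (b' - b)) ^ (q - 1) - (a + τ * (a' - a))
  have hF : ContinuousOn F (Set.uIcc 0 1) := by
    have h1 : Continuous fun τ : ℝ => b + τ * (b' - b) := by fun_prop
    have := h1.rpow_const (p := q - 1) fun _ => Or.inr (by linarith)
    exact Continuous.continuousOn (by fun_prop)
  have mid : (a ≤ b ^ (q - 1) ∧ b' ^ (q - 1) ≤ a' ∨ b ^ (q - 1) ≤ a ∧ a' ≤ b' ^ (q - 1)) →
      ∃ τ, 0 ≤ τ ∧ τ ≤ 1 ∧ (b + τ * (b' - b)) ^ (q - 1) = a + τ * (a' - a) ∧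
        0 ≤ a + τ * (a' - a) ∧ 0 ≤ b + τ * (b' - b) := by
    intro h
    have h0 : (0 : ℝ) ∈ Set.uIcc (F 0) (F 1) := by
      simp only [F, zero_mul, add_zero, one_mul, add_sub_cancel]
      rw [Set.mem_uIcc]
      rcases h with ⟨h1, h2⟩ | ⟨h1, h2⟩
      · right; constructor <;> linarith
      · left; constructor <;> linarith
    obtain ⟨τ, hτ, hz⟩ := intermediate_value_uIcc hF h0
    rw [Set.uIcc_of_le zero_le_one] at hτ
    refine ⟨τ, hτ.1, hτ.2, by simp only [F] at hz; linarith, ?_, ?_⟩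
    · have := mul_nonneg (sub_nonneg.2 hτ.2) ha
      have := mul_nonneg hτ.1 ha'
      linarith
    · have := mul_nonneg (sub_nonneg.2 hτ.2) hb
      have := mul_nonneg hτ.1 hb'
      linarith
  rcases le_total a (b ^ (q - 1)) with h | h <;> rcases le_total a' (b' ^ (q - 1)) with h' | h'
  · exact bellmanProfile_support_inner hp hpq hq2 ha hb ha' hb' h h'
  · obtain ⟨τ, h0, h1, he, hu, hv⟩ := mid (Or.inl ⟨h, h'⟩)
    exact glue _ _ τ h0 h1 rfl rfl
      (bellmanProfile_support_inner hp hpq hq2 ha hb hu hv h he.ge)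
      (bellmanProfile_support_inner hp hpq hq2 hu hv ha hb he.ge h)
      (bellmanProfile_support_outer hp hpq hq2 hu hv ha' hb' he.le h')
  · obtain ⟨τ, h0, h1, he, hu, hv⟩ := mid (Or.inr ⟨h, h'⟩)
    exact glue _ _ τ h0 h1 rfl rfl
      (bellmanProfile_support_outer hp hpq hq2 ha hb hu hv h he.le)
      (bellmanProfile_support_outer hp hpq hq2 hu hv ha hb he.le h)
      (bellmanProfile_support_inner hp hpq hq2 hu hv ha' hb' he.ge h')
  · exact bellmanProfile_support_outer hp hpq hq2 ha hb ha' hb' h h'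

end BellmanConvexity

/-! ### The convex part of the Bellman function on normed spaces -/

section BellmanPhi

variable {E F : Type*} [NormedAddCommGroup E] [NormedAddCommGroup F] {p q : ℝ}

/-- The part `Φ = |ζ|^p + |η|^q + δ Q̃` of the Bellman function, so that `Q = 2 (Z + H) - Φ`. -/
noncomputable def bellmanPhi (p q : ℝ) (ζ : E) (η : F) : ℝ :=
  ‖ζ‖ ^ p + ‖η‖ ^ q + q * (q - 1) / 8 * bellmanQTilde p q ζ η

theorem bellmanQ_eq (ζ : E) (η : F) (Z H : ℝ) :
    bellmanQ p q ζ η Z H = 2 * (Z + H) - bellmanPhi p q ζ η := by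
  unfold bellmanQ bellmanPhi; ring

theorem bellmanPhi_eq_profile (hpq : p.HolderConjugate q) (ζ : E) (η : F) :
    bellmanPhi p q ζ η = bellmanProfile p q ‖ζ‖ ‖η‖ := by
  simp only [bellmanPhi, bellmanProfile, bellmanQTilde,
    le_rpow_conj_iff hpq (norm_nonneg ζ) (norm_nonneg η)]

theorem bellmanPhi_zero (hpq : p.HolderConjugate q) : bellmanPhi p q (0 : E) (0 : F) = 0 := by
  simp [bellmanPhi, bellmanQTilde, hpq.ne_zero, hpq.symm.ne_zero]

theorem sq_mul_rpow_le {a b : ℝ} (hpq : p.HolderConjugate q) (ha : 0 ≤ a) (hb : 0 ≤ b)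
    (h : a ≤ b ^ (q - 1)) : a ^ 2 * b ^ (2 - q) ≤ b ^ q := by
  rcases hb.eq_or_lt with rfl | hb
  · rw [Real.zero_rpow hpq.symm.sub_one_ne_zero] at h
    obtain rfl : a = 0 := le_antisymm h ha
    simp [hpq.symm.ne_zero]
  · calc a ^ 2 * b ^ (2 - q) ≤ (b ^ (q - 1)) ^ 2 * b ^ (2 - q) := by gcongr
      _ = b ^ q := (interface_eq hpq hb rfl).2.1

theorem two_div_conj (hpq : p.HolderConjugate q) (hq2 : q ≤ 2) :
    0 ≤ 2 / p ∧ 0 ≤ 2 / q - 1 ∧ 2 / p + (2 / q - 1) = 1 := by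
  refine ⟨div_nonneg zero_le_two hpq.nonneg, ?_, ?_⟩
  · rw [sub_nonneg, le_div_iff₀ hpq.symm.pos]; linarith
  · have := hpq.inv_add_inv_eq_one
    rw [div_eq_mul_inv, div_eq_mul_inv]; linarith

/-- The outer branch of `Q̃` differs from `Q̃` by at most `|η|^q`. -/
theorem abs_outer_sub_bellmanQTilde_le (hpq : p.HolderConjugate q) (hq2 : q ≤ 2)
    (ζ : E) (η : F) :
    |2 / p * ‖ζ‖ ^ p + (2 / q - 1) * ‖η‖ ^ q - bellmanQTilde p q ζ η| ≤ ‖η‖ ^ q := by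
  obtain ⟨h1, h2, h3⟩ := two_div_conj hpq hq2
  have hb := Real.rpow_nonneg (norm_nonneg η) q
  have ha := Real.rpow_nonneg (norm_nonneg ζ) p
  unfold bellmanQTilde
  split_ifs with h
  · have h4 := sq_mul_rpow_le hpq (norm_nonneg ζ) (norm_nonneg η)
      ((le_rpow_conj_iff hpq (norm_nonneg ζ) (norm_nonneg η)).1 h)
    have h5 : 0 ≤ ‖ζ‖ ^ 2 * ‖η‖ ^ (2 - q) := by positivity
    have h6 : 2 / p * ‖ζ‖ ^ p ≤ 2 / p * ‖η‖ ^ q := mul_le_mul_of_nonneg_left h h1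
    have h7 : 2 / p * ‖η‖ ^ q + (2 / q - 1) * ‖η‖ ^ q = ‖η‖ ^ q := by
      rw [← add_mul, h3, one_mul]
    have := mul_nonneg h1 ha
    have := mul_nonneg h2 hb
    rw [abs_le]; constructor <;> linarith
  · simpa using hb

theorem bellmanPhi_nonneg (hp : 2 ≤ p) (hpq : p.HolderConjugate q) (hq2 : q ≤ 2)
    (ζ : E) (η : F) : 0 ≤ bellmanPhi p q ζ η := by
  rw [bellmanPhi_eq_profile hpq]
  exact bellmanProfile_nonneg hp hpq hq2 (norm_nonneg _) (norm_nonneg _)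

/-- Here $\frac54 = 1+\max\delta$: one has $\delta\le\frac14$ for $q\le2$, and $\widetilde Q$ never
exceeds the sum of the two powers. -/
theorem bellmanPhi_le (hpq : p.HolderConjugate q) (hq2 : q ≤ 2) (ζ : E) (η : F) :
    bellmanPhi p q ζ η ≤ 5 / 4 * (‖ζ‖ ^ p + ‖η‖ ^ q) := by
  obtain ⟨h1, h2, h3⟩ := two_div_conj hpq hq2
  have hq1 := hpq.symm.lt
  have hb := Real.rpow_nonneg (norm_nonneg η) q
  have ha := Real.rpow_nonneg (norm_nonneg ζ) p
  have hδ0 : 0 ≤ q * (q - 1) / 8 := by nlinarith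
  have hδ : q * (q - 1) / 8 ≤ 1 / 4 := by nlinarith
  have hQ : bellmanQTilde p q ζ η ≤ ‖ζ‖ ^ p + ‖η‖ ^ q := by
    unfold bellmanQTilde
    split_ifs with h
    · have h4 := sq_mul_rpow_le hpq (norm_nonneg ζ) (norm_nonneg η)
        ((le_rpow_conj_iff hpq (norm_nonneg ζ) (norm_nonneg η)).1 h)
      linarith
    · have := mul_le_mul_of_nonneg_right (by linarith : 2 / p ≤ 1) ha
      have := mul_le_mul_of_nonneg_right (by linarith : 2 / q - 1 ≤ 1) hb
      linarith
  have := mul_le_mul_of_nonneg_left hQ hδ0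
  have := mul_le_mul_of_nonneg_right hδ (add_nonneg ha hb)
  unfold bellmanPhi
  linarith

/-- The only potentially singular term is $a^2b^{1-q}$ in the inner branch, where $a\le b^{q-1}$
bounds it by $b^{q-1}$. -/
theorem bellmanProfile_gradient_bound (hp : 2 ≤ p) (hpq : p.HolderConjugate q) (hq2 : q ≤ 2)
    (R : ℝ) : ∃ C, 0 ≤ C ∧ ∀ a b : ℝ, 0 ≤ a → a ≤ R → 0 ≤ b → b ≤ R →
      bellmanProfileFst p q a b ≤ C ∧ bellmanProfileSnd q a b ≤ C := by
  have hq1 := hpq.symm.lt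
  have hδ0 : 0 ≤ q * (q - 1) / 8 := by nlinarith
  have h2q : 0 ≤ 2 - q := by linarith
  by_cases hR : 0 ≤ R
  swap
  · exact ⟨0, le_rfl, fun a b ha haR => absurd (ha.trans haR) hR⟩
  have hp0 := hpq.pos
  have hq0 := hpq.symm.pos
  refine ⟨(p * R ^ (p - 1) + q * (q - 1) / 8 * (2 * (R * R ^ (2 - q) + R ^ (p - 1)))) +
    (q * R ^ (q - 1) + q * (q - 1) / 8 * ((2 - q) * R ^ (q - 1))), by positivity,
    fun a b ha haR hb hbR => ?_⟩
  have e1 : a ^ (p - 1) ≤ R ^ (p - 1) := Real.rpow_le_rpow ha haR (by linarith)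
  have e2 : b ^ (q - 1) ≤ R ^ (q - 1) := Real.rpow_le_rpow hb hbR (by linarith)
  have e3 : b ^ (2 - q) ≤ R ^ (2 - q) := Real.rpow_le_rpow hb hbR h2q
  have e4 : a ≤ b ^ (q - 1) → a ^ 2 * b ^ (1 - q) ≤ b ^ (q - 1) := fun h => by
    rcases hb.eq_or_lt with rfl | hb
    · rw [Real.zero_rpow (by linarith)] at h
      obtain rfl : a = 0 := le_antisymm h ha
      simpa using Real.rpow_nonneg le_rfl _
    · calc a ^ 2 * b ^ (1 - q) ≤ (b ^ (q - 1)) ^ 2 * b ^ (1 - q) := by gcongr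
        _ = b ^ (q - 1) := (interface_eq hpq hb rfl).2.2.2
  constructor
  · refine le_trans ?_ (le_add_of_nonneg_right (by positivity))
    unfold bellmanProfileFst
    gcongr
    split_ifs with h
    · exact le_trans (by gcongr) (le_add_of_nonneg_right (by positivity))
    · exact e1.trans (le_add_of_nonneg_left (by positivity))
  · refine le_trans ?_ (le_add_of_nonneg_left (by positivity))
    unfold bellmanProfileSnd
    gcongr
    split_ifs with h
    · exact (e4 h).trans e2
    · exact e2

variable [NormedSpace ℝ E] [NormedSpace ℝ F]

/-- `Φ` has a subgradient at every point, bounded on bounded sets. -/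
theorem bellmanPhi_subgradient (hp : 2 ≤ p) (hpq : p.HolderConjugate q) (hq2 : q ≤ 2)
    (R : ℝ) : ∃ C, 0 ≤ C ∧ ∀ (ζ : E) (η : F), ‖ζ‖ ≤ R → ‖η‖ ≤ R →
      ∃ (σ : E →L[ℝ] ℝ) (τ : F →L[ℝ] ℝ), ‖σ‖ ≤ C ∧ ‖τ‖ ≤ C ∧ ∀ ζ' η',
        bellmanPhi p q ζ η + (σ (ζ' - ζ) + τ (η' - η)) ≤ bellmanPhi p q ζ' η' := by
  obtain ⟨C, hC0, hC⟩ := bellmanProfile_gradient_bound hp hpq hq2 R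
  refine ⟨C, hC0, fun ζ η hζ hη => ?_⟩
  obtain ⟨C1, C2⟩ := hC ‖ζ‖ ‖η‖ (norm_nonneg _) hζ (norm_nonneg _) hη
  have n1 := bellmanProfileFst_nonneg hp hpq (norm_nonneg ζ) (norm_nonneg η)
  have n2 := bellmanProfileSnd_nonneg hpq hq2 (a := ‖ζ‖) (norm_nonneg η)
  -- Hahn-Banach functionals norming $\zeta$ and $\eta$ replace the gradients of the norms, so the
  -- argument also covers the origin.
  obtain ⟨g, hg, hgζ⟩ := exists_dual_vector'' ℝ ζ
  obtain ⟨k, hk, hkη⟩ := exists_dual_vector'' ℝ η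
  refine ⟨bellmanProfileFst p q ‖ζ‖ ‖η‖ • g, bellmanProfileSnd q ‖ζ‖ ‖η‖ • k, ?_, ?_, ?_⟩
  · rw [norm_smul, Real.norm_of_nonneg n1]
    exact (mul_le_of_le_one_right n1 hg).trans C1
  · rw [norm_smul, Real.norm_of_nonneg n2]
    exact (mul_le_of_le_one_right n2 hk).trans C2
  · intro ζ' η'
    have h := bellmanProfile_support hp hpq hq2 (norm_nonneg ζ) (norm_nonneg η)
      (norm_nonneg ζ') (norm_nonneg η')
    have d1 : g ζ' ≤ ‖ζ'‖ := (le_abs_self _).trans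
      ((g.le_opNorm ζ').trans (mul_le_of_le_one_left (norm_nonneg _) hg))
    have d2 : k η' ≤ ‖η'‖ := (le_abs_self _).trans
      ((k.le_opNorm η').trans (mul_le_of_le_one_left (norm_nonneg _) hk))
    simp only [RCLike.ofReal_real_eq_id, id] at hgζ hkη
    have m1 := mul_le_mul_of_nonneg_left (sub_le_sub_right d1 ‖ζ‖) n1
    have m2 := mul_le_mul_of_nonneg_left (sub_le_sub_right d2 ‖η‖) n2
    rw [bellmanPhi_eq_profile hpq, bellmanPhi_eq_profile hpq]
    simp only [smul_apply, map_sub, smul_eq_mul, hgζ, hkη]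
    linarith

-- Locally bounded subgradients make $\Phi$ locally Lipschitz: test the inequality at one point
-- against the other, and conversely.
open Filter Topology in
theorem continuous_bellmanPhi (hp : 2 ≤ p) (hpq : p.HolderConjugate q) (hq2 : q ≤ 2) :
    Continuous fun v : E × F => bellmanPhi p q v.1 v.2 := by
  rw [continuous_iff_continuousAt]
  intro v
  obtain ⟨C, hC0, hC⟩ := bellmanPhi_subgradient (E := E) (F := F) hp hpq hq2 (‖v‖ + 1)
  have bd : ∀ w w' : E × F, ‖w‖ ≤ ‖v‖ + 1 →
      bellmanPhi p q w.1 w.2 - bellmanPhi p q w'.1 w'.2 ≤ 2 * C * ‖w' - w‖ := by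
    intro w w' hw
    obtain ⟨σ, τ, hσ, hτ, h⟩ := hC w.1 w.2 ((norm_fst_le w).trans hw) ((norm_snd_le w).trans hw)
    have h1 := (neg_le_abs _).trans (σ.le_of_opNorm_le hσ (w'.1 - w.1))
    have h2 := (neg_le_abs _).trans (τ.le_of_opNorm_le hτ (w'.2 - w.2))
    have h3 := mul_le_mul_of_nonneg_left (norm_fst_le (w' - w)) hC0
    have h4 := mul_le_mul_of_nonneg_left (norm_snd_le (w' - w)) hC0
    simp only [Prod.fst_sub, Prod.snd_sub] at h3 h4
    have := h w'.1 w'.2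
    linarith
  have hlim : Tendsto (fun w : E × F => 2 * C * ‖w - v‖) (𝓝 v) (𝓝 0) := by
    have : Continuous fun w : E × F => 2 * C * ‖w - v‖ := by fun_prop
    simpa using this.tendsto v
  rw [ContinuousAt, tendsto_iff_norm_sub_tendsto_zero]
  refine squeeze_zero' (Eventually.of_forall fun _ => norm_nonneg _) ?_ hlim
  filter_upwards [Metric.ball_mem_nhds v one_pos] with w hw
  rw [Metric.mem_ball, dist_eq_norm] at hw
  have hwn : ‖w‖ ≤ ‖v‖ + 1 := by
    have := norm_add_le (w - v) v
    rw [sub_add_cancel] at this; linarith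
  rw [Real.norm_eq_abs, abs_le]
  have h1 := bd v w (by linarith)
  have h2 := bd w v hwn
  rw [norm_sub_rev] at h2
  constructor <;> linarith

end BellmanPhi

/-! ### Almost everywhere second differentiability of the composed convex part -/

section AlmostEverywhereTwiceDifferentiable

open MeasureTheory Filter Topology Asymptotics

variable {Z : Type*} [NormedAddCommGroup Z] [NormedSpace ℝ Z]

section Rademacher

variable [FiniteDimensional ℝ Z] [MeasurableSpace Z] [BorelSpace Z] {μ : Measure Z}
  [μ.IsAddHaarMeasure]

/-- Rademacher's theorem for locally Lipschitz functions. -/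
theorem ae_differentiableAt_of_locallyLipschitz {f : Z → ℝ} {O : Set Z}
    (hf : ∀ z ∈ O, ∃ K, ∃ t ∈ 𝓝 z, LipschitzOnWith K f t) :
    ∀ᵐ z ∂μ, z ∈ O → DifferentiableAt ℝ f z := by
  rw [ae_iff]
  refine measure_null_of_locally_null _ fun z hz => ?_
  rw [Set.mem_ofPred_eq, Classical.not_imp] at hz
  obtain ⟨K, t, ht, hK⟩ := hf z hz.1
  refine ⟨interior t ∩ {z | ¬(z ∈ O → DifferentiableAt ℝ f z)},
    Filter.inter_mem (mem_nhdsWithin_of_mem_nhds (interior_mem_nhds.2 ht)) self_mem_nhdsWithin, ?_⟩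
  have := (hK.mono interior_subset).ae_differentiableWithinAt_of_mem (μ := μ)
  refine measure_mono_null (fun w hw => ?_) (ae_iff.1 this)
  rw [Set.mem_ofPred_eq, Classical.not_imp]
  refine ⟨hw.1, fun h => hw.2 fun _ => h.differentiableAt (isOpen_interior.mem_nhds hw.1)⟩

end Rademacher

variable {E F : Type*} [NormedAddCommGroup E] [InnerProductSpace ℝ E]
  [NormedAddCommGroup F] [InnerProductSpace ℝ F] {p q : ℝ}

/-- A zero of $\zeta$ is a minimum of $\|\zeta\|$, so the differential of the norm vanishes there,
which says precisely that $\zeta$ is $o(|w-z|)$. -/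
theorem hasFDerivAt_zero_of_norm {ζ : Z → E} {z : Z} (h0 : ζ z = 0)
    (h : DifferentiableAt ℝ (fun w => ‖ζ w‖) z) : HasFDerivAt ζ (0 : Z →L[ℝ] E) z := by
  have hmin : IsLocalMin (fun w => ‖ζ w‖) z :=
    Eventually.of_forall fun w => by simp [h0]
  have h1 := h.hasFDerivAt
  rw [hmin.fderiv_eq_zero] at h1
  have h2 := h1.isLittleO
  refine HasFDerivAt.of_isLittleO ?_
  refine (isLittleO_norm_left.1 ?_)
  simpa [h0] using isLittleO_norm_left.2 h2

/-- The differential of `‖ζ‖²`. -/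
noncomputable def normSqDeriv (ζ : Z → E) (z : Z) : Z →L[ℝ] ℝ :=
  2 • (innerSL ℝ (ζ z)).comp (fderiv ℝ ζ z)

theorem hasFDerivAt_normSq {ζ : Z → E} {z : Z} (h : DifferentiableAt ℝ ζ z) :
    HasFDerivAt (fun w => ‖ζ w‖ ^ 2) (normSqDeriv ζ z) z := h.hasFDerivAt.norm_sq

theorem norm_normSqDeriv_le (ζ : Z → E) (z : Z) :
    ‖normSqDeriv ζ z‖ ≤ 2 * (‖ζ z‖ * ‖fderiv ℝ ζ z‖) := by
  have h := ContinuousLinearMap.opNorm_comp_le (innerSL ℝ (ζ z)) (fderiv ℝ ζ z)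
  rw [innerSL_apply_norm] at h
  unfold normSqDeriv
  refine (norm_nsmul_le).trans ?_
  simpa using h

theorem normSqDeriv_eq_zero {ζ : Z → E} {z : Z} (h : ζ z = 0) : normSqDeriv ζ z = 0 := by
  simp [normSqDeriv, h]

theorem differentiableAt_normSqDeriv {ζ : Z → E} {z : Z} (h : DifferentiableAt ℝ ζ z)
    (h' : DifferentiableAt ℝ (fderiv ℝ ζ) z) : DifferentiableAt ℝ (normSqDeriv ζ) z := by
  have h1 : DifferentiableAt ℝ (fun w => innerSL ℝ (ζ w)) z :=
    (innerSL ℝ).differentiableAt.comp z h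
  have h2 : DifferentiableAt ℝ (fun w => (innerSL ℝ (ζ w)).comp (fderiv ℝ ζ w)) z := h1.clm_comp h'
  have h3 := h2.const_smul (2 : ℝ)
  refine h3.congr_of_eventuallyEq (Eventually.of_forall fun w => ?_)
  ext v
  simp [normSqDeriv]

theorem sq_rpow_half {x r s : ℝ} (hx : 0 ≤ x) (h : s = 2 * r) : (x ^ 2) ^ r = x ^ s := by
  rw [← Real.rpow_natCast, ← Real.rpow_mul hx, h]; norm_num

/-- The differential of `‖ζ‖^r`, at a point where `ζ ≠ 0`. -/
theorem hasFDerivAt_norm_rpow_of_ne {ζ : Z → E} {z : Z} (h : DifferentiableAt ℝ ζ z)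
    (h0 : ζ z ≠ 0) (r : ℝ) :
    HasFDerivAt (fun w => ‖ζ w‖ ^ r) ((r / 2 * ‖ζ z‖ ^ (r - 2)) • normSqDeriv ζ z) z := by
  have h1 := (hasFDerivAt_normSq h).rpow_const (p := r / 2)
    (Or.inl (pow_ne_zero 2 (norm_ne_zero_iff.2 h0)))
  rw [sq_rpow_half (norm_nonneg _) (s := r - 2) (by ring)] at h1
  refine h1.congr_of_eventuallyEq (Eventually.of_forall fun w => ?_)
  exact (sq_rpow_half (norm_nonneg _) (by ring)).symm

theorem hasFDerivAt_norm_rpow_comp {ζ : Z → E} {z : Z} (h : DifferentiableAt ℝ ζ z)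
    {r : ℝ} (hr : 1 < r) :
    HasFDerivAt (fun w => ‖ζ w‖ ^ r) ((r / 2 * ‖ζ z‖ ^ (r - 2)) • normSqDeriv ζ z) z := by
  by_cases h0 : ζ z = 0
  swap
  · exact hasFDerivAt_norm_rpow_of_ne h h0 r
  rw [normSqDeriv_eq_zero h0, smul_zero]
  have h1 := (hasFDerivAt_norm_rpow (ζ z) hr).comp z h.hasFDerivAt
  simpa [h0, Function.comp_def] using h1

/-- Meant for interface points, where nearby points may switch branch arbitrarily: a common value
and a common differential are enough. -/
theorem hasFDerivAt_of_eq_or {f A B : Z → ℝ} {D : Z →L[ℝ] ℝ} {z : Z} (hA : HasFDerivAt A D z)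
    (hB : HasFDerivAt B D z) (hfA : A z = f z) (hfB : B z = f z)
    (h : ∀ w, f w = A w ∨ f w = B w) : HasFDerivAt f D z := by
  refine HasFDerivAt.of_isLittleO (isLittleO_iff.2 fun c hc => ?_)
  filter_upwards [isLittleO_iff.1 hA.isLittleO hc, isLittleO_iff.1 hB.isLittleO hc] with w h1 h2
  rcases h w with h | h
  · rwa [h, ← hfA]
  · rwa [h, ← hfB]

/-- The coefficient of the differential of `‖ζ‖²` in that of `Φ(ζ, η)`. -/
noncomputable def phiCoeffFst (p q a b : ℝ) : ℝ :=
  p / 2 * a ^ (p - 2) + q * (q - 1) / 8 * max (a ^ (p - 2)) (b ^ (2 - q))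

/-- The coefficient of the differential of `‖η‖²` in that of `Φ(ζ, η)`. -/
noncomputable def phiCoeffSnd (q a b : ℝ) : ℝ :=
  q / 2 * b ^ (q - 2) + q * (q - 1) / 8 * ((1 - q / 2) * min (a ^ 2 * b ^ (-q)) (b ^ (q - 2)))

/-- The two arguments of the maximum in `phiCoeffFst`, and of the minimum in `phiCoeffSnd`, cross
exactly on the interface $a=b^{q-1}$; hence these expressions select the correct branch without a
case distinction. -/
theorem rpow_compare (hpq : p.HolderConjugate q) {b : ℝ} (hb : 0 < b) :
    (b ^ (q - 1)) ^ (p - 2) = b ^ (2 - q) ∧ (b ^ (q - 1)) ^ 2 * b ^ (-q) = b ^ (q - 2) := by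
  constructor
  · rw [← Real.rpow_mul hb.le]
    congr 1
    have := hpq.mul_eq_add
    linarith
  · rw [sq, ← Real.rpow_add hb, ← Real.rpow_add hb]; congr 1; ring

theorem hasFDerivAt_bellmanQTilde_of_ne (hp : 2 ≤ p) (hpq : p.HolderConjugate q)
    {ζ : Z → E} {η : Z → F} {z : Z} (hζ : DifferentiableAt ℝ ζ z) (hη : DifferentiableAt ℝ η z)
    (h0 : η z ≠ 0) :
    HasFDerivAt (fun w => bellmanQTilde p q (ζ w) (η w))
      (max (‖ζ z‖ ^ (p - 2)) (‖η z‖ ^ (2 - q)) • normSqDeriv ζ z +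
        ((1 - q / 2) * min (‖ζ z‖ ^ 2 * ‖η z‖ ^ (-q)) (‖η z‖ ^ (q - 2))) • normSqDeriv η z) z := by
  have hb : 0 < ‖η z‖ := norm_pos_iff.2 h0
  have ha := norm_nonneg (ζ z)
  set D := max (‖ζ z‖ ^ (p - 2)) (‖η z‖ ^ (2 - q)) • normSqDeriv ζ z +
        ((1 - q / 2) * min (‖ζ z‖ ^ 2 * ‖η z‖ ^ (-q)) (‖η z‖ ^ (q - 2))) • normSqDeriv η z with hD
  obtain ⟨c1, c2⟩ := rpow_compare hpq hb
  have hA : ‖ζ z‖ ≤ ‖η z‖ ^ (q - 1) →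
      HasFDerivAt (fun w => ‖ζ w‖ ^ 2 * ‖η w‖ ^ (2 - q)) D z := by
    intro h
    have := (hasFDerivAt_normSq hζ).mul (hasFDerivAt_norm_rpow_of_ne hη h0 (2 - q))
    have m1 : ‖ζ z‖ ^ (p - 2) ≤ ‖η z‖ ^ (2 - q) := by
      rw [← c1]; exact Real.rpow_le_rpow ha h (by linarith)
    have m2 : ‖ζ z‖ ^ 2 * ‖η z‖ ^ (-q) ≤ ‖η z‖ ^ (q - 2) := by
      rw [← c2]; gcongr
    convert! this using 1
    rw [hD, max_eq_right m1, min_eq_left m2, add_comm, smul_smul,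
      (by ring : 2 - q - 2 = -q)]
    congr 2
    ring
  have hB : ‖η z‖ ^ (q - 1) ≤ ‖ζ z‖ →
      HasFDerivAt (fun w => 2 / p * ‖ζ w‖ ^ p + (2 / q - 1) * ‖η w‖ ^ q) D z := by
    intro h
    have := ((hasFDerivAt_norm_rpow_comp hζ (by linarith : 1 < p)).const_mul (2 / p)).add
      ((hasFDerivAt_norm_rpow_comp hη hpq.symm.lt).const_mul (2 / q - 1))
    have hb' := Real.rpow_nonneg hb.le (q - 1)
    have m1 : ‖η z‖ ^ (2 - q) ≤ ‖ζ z‖ ^ (p - 2) := by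
      rw [← c1]; exact Real.rpow_le_rpow hb' h (by linarith)
    have m2 : ‖η z‖ ^ (q - 2) ≤ ‖ζ z‖ ^ 2 * ‖η z‖ ^ (-q) := by
      rw [← c2]; gcongr
    convert! this using 1
    rw [hD, max_eq_left m1, min_eq_right m2, smul_smul, smul_smul]
    have hp0 := hpq.ne_zero
    have hq0 := hpq.symm.ne_zero
    congr 2
    · field_simp
    · field_simp
  have hiff : ∀ w, ‖ζ w‖ ^ p ≤ ‖η w‖ ^ q ↔ ‖ζ w‖ ≤ ‖η w‖ ^ (q - 1) := fun w =>
    le_rpow_conj_iff hpq (norm_nonneg _) (norm_nonneg _)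
  have hcη : ContinuousAt (fun w => ‖η w‖ ^ (q - 1)) z :=
    hη.continuousAt.norm.rpow_const (Or.inl hb.ne')
  rcases lt_trichotomy ‖ζ z‖ (‖η z‖ ^ (q - 1)) with h | h | h
  · refine (hA h.le).congr_of_eventuallyEq ?_
    filter_upwards [hζ.continuousAt.norm.eventually_lt hcη h] with w hw
    simp only [bellmanQTilde, if_pos ((hiff w).2 hw.le)]
  · obtain ⟨e1, e2, -, -⟩ := interface_eq hpq hb h
    refine hasFDerivAt_of_eq_or (hA h.le) (hB h.ge) ?_ ?_ fun w => ?_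
    · simp only [bellmanQTilde, if_pos ((hiff z).2 h.le)]
    · simp only [bellmanQTilde, if_pos ((hiff z).2 h.le)]
      rw [e1, e2, ← add_mul]
      have := hpq.inv_add_inv_eq_one
      rw [div_eq_mul_inv, div_eq_mul_inv]
      linear_combination (2 * ‖η z‖ ^ q) * this
    · unfold bellmanQTilde
      split_ifs
      · exact Or.inl rfl
      · exact Or.inr rfl
  · refine (hB h.le).congr_of_eventuallyEq ?_
    filter_upwards [hcη.eventually_lt hζ.continuousAt.norm h] with w hw
    simp only [bellmanQTilde, if_neg (fun h' => (not_le.2 hw) ((hiff w).1 h'))]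

/-- `Φ(ζ, η)` is differentiable wherever `ζ` and `η` are. -/
theorem hasFDerivAt_bellmanPhi (hp : 2 ≤ p) (hpq : p.HolderConjugate q) (hq2 : q ≤ 2)
    {ζ : Z → E} {η : Z → F} {z : Z} (hζ : DifferentiableAt ℝ ζ z) (hη : DifferentiableAt ℝ η z) :
    HasFDerivAt (fun w => bellmanPhi p q (ζ w) (η w))
      (phiCoeffFst p q ‖ζ z‖ ‖η z‖ • normSqDeriv ζ z +
        phiCoeffSnd q ‖ζ z‖ ‖η z‖ • normSqDeriv η z) z := by
  have d1 := hasFDerivAt_norm_rpow_comp hζ (by linarith : 1 < p)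
  have d2 := hasFDerivAt_norm_rpow_comp hη hpq.symm.lt
  suffices HasFDerivAt (fun w => bellmanQTilde p q (ζ w) (η w))
      (max (‖ζ z‖ ^ (p - 2)) (‖η z‖ ^ (2 - q)) • normSqDeriv ζ z +
        ((1 - q / 2) * min (‖ζ z‖ ^ 2 * ‖η z‖ ^ (-q)) (‖η z‖ ^ (q - 2))) •
          normSqDeriv η z) z by
    convert! (d1.add d2).add (this.const_mul (q * (q - 1) / 8)) using 1
    unfold phiCoeffFst phiCoeffSnd
    module
  by_cases h0 : η z = 0
  swap
  · exact hasFDerivAt_bellmanQTilde_of_ne hp hpq hζ hη h0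
  -- The case $q=2$ is separate because $0^0=1$; then $p=2$ and both arguments equal 1.
  have hmax : max (‖ζ z‖ ^ (p - 2)) (‖η z‖ ^ (2 - q)) = ‖ζ z‖ ^ (p - 2) := by
    rcases hq2.eq_or_lt with hq | hq
    · have : p = 2 := by have := hpq.mul_eq_add; rw [hq] at this; linarith
      rw [hq, this]; simp
    · rw [h0, norm_zero, Real.zero_rpow (by linarith)]
      exact max_eq_left (Real.rpow_nonneg (norm_nonneg _) _)
  rw [normSqDeriv_eq_zero h0, smul_zero] at d2
  rw [normSqDeriv_eq_zero h0, smul_zero, add_zero, hmax]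
  have dB := (d1.const_mul (2 / p)).add (d2.const_mul (2 / q - 1))
  -- Where $\eta=0$, the power $\|\eta\|^q$ has zero differential, and it dominates the error of
  -- replacing $\widetilde Q$ by its outer branch.
  have small : HasFDerivAt (fun w => 2 / p * ‖ζ w‖ ^ p + (2 / q - 1) * ‖η w‖ ^ q -
      bellmanQTilde p q (ζ w) (η w)) (0 : Z →L[ℝ] ℝ) z := by
    have h2 := d2.isLittleO
    have hz : ‖η z‖ ^ q = 0 := by rw [h0, norm_zero, Real.zero_rpow hpq.symm.ne_zero]
    have hz' := abs_outer_sub_bellmanQTilde_le hpq hq2 (ζ z) (η z)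
    have hz'' := abs_eq_zero.1 (le_antisymm (hz'.trans_eq hz) (abs_nonneg _))
    refine HasFDerivAt.of_isLittleO (IsBigO.trans_isLittleO ?_ h2)
    refine IsBigO.of_bound 1 (Eventually.of_forall fun w => ?_)
    rw [hz'', hz]
    simp only [sub_zero, zero_apply, one_mul]
    rw [Real.norm_eq_abs, Real.norm_of_nonneg (Real.rpow_nonneg (norm_nonneg _) _)]
    exact abs_outer_sub_bellmanQTilde_le hpq hq2 _ _
  convert! dB.sub small using 1
  · ext w; simp
  · have := hpq.ne_zero
    rw [smul_zero, add_zero, sub_zero, smul_smul]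
    congr 1
    field_simp

theorem contDiffAt_one_of_differentiableAt {G : Type*} [NormedAddCommGroup G] [NormedSpace ℝ G]
    {f : Z → G} {U : Set Z} (hU : IsOpen U)
    (h1 : ∀ z ∈ U, DifferentiableAt ℝ f z) (h2 : ∀ z ∈ U, DifferentiableAt ℝ (fderiv ℝ f) z)
    {z : Z} (hz : z ∈ U) : ContDiffAt ℝ 1 f z :=
  contDiffAt_one_iff.2 ⟨fderiv ℝ f, U, hU.mem_nhds hz,
    fun w hw => (h2 w hw).continuousAt.continuousWithinAt, fun w hw => (h1 w hw).hasFDerivAt⟩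

/-- Together with Rademacher's theorem this gives differentiability almost everywhere without
examining the coincidence set. -/
theorem exists_lipschitzOnWith_max {f g : Z → ℝ} {z : Z} (hf : ContDiffAt ℝ 1 f z)
    (hg : ContDiffAt ℝ 1 g z) :
    ∃ K, ∃ t ∈ 𝓝 z, LipschitzOnWith K (fun w => max (f w) (g w)) t := by
  obtain ⟨K, t, ht, h1⟩ := hf.exists_lipschitzOnWith
  obtain ⟨L, s, hs, h2⟩ := hg.exists_lipschitzOnWith
  refine ⟨max K L, t ∩ s, inter_mem ht hs, LipschitzOnWith.of_dist_le_mul fun x hx y hy => ?_⟩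
  have e1 := h1.dist_le_mul x hx.1 y hy.1
  have e2 := h2.dist_le_mul x hx.2 y hy.2
  have e3 : (K : ℝ) ≤ (max K L : NNReal) := by exact_mod_cast le_max_left K L
  have e4 : (L : ℝ) ≤ (max K L : NNReal) := by exact_mod_cast le_max_right K L
  rw [Real.dist_eq] at e1 e2 ⊢
  refine (abs_max_sub_max_le_max _ _ _ _).trans (max_le (e1.trans ?_) (e2.trans ?_)) <;> gcongr

/-- At a zero of $\zeta$ the coefficient is only continuous, hence bounded nearby, but $D|\zeta|^2$
is $o(|w-z|)$ because $\zeta$ is $o(|w-z|)$ and $D\zeta$ is bounded. Elsewhere the product rule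
applies; if $\eta$ vanishes there, the maximum is locally its first argument. -/
theorem differentiableAt_phiCoeffFst_smul (hp : 2 ≤ p) (hpq : p.HolderConjugate q) (hq2 : q ≤ 2)
    {ζ : Z → E} {η : Z → F} {z : Z} (hζ : DifferentiableAt ℝ ζ z) (hη : DifferentiableAt ℝ η z)
    (hζ' : DifferentiableAt ℝ (fderiv ℝ ζ) z)
    (h0 : ζ z = 0 → HasFDerivAt ζ (0 : Z →L[ℝ] E) z)
    (hmax : ζ z ≠ 0 → η z ≠ 0 →
      DifferentiableAt ℝ (fun w => max (‖ζ w‖ ^ (p - 2)) (‖η w‖ ^ (2 - q))) z) :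
    DifferentiableAt ℝ (fun w => phiCoeffFst p q ‖ζ w‖ ‖η w‖ • normSqDeriv ζ w) z := by
  by_cases hz : ζ z = 0
  · have hα : ContinuousAt (fun w => phiCoeffFst p q ‖ζ w‖ ‖η w‖) z := by
      have c1 : ContinuousAt (fun w => ‖ζ w‖ ^ (p - 2)) z :=
        hζ.continuousAt.norm.rpow_const (Or.inr (by linarith))
      have c2 : ContinuousAt (fun w => ‖η w‖ ^ (2 - q)) z :=
        hη.continuousAt.norm.rpow_const (Or.inr (by linarith))
      exact (c1.const_mul _).add ((c1.max c2).const_mul _)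
    have o1 : ζ =o[𝓝 z] fun w => w - z := by
      simpa [hz] using (h0 hz).isLittleO
    have o2 : (normSqDeriv ζ) =o[𝓝 z] fun w => w - z := by
      have : (fun w => 2 * (‖ζ w‖ * ‖fderiv ℝ ζ w‖)) =o[𝓝 z] fun w => ‖w - z‖ * (1 : ℝ) :=
        (o1.norm_norm.mul_isBigO (hζ'.continuousAt.norm.isBigO_one ℝ)).const_mul_left 2
      simp only [mul_one] at this
      refine IsBigO.trans_isLittleO (IsBigO.of_bound 1 (Eventually.of_forall fun w => ?_))
        this.of_norm_right
      rw [one_mul, Real.norm_of_nonneg (by positivity)]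
      exact norm_normSqDeriv_le ζ w
    have o3 : (fun w => phiCoeffFst p q ‖ζ w‖ ‖η w‖ • normSqDeriv ζ w) =o[𝓝 z]
        fun w => w - z := by
      have := (hα.isBigO_one ℝ).smul_isLittleO o2
      simpa using this
    have : HasFDerivAt (fun w => phiCoeffFst p q ‖ζ w‖ ‖η w‖ • normSqDeriv ζ w)
        (0 : Z →L[ℝ] (Z →L[ℝ] ℝ)) z := by
      refine HasFDerivAt.of_isLittleO ?_
      simpa [normSqDeriv_eq_zero hz] using o3
    exact this.differentiableAt
  · refine DifferentiableAt.fun_smul ?_ (differentiableAt_normSqDeriv hζ hζ')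
    have d1 := (hasFDerivAt_norm_rpow_of_ne hζ hz (p - 2)).differentiableAt
    have d2 : DifferentiableAt ℝ (fun w => max (‖ζ w‖ ^ (p - 2)) (‖η w‖ ^ (2 - q))) z := by
      by_cases hη0 : η z = 0
      · refine d1.congr_of_eventuallyEq ?_
        rcases hq2.eq_or_lt with hq | hq
        · have : p = 2 := by have := hpq.mul_eq_add; rw [hq] at this; linarith
          rw [hq, this]; simp
        · have c2 : ContinuousAt (fun w => ‖η w‖ ^ (2 - q)) z :=
            hη.continuousAt.norm.rpow_const (Or.inr (by linarith))
          have : ‖η z‖ ^ (2 - q) < ‖ζ z‖ ^ (p - 2) := by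
            rw [hη0, norm_zero, Real.zero_rpow (by linarith)]
            exact Real.rpow_pos_of_pos (norm_pos_iff.2 hz) _
          filter_upwards [c2.eventually_lt d1.continuousAt this] with w hw
          exact max_eq_left hw.le
      · exact hmax hz hη0
    exact (d1.const_mul _).add (d2.const_mul _)

/-- At a zero of $\eta$ the coefficient may blow up like $|\eta|^{q-2}$. Multiplied by the factor
$|\eta|$ from $D|\eta|^2$ it is still $O(|\eta|^{q-1})=o(1)$, and the remaining factor $D\eta$ is
$O(|w-z|)$ because it vanishes at $z$. -/
theorem differentiableAt_phiCoeffSnd_smul (hpq : p.HolderConjugate q) (hq2 : q ≤ 2)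
    {ζ : Z → E} {η : Z → F} {z : Z} (hη : DifferentiableAt ℝ η z)
    (hη' : DifferentiableAt ℝ (fderiv ℝ η) z)
    (h0 : η z = 0 → fderiv ℝ η z = 0)
    (hmin : η z ≠ 0 →
      DifferentiableAt ℝ (fun w => min (‖ζ w‖ ^ 2 * ‖η w‖ ^ (-q)) (‖η w‖ ^ (q - 2))) z) :
    DifferentiableAt ℝ (fun w => phiCoeffSnd q ‖ζ w‖ ‖η w‖ • normSqDeriv η w) z := by
  have hq1 := hpq.symm.lt
  by_cases hz : η z = 0
  · have bound : ∀ a b : ℝ, 0 ≤ a → 0 ≤ b → |phiCoeffSnd q a b| * b ≤ 2 * b ^ (q - 1) := by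
      intro a b ha hb
      rcases hb.eq_or_lt with rfl | hb
      · simpa using Real.rpow_nonneg le_rfl (q - 1)
      · have e : b ^ (q - 1) = b ^ (q - 2) * b := by
          rw [← Real.rpow_add_one hb.ne']; congr 1; ring
        have hX := Real.rpow_pos_of_pos hb (q - 2)
        have hm0 : 0 ≤ min (a ^ 2 * b ^ (-q)) (b ^ (q - 2)) := le_min (by positivity) hX.le
        have hm1 := min_le_right (a ^ 2 * b ^ (-q)) (b ^ (q - 2))
        have hδ0 : 0 ≤ q * (q - 1) / 8 := by nlinarith
        have hδ : q * (q - 1) / 8 ≤ 1 := by nlinarith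
        have h2 : 0 ≤ 1 - q / 2 := by linarith
        have h3 : 0 ≤ phiCoeffSnd q a b := by unfold phiCoeffSnd; positivity
        rw [abs_of_nonneg h3, e, ← mul_assoc]
        refine mul_le_mul_of_nonneg_right ?_ hb.le
        unfold phiCoeffSnd
        have h4 : (1 - q / 2) * min (a ^ 2 * b ^ (-q)) (b ^ (q - 2)) ≤ 1 * b ^ (q - 2) :=
          mul_le_mul (by linarith) hm1 hm0 zero_le_one
        have h5 := mul_le_mul hδ h4 (mul_nonneg h2 hm0) zero_le_one
        have h6 := mul_le_mul_of_nonneg_right (by linarith : q / 2 ≤ 1) hX.le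
        linarith
    have t0 : Tendsto (fun w => ‖η w‖ ^ (q - 1)) (𝓝 z) (𝓝 0) := by
      have : ContinuousAt (fun w => ‖η w‖ ^ (q - 1)) z :=
        hη.continuousAt.norm.rpow_const (Or.inr (by linarith))
      simpa [ContinuousAt, hz, Real.zero_rpow hpq.symm.sub_one_ne_zero] using this
    have o1 : (fun w => ‖η w‖ ^ (q - 1)) =o[𝓝 z] fun _ => (1 : ℝ) := (isLittleO_one_iff ℝ).2 t0
    have o2 : (fderiv ℝ η) =O[𝓝 z] fun w => w - z := by
      simpa [h0 hz] using hη'.isBigO_sub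
    have o3 : (fun w => phiCoeffSnd q ‖ζ w‖ ‖η w‖ • normSqDeriv η w) =o[𝓝 z]
        fun w => w - z := by
      have : (fun w => 4 * (‖η w‖ ^ (q - 1) * ‖fderiv ℝ η w‖)) =o[𝓝 z]
          fun w => (1 : ℝ) * ‖w - z‖ :=
        (o1.mul_isBigO o2.norm_norm).const_mul_left 4
      simp only [one_mul] at this
      refine IsBigO.trans_isLittleO (IsBigO.of_bound 1 (Eventually.of_forall fun w => ?_))
        this.of_norm_right
      rw [one_mul, Real.norm_of_nonneg (by positivity), norm_smul, Real.norm_eq_abs]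
      calc _ ≤ |phiCoeffSnd q ‖ζ w‖ ‖η w‖| * (2 * (‖η w‖ * ‖fderiv ℝ η w‖)) := by
            gcongr; exact norm_normSqDeriv_le η w
        _ = 2 * (|phiCoeffSnd q ‖ζ w‖ ‖η w‖| * ‖η w‖) * ‖fderiv ℝ η w‖ := by ring
        _ ≤ 2 * (2 * ‖η w‖ ^ (q - 1)) * ‖fderiv ℝ η w‖ := by
            refine mul_le_mul_of_nonneg_right (mul_le_mul_of_nonneg_left ?_ zero_le_two)
              (norm_nonneg _)
            exact bound _ _ (norm_nonneg _) (norm_nonneg _)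
        _ = _ := by ring
    have : HasFDerivAt (fun w => phiCoeffSnd q ‖ζ w‖ ‖η w‖ • normSqDeriv η w)
        (0 : Z →L[ℝ] (Z →L[ℝ] ℝ)) z := by
      refine HasFDerivAt.of_isLittleO ?_
      simpa [normSqDeriv_eq_zero hz] using o3
    exact this.differentiableAt
  · refine DifferentiableAt.fun_smul ?_ (differentiableAt_normSqDeriv hη hη')
    have d1 := (hasFDerivAt_norm_rpow_of_ne hη hz (q - 2)).differentiableAt
    exact (d1.const_mul _).add (((hmin hz).const_mul _).const_mul _)

section

variable [FiniteDimensional ℝ Z] [MeasurableSpace Z] [BorelSpace Z] {μ : Measure Z}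
  [μ.IsAddHaarMeasure]

/-- The differential of a `C¹` map vanishes at almost every zero of the map. -/
theorem ae_hasFDerivAt_zero {ζ : Z → E} {U : Set Z} (hζ : ∀ z ∈ U, ContDiffAt ℝ 1 ζ z) :
    ∀ᵐ z ∂μ, z ∈ U → ζ z = 0 → HasFDerivAt ζ (0 : Z →L[ℝ] E) z := by
  have : ∀ᵐ z ∂μ, z ∈ U → DifferentiableAt ℝ (fun w => ‖ζ w‖) z := by
    refine ae_differentiableAt_of_locallyLipschitz fun z hz => ?_
    obtain ⟨K, t, ht, h⟩ := (hζ z hz).exists_lipschitzOnWith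
    exact ⟨1 * K, t, ht, (lipschitzWith_one_norm : LipschitzWith 1 (norm : E → ℝ)).comp_lipschitzOnWith h⟩
  filter_upwards [this] with z hz hzU h0
  exact hasFDerivAt_zero_of_norm h0 (hz hzU)

/-- `Φ(ζ, η)` is twice differentiable almost everywhere when `ζ` and `η` are twice
differentiable. -/
theorem ae_twiceDifferentiableAt_bellmanPhi (hp : 2 ≤ p) (hpq : p.HolderConjugate q)
    (hq2 : q ≤ 2) {ζ : Z → E} {η : Z → F} {U : Set Z} (hU : IsOpen U)
    (hζ : ∀ z ∈ U, DifferentiableAt ℝ ζ z) (hζ' : ∀ z ∈ U, DifferentiableAt ℝ (fderiv ℝ ζ) z)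
    (hη : ∀ z ∈ U, DifferentiableAt ℝ η z) (hη' : ∀ z ∈ U, DifferentiableAt ℝ (fderiv ℝ η) z) :
    ∀ᵐ z ∂μ, z ∈ U → TwiceDifferentiableAt (fun w => bellmanPhi p q (ζ w) (η w)) z := by
  have cζ : ∀ z ∈ U, ContDiffAt ℝ 1 ζ z := fun z hz =>
    contDiffAt_one_of_differentiableAt hU hζ hζ' hz
  have cη : ∀ z ∈ U, ContDiffAt ℝ 1 η z := fun z hz =>
    contDiffAt_one_of_differentiableAt hU hη hη' hz
  have rζ : ∀ z ∈ U, ζ z ≠ 0 → ∀ r : ℝ, ContDiffAt ℝ 1 (fun w => ‖ζ w‖ ^ r) z :=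
    fun z hz h0 r => ((cζ z hz).norm ℝ h0).rpow_const_of_ne (norm_ne_zero_iff.2 h0)
  have rη : ∀ z ∈ U, η z ≠ 0 → ∀ r : ℝ, ContDiffAt ℝ 1 (fun w => ‖η w‖ ^ r) z :=
    fun z hz h0 r => ((cη z hz).norm ℝ h0).rpow_const_of_ne (norm_ne_zero_iff.2 h0)
  have hmax : ∀ᵐ z ∂μ, z ∈ {z | z ∈ U ∧ ζ z ≠ 0 ∧ η z ≠ 0} →
      DifferentiableAt ℝ (fun w => max (‖ζ w‖ ^ (p - 2)) (‖η w‖ ^ (2 - q))) z :=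
    ae_differentiableAt_of_locallyLipschitz fun z hz =>
      exists_lipschitzOnWith_max (rζ z hz.1 hz.2.1 _) (rη z hz.1 hz.2.2 _)
  -- The minimum is treated as the negative of a maximum of negatives. Only $\eta\ne0$ is required,
  -- since $\zeta$ enters through the smooth $\|\zeta\|^2$.
  have hmin : ∀ᵐ z ∂μ, z ∈ {z | z ∈ U ∧ η z ≠ 0} →
      DifferentiableAt ℝ (fun w => max (-(‖ζ w‖ ^ 2 * ‖η w‖ ^ (-q))) (-‖η w‖ ^ (q - 2))) z :=
    ae_differentiableAt_of_locallyLipschitz fun z hz =>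
      exists_lipschitzOnWith_max
        (((cζ z hz.1).norm_sq ℝ).mul (rη z hz.1 hz.2 _)).neg (rη z hz.1 hz.2 _).neg
  filter_upwards [ae_hasFDerivAt_zero (μ := μ) cζ, ae_hasFDerivAt_zero (μ := μ) cη, hmax, hmin]
    with z h1 h2 h3 h4 hz
  refine ⟨?_, ?_⟩
  · filter_upwards [hU.mem_nhds hz] with w hw
    exact (hasFDerivAt_bellmanPhi hp hpq hq2 (hζ w hw) (hη w hw)).differentiableAt
  · have e : fderiv ℝ (fun w => bellmanPhi p q (ζ w) (η w)) =ᶠ[𝓝 z] fun w =>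
        phiCoeffFst p q ‖ζ w‖ ‖η w‖ • normSqDeriv ζ w +
          phiCoeffSnd q ‖ζ w‖ ‖η w‖ • normSqDeriv η w := by
      filter_upwards [hU.mem_nhds hz] with w hw
      exact (hasFDerivAt_bellmanPhi hp hpq hq2 (hζ w hw) (hη w hw)).fderiv
    refine DifferentiableAt.congr_of_eventuallyEq ?_ e
    refine (differentiableAt_phiCoeffFst_smul hp hpq hq2 (hζ z hz) (hη z hz) (hζ' z hz) (h1 hz)
      fun a b => h3 ⟨hz, a, b⟩).add (differentiableAt_phiCoeffSnd_smul hpq hq2 (hη z hz)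
      (hη' z hz) (fun a => (h2 hz a).fderiv) fun a => ?_)
    have := (h4 ⟨hz, a⟩).neg
    refine this.congr_of_eventuallyEq (Eventually.of_forall fun w => ?_)
    simp [max_neg_neg]

end

end AlmostEverywhereTwiceDifferentiable

/-! ### One-dimensional Hermite functions: ladder relations, orthonormality, bounds -/

section HermiteFunctions

open MeasureTheory Filter Topology

theorem contDiff_hermiteFun (m : ℕ) : ContDiff ℝ ∞ (hermiteFun m) := by
  have h0 : ContDiff ℝ ∞ fun y : ℝ => Real.exp (-y ^ 2) := by fun_prop
  have h1 : ContDiff ℝ ∞ (iteratedDeriv m fun y : ℝ => Real.exp (-y ^ 2)) := by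
    rw [iteratedDeriv_eq_iterate]; exact h0.iterate_deriv m
  unfold hermiteFun
  fun_prop

theorem hermiteFun_zero (x : ℝ) : hermiteFun 0 x = (√√Real.pi)⁻¹ * Real.exp (-x ^ 2 / 2) := by
  simp only [hermiteFun, pow_zero, Nat.factorial_zero, Nat.cast_one, one_mul, mul_one,
    iteratedDeriv_zero]
  rw [mul_assoc, ← Real.exp_add]
  congr 2
  ring

/-- The creation relation `h_m' = x h_m - √(2(m+1)) h_{m+1}`. -/
theorem hasDerivAt_hermiteFun (m : ℕ) (x : ℝ) :
    HasDerivAt (hermiteFun m) (x * hermiteFun m x - √(2 * (m + 1)) * hermiteFun (m + 1) x) x := by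
  have h0 : ContDiff ℝ ∞ fun y : ℝ => Real.exp (-y ^ 2) := by fun_prop
  have h1 : HasDerivAt (iteratedDeriv m fun y : ℝ => Real.exp (-y ^ 2))
      (iteratedDeriv (m + 1) (fun y : ℝ => Real.exp (-y ^ 2)) x) x := by
    rw [iteratedDeriv_succ]
    exact (h0.differentiable_iteratedDeriv m (by exact_mod_cast WithTop.coe_lt_top _) x).hasDerivAt
  have h2 : HasDerivAt (fun y : ℝ => Real.exp (y ^ 2 / 2)) (x * Real.exp (x ^ 2 / 2)) x := by
    have := (((hasDerivAt_id x).fun_pow 2).div_const 2).exp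
    convert! this using 1
    simp; ring
  have h3 := (h2.const_mul ((√(2 ^ m * (m ! : ℝ) * √Real.pi))⁻¹ * (-1) ^ m)).mul h1
  have e : √(2 * ((m : ℝ) + 1)) * (√(2 ^ (m + 1) * ((m + 1)! : ℝ) * √Real.pi))⁻¹ =
      (√(2 ^ m * (m ! : ℝ) * √Real.pi))⁻¹ := by
    have : (2 : ℝ) ^ (m + 1) * ((m + 1)! : ℝ) * √Real.pi =
        2 * ((m : ℝ) + 1) * (2 ^ m * (m ! : ℝ) * √Real.pi) := by
      rw [Nat.factorial_succ]; push_cast; ring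
    rw [this, Real.sqrt_mul (by positivity : (0 : ℝ) ≤ 2 * (m + 1)) (2 ^ m * (m ! : ℝ) * √Real.pi),
      mul_inv, ← mul_assoc,
      mul_inv_cancel₀ (by positivity), one_mul]
  convert! h3 using 1
  simp only [hermiteFun]
  rw [← e]
  ring

/-- The three-term recurrence. -/
theorem hermiteFun_recurrence (m : ℕ) (x : ℝ) :
    2 * x * hermiteFun m x =
      √(2 * (m + 1)) * hermiteFun (m + 1) x + √(2 * m) * hermiteFun (m - 1) x := by
  induction m generalizing x with
  | zero =>
    have h1 := hasDerivAt_hermiteFun 0 x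
    have h2 : HasDerivAt (hermiteFun 0) (-x * hermiteFun 0 x) x := by
      have := (((((hasDerivAt_id x).fun_pow 2).neg).div_const 2).exp).const_mul (√√Real.pi)⁻¹
      have e : hermiteFun 0 = fun x => (√√Real.pi)⁻¹ * Real.exp (-x ^ 2 / 2) :=
        funext hermiteFun_zero
      rw [e]
      convert! this using 1
      simp; ring
    have := h1.unique h2
    simp only [Nat.cast_zero, mul_zero, Real.sqrt_zero, zero_mul, add_zero] at this ⊢
    linarith
  | succ m ih =>
    have d : HasDerivAt (fun x => 2 * x * hermiteFun m x)
        (2 * hermiteFun m x + 2 * x *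
          (x * hermiteFun m x - √(2 * (m + 1)) * hermiteFun (m + 1) x)) x := by
      have := ((hasDerivAt_id x).const_mul 2).mul (hasDerivAt_hermiteFun m x)
      convert! this using 1
      simp
    have d' := ((hasDerivAt_hermiteFun (m + 1) x).const_mul √(2 * ((m : ℝ) + 1))).add
      ((hasDerivAt_hermiteFun (m - 1) x).const_mul √(2 * (m : ℝ)))
    -- Differentiating the recurrence of degree $m$ by the creation relation produces the recurrence
    -- of degree $m+1$.
    have e := d.unique (d'.congr_of_eventuallyEq (Eventually.of_forall fun y => ih y))
    have s1 : √(2 * ((m : ℝ) + 1)) ^ 2 = 2 * (m + 1) := Real.sq_sqrt (by positivity)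
    have s2 : √(2 * (m : ℝ)) ^ 2 = 2 * m := Real.sq_sqrt (by positivity)
    have s3 : 0 < √(2 * ((m : ℝ) + 1)) := by positivity
    -- For $m=0$ the truncated index $m-1$ is meaningless but harmless, since its coefficient
    -- $\sqrt{2m}$ vanishes.
    have e3 : √(2 * (m : ℝ)) * (√(2 * (((m - 1 : ℕ) : ℝ) + 1)) * hermiteFun (m - 1 + 1) x) =
        √(2 * (m : ℝ)) ^ 2 * hermiteFun m x := by
      cases m with
      | zero => simp
      | succ k => simp; ring
    have i := ih x
    push_cast at e ⊢
    refine mul_left_cancel₀ s3.ne' ?_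
    have e4 : √(2 * (m : ℝ)) * ((x * hermiteFun (m - 1) x -
        √(2 * (((m - 1 : ℕ) : ℝ) + 1)) * hermiteFun (m - 1 + 1) x)) =
        x * (√(2 * (m : ℝ)) * hermiteFun (m - 1) x) - 2 * m * hermiteFun m x := by
      rw [mul_sub, e3, s2]; ring
    rw [e4] at e
    linear_combination (-1 : ℝ) * e + x * i - hermiteFun m x * s1

/-- The annihilation relation. -/
theorem hasDerivAt_hermiteFun' (m : ℕ) (x : ℝ) :
    HasDerivAt (hermiteFun m) (-x * hermiteFun m x + √(2 * m) * hermiteFun (m - 1) x) x := by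
  convert! hasDerivAt_hermiteFun m x using 1
  linear_combination -(hermiteFun_recurrence m x)

/-- The Hermite equation `h_m'' = (x² - (2m+1)) h_m`. -/
theorem hasDerivAt_deriv_hermiteFun (m : ℕ) (x : ℝ) :
    HasDerivAt (deriv (hermiteFun m)) ((x ^ 2 - (2 * m + 1)) * hermiteFun m x) x := by
  have e : deriv (hermiteFun m) =
      fun x => x * hermiteFun m x - √(2 * (m + 1)) * hermiteFun (m + 1) x :=
    funext fun y => (hasDerivAt_hermiteFun m y).deriv
  rw [e]
  have := ((hasDerivAt_id x).mul (hasDerivAt_hermiteFun m x)).sub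
    ((hasDerivAt_hermiteFun' (m + 1) x).const_mul √(2 * ((m : ℝ) + 1)))
  convert! this using 1
  have s1 : √(2 * ((m : ℝ) + 1)) ^ 2 = 2 * (m + 1) := Real.sq_sqrt (by positivity)
  simp only [id]
  push_cast
  linear_combination (hermiteFun m x) * s1

theorem continuous_hermiteFun (m : ℕ) : Continuous (hermiteFun m) :=
  (contDiff_hermiteFun m).continuous

/-- Induction on the degree through the recurrence, starting from the Gaussian. The constant depends
on $m$, which is enough for integrability and decay at infinity. -/
theorem exists_pow_mul_hermiteFun_le (m : ℕ) :
    ∀ k : ℕ, ∃ C, ∀ x, |x ^ k * hermiteFun m x| ≤ C := by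
  induction m using Nat.strong_induction_on with
  | _ m ih =>
  intro k
  rcases m with _ | m
  · refine ⟨1 + (√√Real.pi)⁻¹ * (2 ^ k * k !) + (√√Real.pi)⁻¹, fun x => ?_⟩
    rw [hermiteFun_zero, abs_mul, abs_mul, abs_of_nonneg (Real.exp_pos _).le, abs_pow,
      abs_of_nonneg (by positivity : 0 ≤ (√√Real.pi)⁻¹)]
    have h1 : (x ^ 2 / 2) ^ k / k ! ≤ Real.exp (x ^ 2 / 2) :=
      Real.pow_div_factorial_le_exp _ (by positivity) _
    have h2 : |x| ^ k ≤ 1 + (x ^ 2) ^ k := by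
      rw [← sq_abs, ← pow_mul, mul_comm, pow_mul]
      have : 0 ≤ |x| ^ k := by positivity
      nlinarith [sq_nonneg (|x| ^ k - 1)]
    have h3 : (x ^ 2) ^ k * Real.exp (-x ^ 2 / 2) ≤ 2 ^ k * k ! := by
      rw [div_pow, div_div, div_le_iff₀ (by positivity)] at h1
      have : Real.exp (-x ^ 2 / 2) * Real.exp (x ^ 2 / 2) = 1 := by
        rw [← Real.exp_add]; simp; ring
      calc _ ≤ Real.exp (x ^ 2 / 2) * (2 ^ k * k !) * Real.exp (-x ^ 2 / 2) := by gcongr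
        _ = _ := by linear_combination (2 ^ k * (k ! : ℝ)) * this
    have h4 : Real.exp (-x ^ 2 / 2) ≤ 1 := by
      rw [Real.exp_le_one_iff]; have := sq_nonneg x; linarith
    calc |x| ^ k * ((√√Real.pi)⁻¹ * Real.exp (-x ^ 2 / 2))
        ≤ (1 + (x ^ 2) ^ k) * ((√√Real.pi)⁻¹ * Real.exp (-x ^ 2 / 2)) := by gcongr
      _ = (√√Real.pi)⁻¹ * Real.exp (-x ^ 2 / 2) +
          (√√Real.pi)⁻¹ * ((x ^ 2) ^ k * Real.exp (-x ^ 2 / 2)) := by ring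
      _ ≤ (√√Real.pi)⁻¹ * 1 + (√√Real.pi)⁻¹ * (2 ^ k * k !) := by gcongr
      _ ≤ _ := by linarith
  · obtain ⟨C, hC⟩ := ih m (by omega) (k + 1)
    obtain ⟨D, hD⟩ := ih (m - 1) (by omega) k
    have s3 : 0 < √(2 * ((m : ℝ) + 1)) := by positivity
    refine ⟨(√(2 * ((m : ℝ) + 1)))⁻¹ * (2 * C + √(2 * m) * D), fun x => ?_⟩
    have e : x ^ k * hermiteFun (m + 1) x = (√(2 * ((m : ℝ) + 1)))⁻¹ *
        (2 * (x ^ (k + 1) * hermiteFun m x) - √(2 * m) * (x ^ k * hermiteFun (m - 1) x)) := by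
      have := hermiteFun_recurrence m x
      rw [eq_inv_mul_iff_mul_eq₀ s3.ne']
      linear_combination (-x ^ k) * this
    rw [e, abs_mul, abs_of_pos (inv_pos.2 s3)]
    gcongr
    refine (abs_sub _ _).trans ?_
    rw [abs_mul 2, abs_mul √_, abs_two, abs_of_nonneg (Real.sqrt_nonneg _)]
    gcongr
    · exact hC x
    · exact hD x

theorem exists_hermiteFun_le_inv (m k : ℕ) :
    ∃ C, ∀ x, |x ^ k * hermiteFun m x| ≤ C * (1 + x ^ 2)⁻¹ := by
  obtain ⟨C, hC⟩ := exists_pow_mul_hermiteFun_le m k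
  obtain ⟨D, hD⟩ := exists_pow_mul_hermiteFun_le m (k + 2)
  refine ⟨C + D, fun x => ?_⟩
  rw [← div_eq_mul_inv, le_div_iff₀ (by positivity)]
  have h1 := hC x
  have h2 := hD x
  have : |x ^ (k + 2) * hermiteFun m x| = |x ^ k * hermiteFun m x| * x ^ 2 := by
    calc _ = |x ^ k * hermiteFun m x * x ^ 2| := by congr 1; ring
      _ = _ := by rw [abs_mul _ (x ^ 2), abs_of_nonneg (sq_nonneg x)]
  rw [this] at h2
  linarith

theorem integrable_hermiteFun_mul (m l k : ℕ) :
    Integrable fun x => x ^ k * hermiteFun m x * hermiteFun l x := by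
  obtain ⟨C, hC⟩ := exists_hermiteFun_le_inv m k
  obtain ⟨D, hD⟩ := exists_pow_mul_hermiteFun_le l 0
  refine Integrable.mono' ((integrable_inv_one_add_sq.const_mul C).mul_const D) ?_ ?_
  · have := continuous_hermiteFun m
    have := continuous_hermiteFun l
    exact Continuous.aestronglyMeasurable (by fun_prop)
  · refine Eventually.of_forall fun x => ?_
    rw [Real.norm_eq_abs, abs_mul]
    have h2 := hD x
    rw [pow_zero, one_mul] at h2
    exact mul_le_mul (hC x) h2 (abs_nonneg _) ((abs_nonneg _).trans (hC x))

theorem integrable_hermiteFun_mul' (m l : ℕ) :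
    Integrable fun x => hermiteFun m x * hermiteFun l x := by
  simpa using integrable_hermiteFun_mul m l 0

/-- Integrate $(h_mh_k)'$ over the line, using creation on $h_m$ and annihilation on $h_k$: the
terms with $x$ cancel. -/
theorem integral_hermiteFun_succ_mul (m k : ℕ) :
    √(2 * (m + 1)) * ∫ x, hermiteFun (m + 1) x * hermiteFun k x =
      √(2 * k) * ∫ x, hermiteFun m x * hermiteFun (k - 1) x := by
  have d : ∀ x, HasDerivAt (fun x => hermiteFun m x * hermiteFun k x)
      (-√(2 * (m + 1)) * (hermiteFun (m + 1) x * hermiteFun k x) +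
        √(2 * k) * (hermiteFun m x * hermiteFun (k - 1) x)) x := fun x => by
    convert! (hasDerivAt_hermiteFun m x).mul (hasDerivAt_hermiteFun' k x) using 1
    ring
  have i1 := (integrable_hermiteFun_mul' (m + 1) k).const_mul (-√(2 * ((m : ℝ) + 1)))
  have i2 := (integrable_hermiteFun_mul' m (k - 1)).const_mul √(2 * (k : ℝ))
  have h := integral_eq_zero_of_hasDerivAt_of_integrable d (i1.add i2)
    (integrable_hermiteFun_mul' m k)
  rw [integral_add i1 i2, integral_const_mul, integral_const_mul] at h
  linarith

/-- Orthonormality of the Hermite functions. -/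
theorem integral_hermiteFun_mul (m k : ℕ) :
    ∫ x, hermiteFun m x * hermiteFun k x = if m = k then 1 else 0 := by
  induction m generalizing k with
  | zero =>
    rcases k with _ | k
    · have e : (fun x => hermiteFun 0 x * hermiteFun 0 x) =
          fun x => (√Real.pi)⁻¹ * Real.exp (-1 * x ^ 2) := by
        ext x
        rw [hermiteFun_zero]
        have h1 : (√√Real.pi)⁻¹ * (√√Real.pi)⁻¹ = (√Real.pi)⁻¹ := by
          rw [← mul_inv, Real.mul_self_sqrt (Real.sqrt_nonneg _)]
        have h2 : Real.exp (-x ^ 2 / 2) * Real.exp (-x ^ 2 / 2) = Real.exp (-1 * x ^ 2) := by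
          rw [← Real.exp_add]; congr 1; ring
        rw [← h1, ← h2]; ring
      rw [e, integral_const_mul, integral_gaussian, div_one, if_pos rfl,
        inv_mul_cancel₀ (by positivity)]
    · have h := integral_hermiteFun_succ_mul k 0
      simp only [CharP.cast_eq_zero, mul_zero, Real.sqrt_zero, zero_mul] at h
      have s3 : √(2 * ((k : ℝ) + 1)) ≠ 0 := by positivity
      have := (mul_eq_zero.1 h).resolve_left s3
      simp only [mul_comm (hermiteFun 0 _)]
      simpa using this
  | succ m ih =>
    have h := integral_hermiteFun_succ_mul m k
    have s3 : √(2 * ((m : ℝ) + 1)) ≠ 0 := by positivity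
    rcases k with _ | k
    · simp only [CharP.cast_eq_zero, mul_zero, Real.sqrt_zero, zero_mul] at h
      simpa using (mul_eq_zero.1 h).resolve_left s3
    · rw [Nat.add_sub_cancel, ih] at h
      by_cases hmk : m = k
      · subst hmk
        push_cast at h
        simpa using mul_left_cancel₀ s3 (by simpa using h)
      · rw [if_neg hmk, mul_zero] at h
        simpa [hmk] using (mul_eq_zero.1 h).resolve_left s3

theorem tendsto_hermiteFun_atBot (m : ℕ) : Tendsto (hermiteFun m) atBot (𝓝 0) := by
  obtain ⟨C, hC⟩ := exists_pow_mul_hermiteFun_le m 1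
  refine squeeze_zero_norm' (a := fun x => C * |x|⁻¹) ?_ ?_
  · filter_upwards [eventually_lt_atBot 0] with x hx
    rw [← div_eq_mul_inv, le_div_iff₀ (abs_pos.2 hx.ne), Real.norm_eq_abs, ← abs_mul, mul_comm]
    simpa using hC x
  · simpa using (tendsto_abs_atBot_atTop.inv_tendsto_atTop).const_mul C

/-- The derivative of $h_m^2$ is a combination of $h_mh_{m\pm1}$ with coefficients $O(\sqrt{m+1})$;
integrating from $-\infty$ and using $L^2$-normalisation bounds $h_m^2$ by the sum of these
coefficients. Only polynomial growth in $m$ matters. -/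
theorem abs_hermiteFun_le (m : ℕ) (x : ℝ) : |hermiteFun m x| ≤ 2 * (m + 1) := by
  have d : ∀ x, HasDerivAt (fun x => hermiteFun m x ^ 2)
      (√(2 * m) * (hermiteFun m x * hermiteFun (m - 1) x) -
        √(2 * (m + 1)) * (hermiteFun m x * hermiteFun (m + 1) x)) x := fun x => by
    convert! (hasDerivAt_hermiteFun m x).fun_pow 2 using 1
    have := hermiteFun_recurrence m x
    simp only [Nat.cast_ofNat, Nat.add_one_sub_one, pow_one]
    linear_combination -(hermiteFun m x) * this
  have i1 := (integrable_hermiteFun_mul' m (m - 1)).const_mul √(2 * (m : ℝ))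
  have i2 := (integrable_hermiteFun_mul' m (m + 1)).const_mul √(2 * ((m : ℝ) + 1))
  have lim : Tendsto (fun x => hermiteFun m x ^ 2) atBot (𝓝 0) := by
    simpa using (tendsto_hermiteFun_atBot m).pow 2
  have h := integral_Iic_of_hasDerivAt_of_tendsto' (a := x) (fun y _ => d y)
    (i1.sub i2).integrableOn lim
  rw [sub_zero] at h
  have sq : ∀ k, ∫ x, hermiteFun k x ^ 2 = 1 := fun k => by
    have := integral_hermiteFun_mul k k
    simpa [← pow_two] using this
  have isq : ∀ k, Integrable fun x => hermiteFun k x ^ 2 := fun k => by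
    simpa [← pow_two] using integrable_hermiteFun_mul' k k
  have prod_le : ∀ k, ∀ y, |hermiteFun m y * hermiteFun k y| ≤
      (hermiteFun m y ^ 2 + hermiteFun k y ^ 2) / 2 := fun k y => by
    rw [abs_mul, ← sq_abs (hermiteFun m y), ← sq_abs (hermiteFun k y)]
    have := sq_nonneg (|hermiteFun m y| - |hermiteFun k y|)
    linarith
  set G : ℝ → ℝ := fun y => √(2 * m) * ((hermiteFun m y ^ 2 + hermiteFun (m - 1) y ^ 2) / 2) +
    √(2 * (m + 1)) * ((hermiteFun m y ^ 2 + hermiteFun (m + 1) y ^ 2) / 2) with hG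
  have j1 : ∀ k (c : ℝ), Integrable fun y => c * ((hermiteFun m y ^ 2 + hermiteFun k y ^ 2) / 2) :=
    fun k c => (((isq m).add (isq k)).div_const 2).const_mul c
  have j2 : ∀ k (c : ℝ), ∫ y, c * ((hermiteFun m y ^ 2 + hermiteFun k y ^ 2) / 2) = c :=
    fun k c => by
      rw [integral_const_mul, integral_div, integral_add (isq m) (isq k), sq, sq]; norm_num
  have iG : Integrable G := (j1 (m - 1) _).add (j1 (m + 1) _)
  have hGval : ∫ y, G y = √(2 * m) + √(2 * (m + 1)) := by
    rw [hG, integral_add (j1 (m - 1) _) (j1 (m + 1) _), j2, j2]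
  have G0 : ∀ y, 0 ≤ G y := fun y => by positivity
  have h1 : hermiteFun m x ^ 2 ≤ √(2 * m) + √(2 * (m + 1)) := by
    rw [← h, ← hGval]
    refine (integral_mono (i1.sub i2).integrableOn iG.integrableOn fun y => ?_).trans
      (setIntegral_le_integral iG (Eventually.of_forall G0))
    have e1 := mul_le_mul_of_nonneg_left ((le_abs_self _).trans (prod_le (m - 1) y))
      (Real.sqrt_nonneg (2 * m))
    have e2 := mul_le_mul_of_nonneg_left ((neg_le_abs _).trans (prod_le (m + 1) y))
      (Real.sqrt_nonneg (2 * (m + 1)))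
    simp only [hG, Pi.sub_apply]
    linarith
  have h2 : √(2 * (m : ℝ)) ≤ 2 * (m + 1) := Real.sqrt_le_iff.2 ⟨by positivity, by nlinarith⟩
  have h3 : √(2 * ((m : ℝ) + 1)) ≤ 2 * (m + 1) := Real.sqrt_le_iff.2 ⟨by positivity, by nlinarith⟩
  refine abs_le_of_sq_le_sq (h1.trans ?_) (by positivity)
  nlinarith

/-- Polynomial bounds, uniform in the degree. -/
theorem exists_pow_mul_hermiteFun_le_pow (k : ℕ) :
    ∃ C, 0 ≤ C ∧ ∀ (m : ℕ) (x : ℝ), |x ^ k * hermiteFun m x| ≤ C * (m + 1) ^ (k + 1) := by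
  induction k with
  | zero => exact ⟨2, by norm_num, fun m x => by simpa using abs_hermiteFun_le m x⟩
  | succ k ih =>
    obtain ⟨C, hC0, hC⟩ := ih
    refine ⟨2 ^ (k + 2) * C, by positivity, fun m x => ?_⟩
    -- The recurrence trades one power of $x$ for shifts of the degree, at the cost of one factor of
    -- order $m+1$.
    have e : x ^ (k + 1) * hermiteFun m x =
        (√(2 * (m + 1)) * (x ^ k * hermiteFun (m + 1) x) +
          √(2 * m) * (x ^ k * hermiteFun (m - 1) x)) / 2 := by
      linear_combination x ^ k / 2 * hermiteFun_recurrence m x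
    have h2 : √(2 * (m : ℝ)) ≤ 2 * (m + 1) := Real.sqrt_le_iff.2 ⟨by positivity, by nlinarith⟩
    have h3 : √(2 * ((m : ℝ) + 1)) ≤ 2 * (m + 1) :=
      Real.sqrt_le_iff.2 ⟨by positivity, by nlinarith⟩
    have c1 : (((m + 1 : ℕ) : ℝ) + 1) ^ (k + 1) ≤ 2 ^ (k + 1) * (m + 1) ^ (k + 1) := by
      rw [← mul_pow]; gcongr; push_cast; linarith
    have c2 : (((m - 1 : ℕ) : ℝ) + 1) ^ (k + 1) ≤ 2 ^ (k + 1) * (m + 1) ^ (k + 1) := by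
      rw [← mul_pow]; gcongr
      have : ((m - 1 : ℕ) : ℝ) ≤ m := by exact_mod_cast Nat.sub_le _ _
      linarith
    have b1 := mul_le_mul h3 ((hC (m + 1) x).trans (mul_le_mul_of_nonneg_left c1 hC0))
      (abs_nonneg _) (by positivity)
    have b2 := mul_le_mul h2 ((hC (m - 1) x).trans (mul_le_mul_of_nonneg_left c2 hC0))
      (abs_nonneg _) (by positivity)
    rw [e, abs_div, abs_two, div_le_iff₀ two_pos]
    refine (abs_add_le _ _).trans ?_
    rw [abs_mul √_, abs_mul √_, abs_of_nonneg (Real.sqrt_nonneg _),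
      abs_of_nonneg (Real.sqrt_nonneg _)]
    refine (add_le_add b1 b2).trans (le_of_eq ?_)
    ring

/-- Weighted bounds for the Hermite functions and their first two derivatives. -/
theorem exists_hermiteFun_weighted_le :
    ∃ C, 0 ≤ C ∧ ∀ (m : ℕ) (x : ℝ), ∀ k ≤ 2,
      |iteratedDeriv k (hermiteFun m) x| ≤ C * (m + 1) ^ 6 * (1 + x ^ 2)⁻¹ := by
  obtain ⟨C0, p0, h0⟩ := exists_pow_mul_hermiteFun_le_pow 0
  obtain ⟨C1, p1, h1⟩ := exists_pow_mul_hermiteFun_le_pow 1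
  obtain ⟨C2, p2, h2⟩ := exists_pow_mul_hermiteFun_le_pow 2
  obtain ⟨C3, p3, h3⟩ := exists_pow_mul_hermiteFun_le_pow 3
  obtain ⟨C4, p4, h4⟩ := exists_pow_mul_hermiteFun_le_pow 4
  -- Two derivatives and the weight $1+x^2$ involve $x^jh_m$ with $j\le4$, hence $(m+1)^5$; the
  -- sixth power absorbs the factors $\sqrt{2m}$ and $2m+1$ in the derivatives.
  have mono : ∀ (m : ℕ) (j : ℕ), j ≤ 5 → ((m : ℝ) + 1) ^ j ≤ (m + 1) ^ 5 := fun m j hj =>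
    pow_le_pow_right₀ (by linarith [(Nat.cast_nonneg m : (0 : ℝ) ≤ m)]) hj
  have up : ∀ {C : ℝ} (_ : 0 ≤ C) {j : ℕ} (_ : j ≤ 4)
      (_ : ∀ (m : ℕ) (x : ℝ), |x ^ j * hermiteFun m x| ≤ C * (m + 1) ^ (j + 1)),
      ∀ (m : ℕ) (x : ℝ), |x ^ j * hermiteFun m x| ≤ C * (m + 1) ^ 5 := fun hC j hj h m x =>
    (h m x).trans (mul_le_mul_of_nonneg_left (mono m _ (by omega)) hC)
  have q0 := up p0 (by norm_num) h0
  have q1 := up p1 (by norm_num) h1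
  have q2 := up p2 (by norm_num) h2
  have q3 := up p3 (by norm_num) h3
  have q4 := up p4 (by norm_num) h4
  obtain ⟨S, hS, S0, S1, S2, S3, S4⟩ : ∃ S, 0 ≤ S ∧ C0 ≤ S ∧ C1 ≤ S ∧ C2 ≤ S ∧ C3 ≤ S ∧ C4 ≤ S :=
    ⟨C0 + C1 + C2 + C3 + C4, by positivity, by linarith, by linarith, by linarith, by linarith,
      by linarith⟩
  have d1 : ∀ (m : ℕ) (x : ℝ), iteratedDeriv 1 (hermiteFun m) x =
      -(x ^ 1 * hermiteFun m x) + √(2 * m) * (x ^ 0 * hermiteFun (m - 1) x) := fun m x => by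
    rw [iteratedDeriv_one, (hasDerivAt_hermiteFun' m x).deriv]; ring
  have d2 : ∀ (m : ℕ) (x : ℝ), iteratedDeriv 2 (hermiteFun m) x =
      x ^ 2 * hermiteFun m x - (2 * m + 1) * (x ^ 0 * hermiteFun m x) := fun m x => by
    rw [iteratedDeriv_succ, iteratedDeriv_one, (hasDerivAt_deriv_hermiteFun m x).deriv]; ring
  have wt : ∀ {A B : ℝ} {j : ℕ} (_ : A ≤ S) (_ : B ≤ S)
      (_ : ∀ (m : ℕ) (x : ℝ), |x ^ j * hermiteFun m x| ≤ A * (m + 1) ^ 5)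
      (_ : ∀ (m : ℕ) (x : ℝ), |x ^ (j + 2) * hermiteFun m x| ≤ B * (m + 1) ^ 5),
      ∀ (m : ℕ) (x : ℝ), |x ^ j * hermiteFun m x| * (1 + x ^ 2) ≤ 2 * (S * (m + 1) ^ 5) :=
    fun {A B j} hA hB ha hb m x => by
      have e : |x ^ (j + 2) * hermiteFun m x| = |x ^ j * hermiteFun m x| * x ^ 2 := by
        calc _ = |x ^ j * hermiteFun m x * x ^ 2| := by congr 1; ring
          _ = _ := by rw [abs_mul _ (x ^ 2), abs_of_nonneg (sq_nonneg x)]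
      have hw : 0 ≤ ((m : ℝ) + 1) ^ 5 := by positivity
      have h1 := (ha m x).trans (mul_le_mul_of_nonneg_right hA hw)
      have h2 := (hb m x).trans (mul_le_mul_of_nonneg_right hB hw)
      rw [e] at h2
      linarith
  have w0 := wt S0 S2 q0 q2
  have w1 := wt S1 S3 q1 q3
  have w2 := wt S2 S4 q2 q4
  refine ⟨6 * S, by positivity, fun m x k hk => ?_⟩
  rw [← div_eq_mul_inv, le_div_iff₀ (by positivity)]
  have hm : (0 : ℝ) ≤ m := Nat.cast_nonneg m
  set W := S * ((m : ℝ) + 1) ^ 5 with hW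
  have hW0 : 0 ≤ W := by positivity
  have hWm : 0 ≤ W * m := by positivity
  have goal : 6 * S * ((m : ℝ) + 1) ^ 6 = 6 * (W * m) + 6 * W := by rw [hW]; ring
  rw [goal]
  have hx : 0 ≤ 1 + x ^ 2 := by positivity
  interval_cases k
  · have := w0 m x
    rw [pow_zero, one_mul] at this
    rw [iteratedDeriv_zero]
    linarith
  · have h2 : √(2 * (m : ℝ)) ≤ 2 * (m + 1) := Real.sqrt_le_iff.2 ⟨by positivity, by nlinarith⟩
    have h3 : |x ^ 0 * hermiteFun (m - 1) x| * (1 + x ^ 2) ≤ 2 * W := by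
      refine (w0 (m - 1) x).trans ?_
      have : ((m - 1 : ℕ) : ℝ) ≤ m := by exact_mod_cast Nat.sub_le _ _
      rw [hW]
      gcongr
    have h4 := mul_le_mul h2 h3 (by positivity) (by positivity)
    have h5 := w1 m x
    calc _ ≤ (|x ^ 1 * hermiteFun m x| + √(2 * m) * |x ^ 0 * hermiteFun (m - 1) x|) *
          (1 + x ^ 2) := by
          refine mul_le_mul_of_nonneg_right ?_ hx
          rw [d1]
          refine (abs_add_le _ _).trans ?_
          rw [abs_neg, abs_mul √_, abs_of_nonneg (Real.sqrt_nonneg _)]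
      _ ≤ _ := by linarith
  · have h4 := mul_le_mul_of_nonneg_left (w0 m x) (by positivity : 0 ≤ 2 * (m : ℝ) + 1)
    have h5 := w2 m x
    calc _ ≤ (|x ^ 2 * hermiteFun m x| + (2 * m + 1) * |x ^ 0 * hermiteFun m x|) *
          (1 + x ^ 2) := by
          refine mul_le_mul_of_nonneg_right ?_ hx
          rw [d2]
          refine (abs_sub _ _).trans ?_
          rw [abs_mul (2 * (m : ℝ) + 1), abs_of_nonneg (by positivity : 0 ≤ 2 * (m : ℝ) + 1)]
      _ ≤ _ := by linarith

end HermiteFunctions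

/-! ### Symmetric second differences and the discrete Laplacian -/

section SecondDifferences

open MeasureTheory Filter Topology

variable {G : Type*} [NormedAddCommGroup G] [NormedSpace ℝ G]

/-- Bound for a symmetric second difference by the second derivative. -/
theorem norm_secondDifference_le {u u' u'' : ℝ → G} {y h K : ℝ} (hh : 0 ≤ h)
    (d1 : ∀ s, HasDerivAt u (u' s) s) (d2 : ∀ s, HasDerivAt u' (u'' s) s)
    (hK : ∀ s ∈ Set.Icc (y - h) (y + h), ‖u'' s‖ ≤ K) :
    ‖u (y + h) + u (y - h) - (2 : ℝ) • u y‖ ≤ K * h ^ 2 := by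
  let g : ℝ → G := fun s => u (y + s) + u (y - s) - (2 : ℝ) • u y
  have dg : ∀ s, HasDerivAt g (u' (y + s) - u' (y - s)) s := fun s => by
    have e1 : HasDerivAt (fun s => u (y + s)) (u' (y + s)) s := (d1 (y + s)).comp_const_add y s
    have e2 : HasDerivAt (fun s => u (y - s)) (-u' (y - s)) s := (d1 (y - s)).comp_const_sub y s
    convert! (e1.add e2).sub_const ((2 : ℝ) • u y) using 1
    abel
  have key := image_norm_le_of_norm_deriv_right_le_deriv_boundary (f := g)
    (f' := fun s => u' (y + s) - u' (y - s)) (a := 0) (b := h) (B := fun s => K * s ^ 2)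
    (B' := fun s => K * (2 * s))
    (fun s _ => (dg s).continuousAt.continuousWithinAt)
    (fun s _ => (dg s).hasDerivWithinAt) (by simp [g, two_smul])
    (fun s => by simpa using (hasDerivAt_pow 2 s).const_mul K)
    (fun s hs => by
      have hm := Convex.norm_image_sub_le_of_norm_hasDerivWithin_le (f := u') (f' := u'')
        (s := Set.Icc (y - h) (y + h)) (x := y - s) (y := y + s) (C := K)
        (fun x _ => (d2 x).hasDerivWithinAt) hK (convex_Icc _ _)
        ⟨by linarith [hs.2], by linarith [hs.1]⟩ ⟨by linarith [hs.1], by linarith [hs.2]⟩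
      refine hm.trans (le_of_eq ?_)
      rw [Real.norm_of_nonneg (by linarith [hs.1])]
      ring)
  simpa [g] using key (Set.right_mem_Icc.2 hh)

/-- Symmetric second differences converge to the second derivative. -/
theorem tendsto_secondDifference {u u' : ℝ → G} {a : G}
    (d1 : ∀ᶠ s in 𝓝 0, HasDerivAt u (u' s) s) (d2 : HasDerivAt u' a 0) :
    Tendsto (fun h : ℝ => (h⁻¹) ^ 2 • (u h + u (-h) - (2 : ℝ) • u 0)) (𝓝[>] 0) (𝓝 a) := by
  rw [tendsto_iff_norm_sub_tendsto_zero, Metric.tendsto_nhds]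
  intro ε hε
  have hε2 : 0 < ε / 2 := by positivity
  have l1 := (hasDerivAt_iff_isLittleO_nhds_zero.1 d2)
  have l2 := Asymptotics.isLittleO_iff.1 l1 hε2
  obtain ⟨r, hr, H⟩ := Metric.eventually_nhds_iff.1 (d1.and l2)
  have mem : Set.Ioo (0 : ℝ) r ∈ 𝓝[>] (0 : ℝ) := Ioo_mem_nhdsGT hr
  filter_upwards [mem] with h hh
  -- After subtracting the parabola $s^2a$, the derivative is at most $\varepsilon s$ in norm;
  -- comparison with $\frac\varepsilon2s^2$ needs differentiability of $u'$ at 0 only.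
  let g : ℝ → G := fun s => u s + u (-s) - (2 : ℝ) • u 0 - (s ^ 2) • a
  have dg : ∀ s, |s| < r → HasDerivAt g (u' s - u' (-s) - (2 * s) • a) s := fun s hs => by
    have e1 := (H (y := s) (by simpa using hs)).1
    have e2 := (H (y := -s) (by simpa using hs)).1
    have e3 : HasDerivAt (fun s => u (-s)) (-u' (-s)) s := by
      simpa [Function.comp_def] using e2.scomp s (hasDerivAt_neg s)
    have e4 : HasDerivAt (fun s : ℝ => s ^ 2 • a) ((2 * s) • a) s := by
      simpa using (hasDerivAt_pow 2 s).smul_const a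
    convert! ((e1.add e3).sub_const ((2 : ℝ) • u 0)).sub e4 using 1
    abel
  have key := image_norm_le_of_norm_deriv_right_le_deriv_boundary (f := g)
    (f' := fun s => u' s - u' (-s) - (2 * s) • a) (a := 0) (b := h)
    (B := fun s => ε / 2 * s ^ 2) (B' := fun s => ε / 2 * (2 * s))
    (fun s hs => (dg s (by rw [abs_of_nonneg hs.1]; linarith [hs.2, hh.2])).continuousAt.continuousWithinAt)
    (fun s hs => (dg s (by rw [abs_of_nonneg hs.1]; linarith [hs.2, hh.2])).hasDerivWithinAt)
    (by simp [g, two_smul])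
    (fun s => by simpa using (hasDerivAt_pow 2 s).const_mul (ε / 2))
    (fun s hs => by
      have hs' : |s| < r := by rw [abs_of_nonneg hs.1]; linarith [hs.2, hh.2]
      have e1 := (H (y := s) (by simpa using hs')).2
      have e2 := (H (y := -s) (by simpa using hs')).2
      simp only [zero_add] at e1 e2
      rw [norm_neg] at e2
      rw [Real.norm_of_nonneg hs.1] at e1 e2
      have e : u' s - u' (-s) - (2 * s) • a =
          (u' s - u' 0 - s • a) - (u' (-s) - u' 0 - (-s) • a) := by module
      rw [e]
      refine (norm_sub_le _ _).trans ?_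
      linarith)
  have kh := key (Set.right_mem_Icc.2 hh.1.le)
  have e : (h⁻¹) ^ 2 • (u h + u (-h) - (2 : ℝ) • u 0) - a = (h⁻¹) ^ 2 • g h := by
    simp only [g]
    rw [smul_sub _ _ ((h ^ 2) • a), smul_smul, inv_pow, inv_mul_cancel₀ (pow_ne_zero 2 hh.1.ne'),
      one_smul]
  rw [dist_zero_right, norm_norm, e, norm_smul, Real.norm_of_nonneg (by positivity)]
  calc (h⁻¹) ^ 2 * ‖g h‖ ≤ (h⁻¹) ^ 2 * (ε / 2 * h ^ 2) := by gcongr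
    _ = ε / 2 := by have := hh.1.ne'; field_simp
    _ < ε := by linarith

variable {n : ℕ}

/-- The coordinate directions of `ℝⁿ × ℝ`; `none` is the direction of the time variable. -/
noncomputable def coordDir : Option (Fin n) → EuclideanSpace ℝ (Fin n) × ℝ
  | none => (0, 1)
  | some j => (EuclideanSpace.single j 1, 0)

/-- The symmetric second difference quotient in direction `d`. -/
noncomputable def secondDiffDir {V : Type*} [AddCommGroup V] [Module ℝ V] (v : V → G) (h : ℝ)
    (d : V) (z : V) : G :=
  (h⁻¹) ^ 2 • (v (z + h • d) + v (z - h • d) - (2 : ℝ) • v z)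

/-- The discrete Laplacian `Δ_x + ∂_t²` with step `h`. -/
noncomputable def secondDiff (v : EuclideanSpace ℝ (Fin n) × ℝ → G) (h : ℝ)
    (z : EuclideanSpace ℝ (Fin n) × ℝ) : G :=
  ∑ i, secondDiffDir v h (coordDir i) z

/-- Restrict to the line $z+sd$. The second derivative need exist only at $z$ itself, which is all
that is available almost everywhere. -/
theorem tendsto_secondDiffDir {V : Type*} [NormedAddCommGroup V] [NormedSpace ℝ V] {B : V → G}
    {z : V} (h1 : ∀ᶠ w in 𝓝 z, DifferentiableAt ℝ B w) (h2 : DifferentiableAt ℝ (fderiv ℝ B) z)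
    (d : V) :
    Tendsto (fun h => secondDiffDir B h d z) (𝓝[>] 0) (𝓝 (fderiv ℝ (fderiv ℝ B) z d d)) := by
  have hc : Tendsto (fun s : ℝ => z + s • d) (𝓝 0) (𝓝 z) := by
    have : Continuous fun s : ℝ => z + s • d := by fun_prop
    simpa using this.tendsto 0
  have hd : ∀ s : ℝ, HasDerivAt (fun s : ℝ => z + s • d) d s := fun s => by
    simpa using ((hasDerivAt_id s).smul_const d).const_add z
  have d1 : ∀ᶠ s in 𝓝 (0 : ℝ), HasDerivAt (fun s : ℝ => B (z + s • d))
      (fderiv ℝ B (z + s • d) d) s := by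
    filter_upwards [hc.eventually h1] with s hs
    exact hs.hasFDerivAt.comp_hasDerivAt s (hd s)
  have d2 : HasDerivAt (fun s : ℝ => fderiv ℝ B (z + s • d) d)
      (fderiv ℝ (fderiv ℝ B) z d d) 0 := by
    have e : HasDerivAt (fun s : ℝ => fderiv ℝ B (z + s • d)) (fderiv ℝ (fderiv ℝ B) z d) 0 := by
      refine HasFDerivAt.comp_hasDerivAt (f := fun s : ℝ => z + s • d) (0 : ℝ) ?_ (hd 0)
      simpa using h2.hasFDerivAt
    simpa using e.clm_apply (hasDerivAt_const (0 : ℝ) d)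
  have := tendsto_secondDifference d1 d2
  refine this.congr fun h => ?_
  simp [secondDiffDir, sub_eq_add_neg]

/-- At points of twice differentiability, `L'` is given by the Hessian. -/
theorem hermiteOpExt_eq (b : EuclideanSpace ℝ (Fin n) → ℝ → ℝ) (x : EuclideanSpace ℝ (Fin n))
    (t : ℝ)
    (h : TwiceDifferentiableAt (fun w : EuclideanSpace ℝ (Fin n) × ℝ => b w.1 w.2) (x, t)) :
    hermiteOpExt b x t = ∑ i, fderiv ℝ (fderiv ℝ
      fun w : EuclideanSpace ℝ (Fin n) × ℝ => b w.1 w.2) (x, t) (coordDir i) (coordDir i) -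
      ‖x‖ ^ 2 * b x t := by
  set B := fun w : EuclideanSpace ℝ (Fin n) × ℝ => b w.1 w.2 with hB
  obtain ⟨h1, h2⟩ := h
  have ht : iteratedDeriv 2 (fun s => b x s) t =
      fderiv ℝ (fderiv ℝ B) (x, t) (0, 1) (0, 1) := by
    rw [iteratedDeriv_succ, iteratedDeriv_one]
    have c : Tendsto (fun s : ℝ => (x, s)) (𝓝 t) (𝓝 (x, t)) := by
      have : Continuous fun s : ℝ => (x, s) := by fun_prop
      exact this.tendsto t
    have hd : ∀ s : ℝ, HasDerivAt (fun s : ℝ => (x, s)) ((0, 1) : EuclideanSpace ℝ (Fin n) × ℝ) s :=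
      fun s => (hasDerivAt_const s x).prodMk (hasDerivAt_id s)
    have e : deriv (fun s => b x s) =ᶠ[𝓝 t] fun s => fderiv ℝ B (x, s) (0, 1) := by
      filter_upwards [c.eventually h1] with s hs
      exact (hs.hasFDerivAt.comp_hasDerivAt s (hd s)).deriv
    rw [e.deriv_eq]
    have := (h2.hasFDerivAt.comp_hasDerivAt t (hd t)).clm_apply
      (hasDerivAt_const t ((0, 1) : EuclideanSpace ℝ (Fin n) × ℝ))
    simpa using this.deriv
  have hx : Laplacian.laplacian (fun y => b y t) x = ∑ j : Fin n,
      fderiv ℝ (fderiv ℝ B) (x, t) (EuclideanSpace.single j 1, 0)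
        (EuclideanSpace.single j 1, 0) := by
    rw [InnerProductSpace.laplacian_eq_iteratedFDeriv_orthonormalBasis _
      (EuclideanSpace.basisFun (Fin n) ℝ)]
    refine Finset.sum_congr rfl fun j _ => ?_
    rw [iteratedFDeriv_two_apply]
    have c : Tendsto (fun y => (y, t)) (𝓝 x) (𝓝 (x, t)) := by
      have : Continuous fun y : EuclideanSpace ℝ (Fin n) => (y, t) := by fun_prop
      exact this.tendsto x
    have hd : ∀ y : EuclideanSpace ℝ (Fin n), HasFDerivAt (fun y => (y, t))
        (ContinuousLinearMap.inl ℝ (EuclideanSpace ℝ (Fin n)) ℝ) y := fun y =>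
      hasFDerivAt_prodMk_left y t
    have e : fderiv ℝ (fun y => b y t) =ᶠ[𝓝 x] fun y =>
        (fderiv ℝ B (y, t)).comp (ContinuousLinearMap.inl ℝ (EuclideanSpace ℝ (Fin n)) ℝ) := by
      filter_upwards [c.eventually h1] with y hy
      exact (hy.hasFDerivAt.comp y (hd y)).fderiv
    rw [e.fderiv_eq]
    have := (h2.hasFDerivAt.comp x (hd x)).clm_comp (hasFDerivAt_const
      (ContinuousLinearMap.inl ℝ (EuclideanSpace ℝ (Fin n)) ℝ) x)
    simp only [Function.comp_def] at this
    rw [HasFDerivAt.fderiv this]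
    simp
  rw [hermiteOpExt, hermiteOp, ht, hx, Fintype.sum_option]
  simp only [coordDir]
  ring

theorem tendsto_secondDiff_hermiteOpExt (b : EuclideanSpace ℝ (Fin n) → ℝ → ℝ)
    (x : EuclideanSpace ℝ (Fin n)) (t : ℝ)
    (h : TwiceDifferentiableAt (fun w : EuclideanSpace ℝ (Fin n) × ℝ => b w.1 w.2) (x, t)) :
    Tendsto (fun s => secondDiff (fun w : EuclideanSpace ℝ (Fin n) × ℝ => b w.1 w.2) s (x, t))
      (𝓝[>] 0) (𝓝 (hermiteOpExt b x t + ‖x‖ ^ 2 * b x t)) := by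
  rw [hermiteOpExt_eq b x t h, sub_add_cancel]
  exact tendsto_finsetSum _ fun i _ => tendsto_secondDiffDir h.1 h.2 _

end SecondDifferences

/-! ### Bounds for single modes on space-time -/

section HermiteModes

open MeasureTheory Filter Topology

variable {n : ℕ}

/-- The weight `∏ (α_j + 1)` measuring the size of a multi-index. -/
def hermWeight (α : Fin n → ℕ) : ℝ := ∏ j, ((α j : ℝ) + 1)

/-- The square root of the eigenvalue `2|α| + n`. -/
noncomputable def hermFreq (α : Fin n → ℕ) : ℝ := √(2 * (∑ j, (α j : ℝ)) + n)

/-- The integrable weight `∏ (1 + x_j²)⁻¹`. -/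
noncomputable def decayWeight (x : EuclideanSpace ℝ (Fin n)) : ℝ := ∏ j, (1 + (x j) ^ 2)⁻¹

/-- The function `e^{-t √(2|α|+n)} h_α(x)`. -/
noncomputable def hermMode (α : Fin n → ℕ) (z : EuclideanSpace ℝ (Fin n) × ℝ) : ℝ :=
  Real.exp (-z.2 * hermFreq α) * hermiteFunMulti α z.1

theorem one_le_prod_natCast_add_one (α : Fin n → ℕ) (s : Finset (Fin n)) :
    1 ≤ ∏ j ∈ s, ((α j : ℝ) + 1) := by
  have := Finset.prod_le_prod (s := s) (f := fun _ => (1 : ℝ)) (g := fun j => (α j : ℝ) + 1)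
    (fun _ _ => zero_le_one) fun j _ => by simp
  simpa using this

theorem one_le_hermWeight (α : Fin n → ℕ) : 1 ≤ hermWeight α :=
  one_le_prod_natCast_add_one α _

theorem hermWeight_pos (α : Fin n → ℕ) : 0 < hermWeight α :=
  one_pos.trans_le (one_le_hermWeight α)

theorem le_hermWeight (α : Fin n → ℕ) (j : Fin n) : (α j : ℝ) + 1 ≤ hermWeight α := by
  unfold hermWeight
  rw [← Finset.mul_prod_erase _ _ (Finset.mem_univ j)]
  refine le_mul_of_one_le_right (by positivity) ?_
  exact one_le_prod_natCast_add_one α _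

theorem hermFreq_sq (α : Fin n → ℕ) : hermFreq α ^ 2 = 2 * (∑ j, (α j : ℝ)) + n :=
  Real.sq_sqrt (by positivity)

theorem hermFreq_sq_le (α : Fin n → ℕ) : hermFreq α ^ 2 ≤ 2 * n * hermWeight α := by
  rw [hermFreq_sq]
  have h1 : ∑ j, ((α j : ℝ) + 1) ≤ ∑ _j : Fin n, hermWeight α :=
    Finset.sum_le_sum fun j _ => le_hermWeight α j
  rw [Finset.sum_add_distrib] at h1
  simp only [Finset.sum_const, Finset.card_univ, Fintype.card_fin, nsmul_eq_mul, mul_one] at h1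
  have : (0 : ℝ) ≤ n := Nat.cast_nonneg _
  linarith

theorem hermFreq_nonneg (α : Fin n → ℕ) : 0 ≤ hermFreq α := Real.sqrt_nonneg _

theorem one_le_hermFreq (hn : 1 ≤ n) (α : Fin n → ℕ) : 1 ≤ hermFreq α := by
  refine Real.one_le_sqrt.2 ?_
  have h1 : (1 : ℝ) ≤ n := by exact_mod_cast hn
  have h2 : 0 ≤ ∑ j, (α j : ℝ) := by positivity
  linarith

/-- A finite set of multi-indices lies in a box, over which the sum factors into one-dimensional
convergent sums. -/
theorem summable_hermWeight : Summable fun α : Fin n → ℕ => (hermWeight α ^ 2)⁻¹ := by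
  have s1 : Summable fun m : ℕ => (((m : ℝ) + 1) ^ 2)⁻¹ := by
    have := (summable_nat_add_iff 1).2 (Real.summable_nat_pow_inv.2 one_lt_two)
    simpa using this
  refine summable_of_sum_le (c := ∏ _j : Fin n, ∑' m : ℕ, (((m : ℝ) + 1) ^ 2)⁻¹)
    (fun α => by positivity) fun u => ?_
  classical
  let t : Fin n → Finset ℕ := fun j => u.image fun α => α j
  have hu : u ⊆ Fintype.piFinset t := fun α hα =>
    Fintype.mem_piFinset.2 fun j => Finset.mem_image_of_mem _ hα
  calc ∑ α ∈ u, (hermWeight α ^ 2)⁻¹ ≤ ∑ α ∈ Fintype.piFinset t, (hermWeight α ^ 2)⁻¹ :=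
        Finset.sum_le_sum_of_subset_of_nonneg hu fun _ _ _ => by positivity
    _ = ∑ α ∈ Fintype.piFinset t, ∏ j, (((α j : ℝ) + 1) ^ 2)⁻¹ := by
        refine Finset.sum_congr rfl fun α _ => ?_
        rw [hermWeight, ← Finset.prod_pow, Finset.prod_inv_distrib]
    _ = ∏ j, ∑ m ∈ t j, (((m : ℝ) + 1) ^ 2)⁻¹ :=
        (Finset.prod_univ_sum t fun _ m => (((m : ℝ) + 1) ^ 2)⁻¹).symm
    _ ≤ _ := Finset.prod_le_prod (fun j _ => by positivity) fun j _ =>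
        s1.sum_le_tsum _ fun _ _ => by positivity

theorem decayWeight_pos (x : EuclideanSpace ℝ (Fin n)) : 0 < decayWeight x :=
  Finset.prod_pos fun j _ => by positivity

theorem decayWeight_le_one (x : EuclideanSpace ℝ (Fin n)) : decayWeight x ≤ 1 :=
  Finset.prod_le_one (fun j _ => by positivity) fun j _ =>
    inv_le_one_of_one_le₀ (by have := sq_nonneg (x j); linarith)

theorem integrable_euclidean_prod {f : Fin n → ℝ → ℝ} (hf : ∀ j, Integrable (f j)) :
    Integrable fun x : EuclideanSpace ℝ (Fin n) => ∏ j, f j (x j) := by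
  have := (Integrable.fintype_prod hf)
  exact (PiLp.volume_preserving_ofLp (Fin n)).integrable_comp_of_integrable this

theorem integral_euclidean_prod (f : Fin n → ℝ → ℝ) :
    ∫ x : EuclideanSpace ℝ (Fin n), ∏ j, f j (x j) = ∏ j, ∫ y, f j y := by
  rw [← integral_fintype_prod_volume_eq_prod]
  exact (PiLp.volume_preserving_ofLp (Fin n)).integral_comp
    (MeasurableEquiv.toLp 2 (Fin n → ℝ)).symm.measurableEmbedding (fun x => ∏ j, f j (x j))

theorem integrable_decayWeight : Integrable (decayWeight (n := n)) :=
  integrable_euclidean_prod fun _ => integrable_inv_one_add_sq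

theorem contDiff_hermiteFunMulti (α : Fin n → ℕ) : ContDiff ℝ ∞ (hermiteFunMulti α) := by
  unfold hermiteFunMulti
  refine contDiff_prod fun j _ => ?_
  have : ContDiff ℝ ∞ fun x : EuclideanSpace ℝ (Fin n) => x j := by fun_prop
  exact (contDiff_hermiteFun (α j)).comp this

theorem contDiff_hermMode (α : Fin n → ℕ) : ContDiff ℝ ∞ (hermMode α) := by
  have := contDiff_hermiteFunMulti α
  unfold hermMode
  fun_prop

theorem exists_hermiteFunMulti_le :
    ∃ C, 0 ≤ C ∧ ∀ (α : Fin n → ℕ) (x : EuclideanSpace ℝ (Fin n)),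
      |hermiteFunMulti α x| ≤ C * hermWeight α ^ 6 * decayWeight x := by
  obtain ⟨C, hC0, hC⟩ := exists_hermiteFun_weighted_le
  refine ⟨C ^ n, by positivity, fun α x => ?_⟩
  have e : C ^ n * hermWeight α ^ 6 * decayWeight x =
      ∏ j, (C * ((α j : ℝ) + 1) ^ 6 * (1 + (x j) ^ 2)⁻¹) := by
    rw [Finset.prod_mul_distrib, Finset.prod_mul_distrib, Finset.prod_pow, hermWeight,
      decayWeight]
    simp
  rw [e, hermiteFunMulti, Finset.abs_prod]
  exact Finset.prod_le_prod (fun _ _ => abs_nonneg _) fun j _ => by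
    simpa using hC (α j) (x j) 0 (by norm_num)

/-- The sixth power of the weight comes from the one-dimensional bounds. At most two time
derivatives bring out at most `hermFreq α ^ 2`, as the frequency is at least 1 when $n\ge1$, and
this costs one more factor of the weight. -/
theorem exists_iteratedFDeriv_hermMode_le (hn : 1 ≤ n) {k : ℕ} (hk : k ≤ 2) :
    ∃ C, 0 ≤ C ∧ ∀ (α : Fin n → ℕ) (z : EuclideanSpace ℝ (Fin n) × ℝ),
      ‖iteratedFDeriv ℝ k (hermMode α) z‖ ≤
        C * hermWeight α ^ 7 * Real.exp (-z.2 * hermFreq α) := by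
  obtain ⟨C, hC0, hC⟩ := exists_hermiteFun_weighted_le
  have comp : ∀ (L : EuclideanSpace ℝ (Fin n) × ℝ →L[ℝ] ℝ), ‖L‖ ≤ 1 → ∀ (g : ℝ → ℝ),
      ContDiff ℝ ∞ g → ∀ (i : ℕ) z, ‖iteratedFDeriv ℝ i (fun z => g (L z)) z‖ ≤
        |iteratedDeriv i g (L z)| := by
    intro L hL g hg i z
    have := L.iteratedFDeriv_comp_right hg z (i := i) (by exact_mod_cast le_top)
    rw [Function.comp_def] at this
    rw [this, ← Real.norm_eq_abs, ← norm_iteratedFDeriv_eq_norm_iteratedDeriv]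
    refine (ContinuousMultilinearMap.norm_compContinuousLinearMap_le _ _).trans ?_
    refine mul_le_of_le_one_right (norm_nonneg _) ?_
    exact Finset.prod_le_one (fun _ _ => norm_nonneg _) fun _ _ => hL
  let P : Fin n → (EuclideanSpace ℝ (Fin n) × ℝ →L[ℝ] ℝ) := fun j =>
    (EuclideanSpace.proj j).comp (ContinuousLinearMap.fst ℝ _ _)
  have hP : ∀ j, ‖P j‖ ≤ 1 := fun j => ContinuousLinearMap.opNorm_le_bound _ zero_le_one fun z => by
    rw [one_mul]
    exact (PiLp.norm_apply_le z.1 j).trans (norm_fst_le z)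
  have hS : ‖ContinuousLinearMap.snd ℝ (EuclideanSpace ℝ (Fin n)) ℝ‖ ≤ 1 :=
    ContinuousLinearMap.norm_snd_le _ _ _
  let D : ℕ → ℝ := fun i => ∑ p ∈ (Finset.univ : Finset (Fin n)).sym i,
    ((p : Multiset (Fin n)).countPerms : ℝ)
  have hprod : ∀ i ≤ 2, ∀ (α : Fin n → ℕ) z, ‖iteratedFDeriv ℝ i
      (fun z : EuclideanSpace ℝ (Fin n) × ℝ => hermiteFunMulti α z.1) z‖ ≤
        D i * (C ^ n * hermWeight α ^ 6) := by
    intro i hi α z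
    have h1 := norm_iteratedFDeriv_prod_le (𝕜 := ℝ) (u := Finset.univ)
      (f := fun j (z : EuclideanSpace ℝ (Fin n) × ℝ) => hermiteFun (α j) (P j z)) (N := ∞)
      (fun j _ => (contDiff_hermiteFun (α j)).comp (P j).contDiff) (x := z) (n := i)
      (by exact_mod_cast le_top)
    refine h1.trans ?_
    rw [Finset.sum_mul]
    refine Finset.sum_le_sum fun p _ => mul_le_mul_of_nonneg_left ?_ (Nat.cast_nonneg _)
    have e : C ^ n * hermWeight α ^ 6 = ∏ j, (C * ((α j : ℝ) + 1) ^ 6) := by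
      rw [Finset.prod_mul_distrib, Finset.prod_pow, hermWeight]; simp
    rw [e]
    refine Finset.prod_le_prod (fun _ _ => norm_nonneg _) fun j _ => ?_
    refine (comp (P j) (hP j) _ (contDiff_hermiteFun (α j)) _ z).trans ?_
    have hc : Multiset.count j (p : Multiset (Fin n)) ≤ 2 :=
      ((Multiset.count_le_card _ _).trans_eq p.2).trans hi
    refine (hC (α j) _ _ hc).trans (mul_le_of_le_one_right (by positivity) ?_)
    exact inv_le_one_of_one_le₀ (by have := sq_nonneg (P j z); linarith)
  have hexp : ∀ i ≤ 2, ∀ (α : Fin n → ℕ) z, ‖iteratedFDeriv ℝ i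
      (fun z : EuclideanSpace ℝ (Fin n) × ℝ => Real.exp (-z.2 * hermFreq α)) z‖ ≤
        2 * n * hermWeight α * Real.exp (-z.2 * hermFreq α) := by
    intro i hi α z
    have hg : ContDiff ℝ ∞ fun s : ℝ => Real.exp (-hermFreq α * s) := by fun_prop
    have h1 := comp (ContinuousLinearMap.snd ℝ _ _) hS _ hg i z
    rw [iteratedDeriv_exp_const_mul] at h1
    have e : ∀ s : ℝ, -hermFreq α * s = -s * hermFreq α := fun s => by ring
    simp only [ContinuousLinearMap.coe_snd', e] at h1
    refine h1.trans ?_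
    rw [abs_mul, abs_pow, abs_neg, abs_of_nonneg (hermFreq_nonneg α), abs_of_pos (Real.exp_pos _)]
    exact mul_le_mul_of_nonneg_right ((pow_le_pow_right₀ (one_le_hermFreq hn α) hi).trans
      (hermFreq_sq_le α)) (Real.exp_pos _).le
  refine ⟨∑ i ∈ Finset.range (k + 1), (k.choose i : ℝ) * (2 * n) * (D (k - i) * C ^ n),
    by positivity, fun α z => ?_⟩
  have h1 : ContDiff ℝ ∞ (fun z : EuclideanSpace ℝ (Fin n) × ℝ =>
    Real.exp (-z.2 * hermFreq α)) := by fun_prop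
  have h2 : ContDiff ℝ ∞ (fun z : EuclideanSpace ℝ (Fin n) × ℝ => hermiteFunMulti α z.1) :=
    (contDiff_hermiteFunMulti α).comp contDiff_fst
  refine (norm_iteratedFDeriv_mul_le h1 h2 z (by exact_mod_cast le_top)).trans ?_
  rw [Finset.sum_mul, Finset.sum_mul]
  refine Finset.sum_le_sum fun i hi => ?_
  have hi' : i ≤ k := Nat.lt_succ_iff.1 (Finset.mem_range.1 hi)
  have b1 := hexp i (hi'.trans hk) α z
  have b2 := hprod (k - i) ((Nat.sub_le _ _).trans hk) α z
  have hw := (hermWeight_pos α).le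
  calc _ ≤ (k.choose i : ℝ) * (2 * n * hermWeight α * Real.exp (-z.2 * hermFreq α)) *
        (D (k - i) * (C ^ n * hermWeight α ^ 6)) := by gcongr
    _ = _ := by ring

/-- Moving one coordinate of a product of Hermite functions. -/
theorem hermiteFunMulti_add_single (α : Fin n → ℕ) (x : EuclideanSpace ℝ (Fin n)) (j : Fin n)
    (s : ℝ) : hermiteFunMulti α (x + s • EuclideanSpace.single j (1 : ℝ)) =
      hermiteFun (α j) (x j + s) * ∏ i ∈ Finset.univ.erase j, hermiteFun (α i) (x i) := by
  unfold hermiteFunMulti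
  rw [← Finset.mul_prod_erase _ _ (Finset.mem_univ j)]
  congr 1
  · simp
  · refine Finset.prod_congr rfl fun i hi => ?_
    simp [Finset.ne_of_mem_erase hi]

theorem secondDiffDir_hermMode_some (α : Fin n → ℕ) (h : ℝ) (j : Fin n)
    (z : EuclideanSpace ℝ (Fin n) × ℝ) :
    secondDiffDir (hermMode α) h (coordDir (some j)) z = Real.exp (-z.2 * hermFreq α) *
      (secondDiffDir (hermiteFun (α j)) h 1 (z.1 j) *
        ∏ i ∈ Finset.univ.erase j, hermiteFun (α i) (z.1 i)) := by
  have e0 := hermiteFunMulti_add_single α z.1 j 0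
  have e1 := hermiteFunMulti_add_single α z.1 j h
  have e2 := hermiteFunMulti_add_single α z.1 j (-h)
  rw [zero_smul, add_zero, add_zero] at e0
  rw [neg_smul, ← sub_eq_add_neg, ← sub_eq_add_neg] at e2
  simp only [secondDiffDir, hermMode, coordDir, Prod.fst_add, Prod.snd_add, Prod.fst_sub,
    Prod.snd_sub, Prod.smul_fst, Prod.smul_snd, smul_eq_mul, mul_zero, add_zero, sub_zero, e0, e1,
    e2, mul_one]
  ring

theorem secondDiffDir_hermMode_none (α : Fin n → ℕ) (h : ℝ)
    (z : EuclideanSpace ℝ (Fin n) × ℝ) :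
    secondDiffDir (hermMode α) h (coordDir none) z =
      secondDiffDir (fun s => Real.exp (-s * hermFreq α)) h 1 z.2 * hermiteFunMulti α z.1 := by
  simp only [secondDiffDir, hermMode, coordDir, Prod.fst_add, Prod.snd_add, Prod.fst_sub,
    Prod.snd_sub, Prod.smul_fst, Prod.smul_snd, smul_eq_mul, mul_one, smul_zero, add_zero,
    sub_zero]
  ring

theorem exists_secondDiff_hermiteFun_le :
    ∃ C, 0 ≤ C ∧ ∀ (m : ℕ) (y h : ℝ), 0 < h → h ≤ 1 →
      |secondDiffDir (hermiteFun m) h 1 y| ≤ C * (m + 1) ^ 6 * (1 + y ^ 2)⁻¹ := by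
  obtain ⟨C, hC0, hC⟩ := exists_hermiteFun_weighted_le
  refine ⟨3 * C, by positivity, fun m y h hh h1 => ?_⟩
  have d1 : ∀ s, HasDerivAt (hermiteFun m) (deriv (hermiteFun m) s) s := fun s =>
    (hasDerivAt_hermiteFun m s).differentiableAt.hasDerivAt
  have d2 : ∀ s, HasDerivAt (deriv (hermiteFun m)) (iteratedDeriv 2 (hermiteFun m) s) s :=
    fun s => by
      rw [iteratedDeriv_succ, iteratedDeriv_one]
      exact (hasDerivAt_deriv_hermiteFun m s).differentiableAt.hasDerivAt
  have key := norm_secondDifference_le (K := 3 * C * (m + 1) ^ 6 * (1 + y ^ 2)⁻¹) hh.le d1 d2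
    (y := y) fun s hs => by
      -- Within unit distance the decay weights are comparable: $y^2\le2s^2+2(y-s)^2$.
      have hys : 1 + y ^ 2 ≤ 3 * (1 + s ^ 2) := by
        have : |y - s| ≤ 1 := abs_le.2 ⟨by linarith [hs.2], by linarith [hs.1]⟩
        have := (sq_le_one_iff_abs_le_one _).2 this
        nlinarith [sq_nonneg (y - 2 * s)]
      refine (hC m s 2 le_rfl).trans ?_
      have : (1 + s ^ 2)⁻¹ ≤ 3 * (1 + y ^ 2)⁻¹ := by
        rw [inv_eq_one_div, ← div_eq_mul_inv, div_le_div_iff₀ (by positivity) (by positivity)]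
        linarith
      calc _ ≤ C * ((m : ℝ) + 1) ^ 6 * (3 * (1 + y ^ 2)⁻¹) := by gcongr
        _ = _ := by ring
  rw [secondDiffDir, smul_eq_mul, smul_eq_mul h, mul_one, abs_mul, abs_of_nonneg (by positivity : 0 ≤ h⁻¹ ^ 2)]
  rw [Real.norm_eq_abs] at key
  calc _ ≤ h⁻¹ ^ 2 * (3 * C * (m + 1) ^ 6 * (1 + y ^ 2)⁻¹ * h ^ 2) := by gcongr
    _ = _ := by have := hh.ne'; field_simp

/-- A spatial difference moves one coordinate, so the decay in all the others survives. The time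
$t-h$ in the exponential appears because the difference in $t$ reaches back that far. -/
theorem exists_secondDiff_hermMode_le :
    ∃ C, 0 ≤ C ∧ ∀ (α : Fin n → ℕ) (z : EuclideanSpace ℝ (Fin n) × ℝ) (h : ℝ), 0 < h → h ≤ 1 →
      |secondDiff (hermMode α) h z| ≤
        C * hermWeight α ^ 7 * Real.exp (-(z.2 - h) * hermFreq α) * decayWeight z.1 := by
  obtain ⟨C, hC0, hC⟩ := exists_hermiteFun_weighted_le
  obtain ⟨D, hD0, hD⟩ := exists_secondDiff_hermiteFun_le
  obtain ⟨A, hA0, hA⟩ := exists_hermiteFunMulti_le (n := n)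
  refine ⟨2 * n * A + n * (D * C ^ (n - 1)), by positivity, fun α z h hh h1 => ?_⟩
  set X := Real.exp (-(z.2 - h) * hermFreq α) with hX
  have hw1 := one_le_hermWeight α
  have hρ := decayWeight_pos z.1
  have hexp : Real.exp (-z.2 * hermFreq α) ≤ X := by
    refine Real.exp_le_exp.2 ?_
    have := mul_nonneg hh.le (hermFreq_nonneg α)
    linarith
  have hnone : |secondDiffDir (hermMode α) h (coordDir none) z| ≤
      2 * n * A * hermWeight α ^ 7 * X * decayWeight z.1 := by
    have d1 : ∀ s, HasDerivAt (fun s => Real.exp (-s * hermFreq α))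
        (-hermFreq α * Real.exp (-s * hermFreq α)) s := fun s => by
      have := ((hasDerivAt_neg s).mul_const (hermFreq α)).exp
      convert! this using 1; ring
    have key := norm_secondDifference_le (K := hermFreq α ^ 2 * X) hh.le d1
      (u'' := fun s => -hermFreq α * (-hermFreq α * Real.exp (-s * hermFreq α)))
      (fun s => (d1 s).const_mul _)
      (y := z.2) fun s hs => by
        have : Real.exp (-s * hermFreq α) ≤ X := by
          refine Real.exp_le_exp.2 ?_
          have := mul_le_mul_of_nonneg_right hs.1 (hermFreq_nonneg α)
          linarith
        rw [← mul_assoc, neg_mul_neg, ← sq, Real.norm_of_nonneg (by positivity)]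
        gcongr
    have k2 : |secondDiffDir (fun s => Real.exp (-s * hermFreq α)) h 1 z.2| ≤
        hermFreq α ^ 2 * X := by
      rw [secondDiffDir, smul_eq_mul, smul_eq_mul h, mul_one, abs_mul,
        abs_of_nonneg (by positivity : 0 ≤ h⁻¹ ^ 2)]
      rw [Real.norm_eq_abs] at key
      calc _ ≤ h⁻¹ ^ 2 * (hermFreq α ^ 2 * X * h ^ 2) := by gcongr
        _ = _ := by have := hh.ne'; field_simp
    rw [secondDiffDir_hermMode_none, abs_mul]
    have k3 : hermFreq α ^ 2 * X ≤ 2 * n * hermWeight α * X :=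
      mul_le_mul_of_nonneg_right (hermFreq_sq_le α) (Real.exp_pos _).le
    calc _ ≤ (2 * n * hermWeight α * X) * (A * hermWeight α ^ 6 * decayWeight z.1) :=
          mul_le_mul (k2.trans k3) (hA α z.1) (abs_nonneg _) (by positivity)
      _ = _ := by ring
  have hsome : ∀ j, |secondDiffDir (hermMode α) h (coordDir (some j)) z| ≤
      D * C ^ (n - 1) * hermWeight α ^ 7 * X * decayWeight z.1 := fun j => by
    rw [secondDiffDir_hermMode_some, abs_mul, abs_mul, abs_of_pos (Real.exp_pos _),
      Finset.abs_prod]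
    have p1 : ∏ i ∈ Finset.univ.erase j, |hermiteFun (α i) (z.1 i)| ≤
        ∏ i ∈ Finset.univ.erase j, (C * (((α i : ℝ) + 1) ^ 6 * (1 + (z.1 i) ^ 2)⁻¹)) :=
      Finset.prod_le_prod (fun _ _ => abs_nonneg _) fun i _ => by
        simpa [mul_assoc] using hC (α i) (z.1 i) 0 (by norm_num)
    rw [Finset.prod_mul_distrib, Finset.prod_const, Finset.card_erase_of_mem (Finset.mem_univ j),
      Finset.card_univ, Fintype.card_fin] at p1
    have p2 := hD (α j) (z.1 j) h hh h1
    have e : (((α j : ℝ) + 1) ^ 6 * (1 + (z.1 j) ^ 2)⁻¹) *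
        ∏ i ∈ Finset.univ.erase j, (((α i : ℝ) + 1) ^ 6 * (1 + (z.1 i) ^ 2)⁻¹) =
        hermWeight α ^ 6 * decayWeight z.1 := by
      rw [Finset.mul_prod_erase _ (fun i => (((α i : ℝ) + 1) ^ 6 * (1 + (z.1 i) ^ 2)⁻¹))
        (Finset.mem_univ j), Finset.prod_mul_distrib, Finset.prod_pow, hermWeight, decayWeight]
    have hw7 : hermWeight α ^ 6 ≤ hermWeight α ^ 7 := pow_le_pow_right₀ hw1 (by norm_num)
    calc _ ≤ X * ((D * ((α j : ℝ) + 1) ^ 6 * (1 + (z.1 j) ^ 2)⁻¹) *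
          (C ^ (n - 1) *
            ∏ i ∈ Finset.univ.erase j, (((α i : ℝ) + 1) ^ 6 * (1 + (z.1 i) ^ 2)⁻¹))) := by
          gcongr
      _ = D * C ^ (n - 1) * X * (hermWeight α ^ 6 * decayWeight z.1) := by rw [← e]; ring
      _ ≤ D * C ^ (n - 1) * X * (hermWeight α ^ 7 * decayWeight z.1) := by gcongr
      _ = _ := by ring
  rw [secondDiff, Fintype.sum_option]
  refine (abs_add_le _ _).trans ((add_le_add hnone ((Finset.abs_sum_le_sum_abs _ _).trans
    (Finset.sum_le_sum fun j _ => hsome j))).trans (le_of_eq ?_))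
  rw [Finset.sum_const, Finset.card_univ, Fintype.card_fin, nsmul_eq_mul]
  ring

/-- The eigenvalue $2|\alpha|+n$ produced by $\partial_t^2$ cancels the sum of the $2\alpha_j+1$ in
the Hermite equations, leaving $|x|^2$. -/
theorem tendsto_secondDiff_hermMode (α : Fin n → ℕ) (z : EuclideanSpace ℝ (Fin n) × ℝ) :
    Tendsto (fun h => secondDiff (hermMode α) h z) (𝓝[>] 0) (𝓝 (‖z.1‖ ^ 2 * hermMode α z)) := by
  have shift : ∀ {g g' : ℝ → ℝ} {a y : ℝ} (_ : ∀ s, HasDerivAt g (g' s) s)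
      (_ : HasDerivAt g' a y), Tendsto (fun h => secondDiffDir g h 1 y) (𝓝[>] 0) (𝓝 a) := by
    intro g g' a y d1 d2
    have := tendsto_secondDifference (u := fun s => g (y + s)) (u' := fun s => g' (y + s)) (a := a)
      (Eventually.of_forall fun s => (d1 (y + s)).comp_const_add y s)
      (HasDerivAt.comp_const_add y 0 (by simpa using d2))
    simpa [secondDiffDir, sub_eq_add_neg] using this
  have lj : ∀ j, Tendsto (fun h => secondDiffDir (hermMode α) h (coordDir (some j)) z) (𝓝[>] 0)
      (𝓝 (((z.1 j) ^ 2 - (2 * α j + 1)) * hermMode α z)) := fun j => by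
    have h1 := shift (fun s => (hasDerivAt_hermiteFun (α j) s).differentiableAt.hasDerivAt)
      (hasDerivAt_deriv_hermiteFun (α j) (z.1 j))
    have h2 := (h1.mul_const (∏ i ∈ Finset.univ.erase j, hermiteFun (α i) (z.1 i))).const_mul
      (Real.exp (-z.2 * hermFreq α))
    simp only [secondDiffDir_hermMode_some]
    convert! h2 using 2
    rw [hermMode, hermiteFunMulti, ← Finset.mul_prod_erase _ _ (Finset.mem_univ j)]
    ring
  have l0 : Tendsto (fun h => secondDiffDir (hermMode α) h (coordDir none) z) (𝓝[>] 0)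
      (𝓝 ((2 * (∑ j, (α j : ℝ)) + n) * hermMode α z)) := by
    have d1 : ∀ s, HasDerivAt (fun s => Real.exp (-s * hermFreq α))
        (-hermFreq α * Real.exp (-s * hermFreq α)) s := fun s => by
      have := ((hasDerivAt_neg s).mul_const (hermFreq α)).exp
      convert! this using 1; ring
    have h1 := shift d1 ((d1 z.2).const_mul (-hermFreq α))
    have h2 := h1.mul_const (hermiteFunMulti α z.1)
    simp only [secondDiffDir_hermMode_none]
    convert! h2 using 2
    rw [hermMode, ← hermFreq_sq]
    ring
  have := l0.add (tendsto_finsetSum Finset.univ fun j _ => lj j)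
  simp only [secondDiff, Fintype.sum_option]
  convert! this using 2
  rw [← Finset.sum_mul, ← add_mul, EuclideanSpace.norm_sq_eq]
  congr 1
  simp only [Real.norm_eq_abs, sq_abs, Finset.sum_sub_distrib, Finset.sum_add_distrib,
    ← Finset.mul_sum]
  simp

end HermiteModes

/-! ### Series of modes: regularity, the equation, decay -/

section HermiteSeries

open MeasureTheory Filter Topology

variable {n : ℕ} {G : Type*} [NormedAddCommGroup G] [NormedSpace ℝ G]

/-- The series `∑_α e^{-t √(2|α|+n)} h_α(x) a_α`. -/
noncomputable def hermSeries (a : (Fin n → ℕ) → G) (z : EuclideanSpace ℝ (Fin n) × ℝ) : G :=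
  ∑' α, hermMode α z • a α

/-- Summability of the coefficients after damping by time `τ`. -/
def DampedSummable (τ : ℝ) (a : (Fin n → ℕ) → G) : Prop :=
  Summable fun α => hermWeight α ^ 7 * Real.exp (-τ * hermFreq α) * ‖a α‖

/-- Each $\alpha_j+1$ is at most $2|\alpha|+n$; polynomial weights can therefore be absorbed by
exponential damping in the frequency. -/
theorem hermWeight_le_hermFreq_pow (hn : 1 ≤ n) (α : Fin n → ℕ) :
    hermWeight α ≤ hermFreq α ^ (2 * n) := by
  have h1 : (1 : ℝ) ≤ n := by exact_mod_cast hn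
  have : ∀ j ∈ Finset.univ, (α j : ℝ) + 1 ≤ hermFreq α ^ 2 := fun j _ => by
    rw [hermFreq_sq]
    have h2 := Finset.single_le_sum (f := fun j => (α j : ℝ)) (fun _ _ => Nat.cast_nonneg _)
      (Finset.mem_univ j)
    have h3 : 0 ≤ ∑ j, (α j : ℝ) := by positivity
    linarith
  calc hermWeight α ≤ ∏ _j : Fin n, hermFreq α ^ 2 :=
        Finset.prod_le_prod (fun _ _ => by positivity) this
    _ = _ := by rw [Finset.prod_const, Finset.card_univ, Fintype.card_fin, ← pow_mul]

/-- Polynomially bounded coefficients are summable after damping. -/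
theorem dampedSummable_of_le (hn : 1 ≤ n) {τ : ℝ} (hτ : 0 < τ) {a : (Fin n → ℕ) → G} {C : ℝ}
    {K : ℕ} (ha : ∀ α, ‖a α‖ ≤ C * hermWeight α ^ K) : DampedSummable τ a := by
  -- The exponent is $9=7+2$: seven powers from `DampedSummable`, two for summability. Then
  -- $W^{K+9}\le\lambda^m\le (m!/\tau^m)e^{\tau\lambda}$, with $W$ the weight and $\lambda$ the
  -- frequency.
  set m := 2 * n * (K + 9) with hm
  have hC : 0 ≤ C := by
    have := (norm_nonneg _).trans (ha 0)
    exact nonneg_of_mul_nonneg_left this (pow_pos (hermWeight_pos _) _)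
  refine Summable.of_nonneg_of_le (fun α => by have := hermWeight_pos α; positivity) (fun α => ?_)
    (summable_hermWeight.mul_left (C * (m ! / τ ^ m)))
  have hw := hermWeight_pos α
  have e1 := Real.pow_div_factorial_le_exp (τ * hermFreq α)
    (mul_nonneg hτ.le (hermFreq_nonneg α)) m
  have e2 : hermWeight α ^ (K + 9) * Real.exp (-τ * hermFreq α) ≤ m ! / τ ^ m := by
    have e3 : hermWeight α ^ (K + 9) ≤ hermFreq α ^ m := by
      rw [hm, pow_mul]
      exact pow_le_pow_left₀ hw.le (hermWeight_le_hermFreq_pow hn α) _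
    have e4 : hermFreq α ^ m ≤ m ! / τ ^ m * Real.exp (τ * hermFreq α) := by
      rw [div_le_iff₀ (by positivity), mul_pow] at e1
      rw [div_mul_eq_mul_div, le_div_iff₀ (by positivity)]
      linarith
    have e5 : Real.exp (τ * hermFreq α) * Real.exp (-τ * hermFreq α) = 1 := by
      rw [← Real.exp_add]; simp
    calc _ ≤ (m ! / τ ^ m * Real.exp (τ * hermFreq α)) * Real.exp (-τ * hermFreq α) :=
          mul_le_mul_of_nonneg_right (e3.trans e4) (Real.exp_pos _).le
      _ = _ := by rw [mul_assoc, e5, mul_one]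
  calc hermWeight α ^ 7 * Real.exp (-τ * hermFreq α) * ‖a α‖
      ≤ hermWeight α ^ 7 * Real.exp (-τ * hermFreq α) * (C * hermWeight α ^ K) := by
        gcongr; exact ha α
    _ = C * (hermWeight α ^ (K + 9) * Real.exp (-τ * hermFreq α)) * (hermWeight α ^ 2)⁻¹ := by
        rw [pow_add, (by norm_num : (9 : ℕ) = 7 + 2), pow_add]; field_simp
    _ ≤ C * (m ! / τ ^ m) * (hermWeight α ^ 2)⁻¹ := by gcongr

/-- Rapidly decaying coefficients are summable without damping. -/
theorem dampedSummable_zero_of_le {a : (Fin n → ℕ) → G} {C : ℝ}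
    (ha : ∀ α, hermWeight α ^ 9 * ‖a α‖ ≤ C) : DampedSummable 0 a := by
  refine Summable.of_nonneg_of_le (fun α => by have := hermWeight_pos α; positivity) (fun α => ?_)
    (summable_hermWeight.mul_left C)
  have hw := hermWeight_pos α
  rw [neg_zero, zero_mul, Real.exp_zero, mul_one, ← div_eq_mul_inv, le_div_iff₀ (by positivity)]
  refine le_trans (le_of_eq ?_) (ha α)
  ring

theorem DampedSummable.mono {τ τ' : ℝ} (h : τ ≤ τ') {a : (Fin n → ℕ) → G}
    (ha : DampedSummable τ a) : DampedSummable τ' a := by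
  refine Summable.of_nonneg_of_le (fun α => by have := hermWeight_pos α; positivity) (fun α => ?_) ha
  have hw := hermWeight_pos α
  have := mul_le_mul_of_nonneg_right h (hermFreq_nonneg α)
  have e : Real.exp (-τ' * hermFreq α) ≤ Real.exp (-τ * hermFreq α) :=
    Real.exp_le_exp.2 (by linarith)
  gcongr

variable [CompleteSpace G]

theorem summable_hermMode_smul (hn : 1 ≤ n) {a : (Fin n → ℕ) → G}
    {z : EuclideanSpace ℝ (Fin n) × ℝ} (ha : DampedSummable z.2 a) :
    Summable fun α => hermMode α z • a α := by
  obtain ⟨C, hC0, hC⟩ := exists_iteratedFDeriv_hermMode_le hn (k := 0) (by norm_num)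
  refine Summable.of_norm_bounded (ha.mul_left C) fun α => ?_
  have := hC α z
  rw [norm_iteratedFDeriv_zero] at this
  rw [norm_smul]
  calc _ ≤ C * hermWeight α ^ 7 * Real.exp (-z.2 * hermFreq α) * ‖a α‖ := by gcongr
    _ = _ := by ring

theorem isOpen_timeAbove (τ : ℝ) : IsOpen {z : EuclideanSpace ℝ (Fin n) × ℝ | τ < z.2} :=
  isOpen_lt continuous_const continuous_snd

theorem isPreconnected_timeAbove (τ : ℝ) :
    IsPreconnected {z : EuclideanSpace ℝ (Fin n) × ℝ | τ < z.2} := by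
  have : {z : EuclideanSpace ℝ (Fin n) × ℝ | τ < z.2} = Set.univ ×ˢ Set.Ioi τ := by
    ext z; simp
  rw [this]
  exact isPreconnected_univ.prod isPreconnected_Ioi

theorem norm_iteratedFDeriv_hermMode_smul_le (hn : 1 ≤ n) {k : ℕ} (hk : k ≤ 2) :
    ∃ C, 0 ≤ C ∧ ∀ (a : (Fin n → ℕ) → G) (τ : ℝ) (α : Fin n → ℕ)
      (z : EuclideanSpace ℝ (Fin n) × ℝ), τ < z.2 →
      ‖iteratedFDeriv ℝ k (fun z => hermMode α z • a α) z‖ ≤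
        C * (hermWeight α ^ 7 * Real.exp (-τ * hermFreq α) * ‖a α‖) := by
  obtain ⟨C, hC0, hC⟩ := exists_iteratedFDeriv_hermMode_le hn hk
  refine ⟨C, hC0, fun a τ α z hz => ?_⟩
  have e : (fun z => hermMode α z • a α) =
      (ContinuousLinearMap.toSpanSingleton ℝ (a α)) ∘ (hermMode α) := by
    ext z; simp
  rw [e, ContinuousLinearMap.iteratedFDeriv_comp_left _ (contDiff_hermMode α).contDiffAt
    (by exact_mod_cast le_top)]
  refine (ContinuousLinearMap.norm_compContinuousMultilinearMap_le _ _).trans ?_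
  rw [ContinuousLinearMap.norm_toSpanSingleton]
  have h1 : Real.exp (-z.2 * hermFreq α) ≤ Real.exp (-τ * hermFreq α) := by
    have := mul_le_mul_of_nonneg_right hz.le (hermFreq_nonneg α)
    exact Real.exp_le_exp.2 (by linarith)
  have hw := hermWeight_pos α
  calc _ ≤ ‖a α‖ * (C * hermWeight α ^ 7 * Real.exp (-τ * hermFreq α)) := by
        gcongr; exact (hC α z).trans (by gcongr)
    _ = _ := by ring

/-- The series is twice differentiable for positive times. -/
theorem hermSeries_twice_differentiable (hn : 1 ≤ n) {τ : ℝ} {a : (Fin n → ℕ) → G}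
    (ha : DampedSummable τ a) {z : EuclideanSpace ℝ (Fin n) × ℝ} (hz : τ < z.2) :
    DifferentiableAt ℝ (hermSeries a) z ∧ DifferentiableAt ℝ (fderiv ℝ (hermSeries a)) z := by
  obtain ⟨C1, -, h1⟩ := norm_iteratedFDeriv_hermMode_smul_le (G := G) hn (k := 1) (by norm_num)
  obtain ⟨C2, -, h2⟩ := norm_iteratedFDeriv_hermMode_smul_le (G := G) hn (k := 2) le_rfl
  let f : (Fin n → ℕ) → EuclideanSpace ℝ (Fin n) × ℝ → G := fun α z => hermMode α z • a α
  have hf : ∀ α, ContDiff ℝ ∞ (f α) := fun α => (contDiff_hermMode α).smul contDiff_const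
  have b1 : ∀ α w, w ∈ {z : EuclideanSpace ℝ (Fin n) × ℝ | τ < z.2} → ‖fderiv ℝ (f α) w‖ ≤
      C1 * (hermWeight α ^ 7 * Real.exp (-τ * hermFreq α) * ‖a α‖) := fun α w hw => by
    rw [← norm_iteratedFDeriv_zero (𝕜 := ℝ) (f := fderiv ℝ (f α)), norm_iteratedFDeriv_fderiv]
    exact h1 a τ α w hw
  have b2 : ∀ α w, w ∈ {z : EuclideanSpace ℝ (Fin n) × ℝ | τ < z.2} →
      ‖fderiv ℝ (fderiv ℝ (f α)) w‖ ≤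
        C2 * (hermWeight α ^ 7 * Real.exp (-τ * hermFreq α) * ‖a α‖) := fun α w hw => by
    rw [← norm_iteratedFDeriv_zero (𝕜 := ℝ) (f := fderiv ℝ (fderiv ℝ (f α))),
      norm_iteratedFDeriv_fderiv, norm_iteratedFDeriv_fderiv]
    exact h2 a τ α w hw
  have d1 : ∀ w ∈ {z : EuclideanSpace ℝ (Fin n) × ℝ | τ < z.2},
      HasFDerivAt (hermSeries a) (∑' α, fderiv ℝ (f α) w) w := fun w hw =>
    hasFDerivAt_tsum_of_isPreconnected (ha.mul_left C1) (isOpen_timeAbove τ)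
      (isPreconnected_timeAbove τ)
      (fun α w _ => ((hf α).differentiable (by simp) w).hasFDerivAt) b1 hw
      (summable_hermMode_smul hn (ha.mono (le_of_lt hw))) hw
  have d2 : HasFDerivAt (fun w => ∑' α, fderiv ℝ (f α) w)
      (∑' α, fderiv ℝ (fderiv ℝ (f α)) z) z := by
    refine hasFDerivAt_tsum_of_isPreconnected (ha.mul_left C2) (isOpen_timeAbove τ)
      (isPreconnected_timeAbove τ) (fun α w _ => ?_) b2 hz
      (Summable.of_norm_bounded (ha.mul_left C1) fun α => b1 α z hz) hz
    have : ContDiff ℝ 1 (fderiv ℝ (f α)) :=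
      (hf α).fderiv_right (by norm_cast)
    exact (this.differentiable (by simp) w).hasFDerivAt
  refine ⟨(d1 z hz).differentiableAt, ?_⟩
  refine d2.differentiableAt.congr_of_eventuallyEq ?_
  filter_upwards [(isOpen_timeAbove τ).mem_nhds hz] with w hw
  exact (d1 w hw).fderiv

theorem hasSum_secondDiffDir {V ι : Type*} [AddCommGroup V] [Module ℝ V] {u : ι → V → ℝ}
    {a : ι → G} {h : ℝ} {d z : V}
    (h1 : Summable fun i => u i (z + h • d) • a i) (h2 : Summable fun i => u i (z - h • d) • a i)
    (h3 : Summable fun i => u i z • a i) :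
    HasSum (fun i => secondDiffDir (u i) h d z • a i)
      (secondDiffDir (fun z => ∑' i, u i z • a i) h d z) := by
  have := ((h1.hasSum.add h2.hasSum).sub (h3.hasSum.const_smul (2 : ℝ))).const_smul ((h⁻¹) ^ 2)
  convert! this using 2
  simp only [secondDiffDir, smul_eq_mul]
  module

theorem hasSum_secondDiff (hn : 1 ≤ n) {a : (Fin n → ℕ) → G} {h : ℝ} (hh : 0 ≤ h)
    {z : EuclideanSpace ℝ (Fin n) × ℝ} (ha : DampedSummable (z.2 - h) a) :
    HasSum (fun α => secondDiff (hermMode α) h z • a α) (secondDiff (hermSeries a) h z) := by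
  have key : ∀ w : EuclideanSpace ℝ (Fin n) × ℝ, z.2 - h ≤ w.2 →
      Summable fun α => hermMode α w • a α := fun w hw =>
    summable_hermMode_smul hn (ha.mono hw)
  have := hasSum_sum (s := Finset.univ) fun (i : Option (Fin n)) _ =>
    hasSum_secondDiffDir (u := hermMode) (a := a) (h := h) (d := coordDir i) (z := z)
      (key _ (by cases i <;> simp [coordDir] <;> linarith))
      (key _ (by cases i <;> simp [coordDir] <;> linarith))
      (key _ (by linarith))
  simp only [secondDiff, Finset.sum_smul]
  exact this

/-- Solutions `v` of `L' v = 0`: the discrete Laplacian of the series tends to `|x|² v`. -/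
theorem tendsto_secondDiff_hermSeries (hn : 1 ≤ n) {a : (Fin n → ℕ) → G}
    {z : EuclideanSpace ℝ (Fin n) × ℝ} {τ : ℝ} (hτ : τ < z.2) (ha : DampedSummable τ a) :
    Tendsto (fun h => secondDiff (hermSeries a) h z) (𝓝[>] 0) (𝓝 (‖z.1‖ ^ 2 • hermSeries a z)) := by
  obtain ⟨C, hC0, hC⟩ := exists_secondDiff_hermMode_le (n := n)
  have mem : Set.Ioo (0 : ℝ) (min 1 (z.2 - τ)) ∈ 𝓝[>] (0 : ℝ) :=
    Ioo_mem_nhdsGT (lt_min one_pos (sub_pos.2 hτ))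
  have lim : Tendsto (fun h => ∑' α, secondDiff (hermMode α) h z • a α) (𝓝[>] 0)
      (𝓝 (∑' α, (‖z.1‖ ^ 2 * hermMode α z) • a α)) := by
    refine tendsto_tsum_of_dominated_convergence (ha.mul_left C)
      (fun α => (tendsto_secondDiff_hermMode α z).smul_const (a α)) ?_
    filter_upwards [mem] with h hh α
    have h1 := hh.2.trans_le (min_le_left _ _)
    have h2 := hh.2.trans_le (min_le_right _ _)
    have hw := hermWeight_pos α
    have e : Real.exp (-(z.2 - h) * hermFreq α) ≤ Real.exp (-τ * hermFreq α) := by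
      have := mul_le_mul_of_nonneg_right (by linarith : τ ≤ z.2 - h) (hermFreq_nonneg α)
      exact Real.exp_le_exp.2 (by linarith)
    rw [norm_smul, Real.norm_eq_abs]
    calc _ ≤ (C * hermWeight α ^ 7 * Real.exp (-τ * hermFreq α) * 1) * ‖a α‖ := by
          refine mul_le_mul_of_nonneg_right ((hC α z h hh.1 h1.le).trans ?_) (norm_nonneg _)
          exact mul_le_mul (by gcongr) (decayWeight_le_one _) (decayWeight_pos _).le
            (by positivity)
      _ = _ := by ring
  have e2 : ∑' α, (‖z.1‖ ^ 2 * hermMode α z) • a α = ‖z.1‖ ^ 2 • hermSeries a z := by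
    simp only [mul_smul]
    exact (summable_hermMode_smul hn (ha.mono hτ.le)).tsum_const_smul _
  rw [← e2]
  refine lim.congr' ?_
  filter_upwards [mem] with h hh
  have h2 := hh.2.trans_le (min_le_right _ _)
  exact (hasSum_secondDiff hn hh.1.le (ha.mono (by linarith))).tsum_eq

theorem exp_hermFreq_le (hn : 1 ≤ n) (α : Fin n → ℕ) {s : ℝ} (hs : 0 ≤ s) :
    Real.exp (-s * hermFreq α) ≤ Real.exp (-s) := by
  have := mul_le_mul_of_nonneg_left (one_le_hermFreq hn α) hs
  exact Real.exp_le_exp.2 (by linarith)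

/-- Decay of the series in space and time when the coefficients are summable. -/
theorem exists_norm_hermSeries_le (hn : 1 ≤ n) {a : (Fin n → ℕ) → G} (ha : DampedSummable 0 a) :
    ∃ C, 0 ≤ C ∧ ∀ z : EuclideanSpace ℝ (Fin n) × ℝ, 0 ≤ z.2 →
      ‖hermSeries a z‖ ≤ C * (Real.exp (-z.2) * decayWeight z.1) := by
  obtain ⟨C, hC0, hC⟩ := exists_hermiteFunMulti_le (n := n)
  have ha' : Summable fun α => hermWeight α ^ 7 * ‖a α‖ := by simpa [DampedSummable] using ha
  refine ⟨C * ∑' α, hermWeight α ^ 7 * ‖a α‖, mul_nonneg hC0 (tsum_nonneg fun α => by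
    have := hermWeight_pos α; positivity), fun z hz => ?_⟩
  rw [mul_right_comm, ← tsum_mul_left]
  refine tsum_of_norm_bounded (Summable.hasSum ?_) fun α => ?_
  · exact (ha'.mul_left _)
  · have hw1 := one_le_hermWeight α
    have hw7 : hermWeight α ^ 6 ≤ hermWeight α ^ 7 := pow_le_pow_right₀ hw1 (by norm_num)
    have hw := hermWeight_pos α
    have hρ := decayWeight_pos z.1
    rw [norm_smul, hermMode, norm_mul, Real.norm_of_nonneg (Real.exp_pos _).le, Real.norm_eq_abs]
    calc _ ≤ Real.exp (-z.2) * (C * hermWeight α ^ 7 * decayWeight z.1) * ‖a α‖ := by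
          refine mul_le_mul_of_nonneg_right (mul_le_mul (exp_hermFreq_le hn α hz)
            ((hC α z.1).trans (by gcongr)) (abs_nonneg _) (Real.exp_pos _).le) (norm_nonneg _)
      _ = _ := by ring

/-- Uniformity in $h\le1$ costs a factor $e$, from $e^{-(t-h)}\le e\cdot e^{-t}$; this uniform decay
feeds the Fatou minorant. -/
theorem exists_norm_secondDiff_hermSeries_le (hn : 1 ≤ n) {a : (Fin n → ℕ) → G}
    (ha : DampedSummable 0 a) :
    ∃ C, 0 ≤ C ∧ ∀ (z : EuclideanSpace ℝ (Fin n) × ℝ) (h : ℝ), 0 < h → h ≤ 1 → h ≤ z.2 →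
      ‖secondDiff (hermSeries a) h z‖ ≤ C * (Real.exp (-z.2) * decayWeight z.1) := by
  obtain ⟨C, hC0, hC⟩ := exists_secondDiff_hermMode_le (n := n)
  have ha' : Summable fun α => hermWeight α ^ 7 * ‖a α‖ := by simpa [DampedSummable] using ha
  refine ⟨C * Real.exp 1 * ∑' α, hermWeight α ^ 7 * ‖a α‖,
    mul_nonneg (by positivity) (tsum_nonneg fun α => by
      have := hermWeight_pos α; positivity), fun z h hh h1 hz => ?_⟩
  rw [mul_right_comm, ← tsum_mul_left,
    ← (hasSum_secondDiff hn hh.le (ha.mono (by linarith))).tsum_eq]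
  refine tsum_of_norm_bounded (Summable.hasSum ?_) fun α => ?_
  · exact (ha'.mul_left _)
  · have hw := hermWeight_pos α
    have hρ := decayWeight_pos z.1
    have e : Real.exp (-(z.2 - h) * hermFreq α) ≤ Real.exp 1 * Real.exp (-z.2) := by
      refine (exp_hermFreq_le hn α (sub_nonneg.2 hz)).trans ?_
      rw [← Real.exp_add]
      exact Real.exp_le_exp.2 (by linarith)
    rw [norm_smul, Real.norm_eq_abs]
    calc _ ≤ (C * hermWeight α ^ 7 * (Real.exp 1 * Real.exp (-z.2)) * decayWeight z.1) *
          ‖a α‖ := by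
          refine mul_le_mul_of_nonneg_right ((hC α z h hh h1).trans ?_) (norm_nonneg _)
          gcongr
      _ = _ := by ring

theorem tendsto_hermSeries_zero (hn : 1 ≤ n) {a : (Fin n → ℕ) → G} (ha : DampedSummable 0 a)
    (x : EuclideanSpace ℝ (Fin n)) :
    Tendsto (fun t => hermSeries a (x, t)) (𝓝[>] 0) (𝓝 (hermSeries a (x, 0))) := by
  obtain ⟨C, hC0, hC⟩ := exists_iteratedFDeriv_hermMode_le hn (k := 0) (by norm_num)
  have ha' : Summable fun α => hermWeight α ^ 7 * ‖a α‖ := by simpa [DampedSummable] using ha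
  refine tendsto_tsum_of_dominated_convergence (ha'.mul_left C) (fun α => ?_) ?_
  · have : Continuous fun t : ℝ => hermMode α (x, t) • a α := by
      have := (contDiff_hermMode α).continuous
      fun_prop
    exact this.continuousWithinAt
  · filter_upwards [self_mem_nhdsWithin] with t ht α
    have hw := hermWeight_pos α
    have h0 := hC α (x, t)
    rw [norm_iteratedFDeriv_zero] at h0
    have h1 : Real.exp (-t * hermFreq α) ≤ 1 := by
      rw [Real.exp_le_one_iff]
      have := mul_nonneg (le_of_lt ht) (hermFreq_nonneg α)
      linarith
    rw [norm_smul]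
    calc _ ≤ C * hermWeight α ^ 7 * 1 * ‖a α‖ :=
          mul_le_mul_of_nonneg_right (h0.trans (by gcongr)) (norm_nonneg _)
      _ = _ := by ring

end HermiteSeries

/-! ### Hermite coefficients of integrable functions and of test functions -/

section HermiteCoefficients

open MeasureTheory Filter Topology

variable {n : ℕ} {G : Type*} [NormedAddCommGroup G] [NormedSpace ℝ G]

/-- The Hermite coefficients `∫ h_α u`. -/
noncomputable def hermCoeff (u : EuclideanSpace ℝ (Fin n) → G) (α : Fin n → ℕ) : G :=
  ∫ y, hermiteFunMulti α y • u y

theorem hermitePoisson_eq_hermSeries (u : EuclideanSpace ℝ (Fin n) → G)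
    (z : EuclideanSpace ℝ (Fin n) × ℝ) :
    hermitePoisson z.2 u z.1 = hermSeries (hermCoeff u) z := rfl

theorem continuous_hermiteFunMulti (α : Fin n → ℕ) : Continuous (hermiteFunMulti α) :=
  (contDiff_hermiteFunMulti α).continuous

theorem exists_norm_hermCoeff_le {u : EuclideanSpace ℝ (Fin n) → G} (hu : Integrable u) :
    ∃ C, ∀ α, ‖hermCoeff u α‖ ≤ C * hermWeight α ^ 6 := by
  obtain ⟨C, hC0, hC⟩ := exists_hermiteFunMulti_le (n := n)
  refine ⟨C * ∫ y, ‖u y‖, fun α => ?_⟩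
  have hw := hermWeight_pos α
  rw [mul_right_comm, ← integral_const_mul]
  refine norm_integral_le_of_norm_le (hu.norm.const_mul _) (Eventually.of_forall fun y => ?_)
  rw [norm_smul, Real.norm_eq_abs]
  refine mul_le_mul_of_nonneg_right ((hC α y).trans ?_) (norm_nonneg _)
  exact mul_le_of_le_one_right (by positivity) (decayWeight_le_one y)

theorem dampedSummable_hermCoeff (hn : 1 ≤ n) {τ : ℝ} (hτ : 0 < τ)
    {u : EuclideanSpace ℝ (Fin n) → G} (hu : Integrable u) :
    DampedSummable τ (hermCoeff u) := by
  obtain ⟨C, hC⟩ := exists_norm_hermCoeff_le hu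
  exact dampedSummable_of_le hn hτ hC

/-- The partial Hermite operator `-∂_j² + x_j²`. -/
noncomputable def partialHermiteOp (j : Fin n) (u : EuclideanSpace ℝ (Fin n) → G)
    (x : EuclideanSpace ℝ (Fin n)) : G :=
  (x j) ^ 2 • u x - fderiv ℝ (fun y => fderiv ℝ u y (EuclideanSpace.single j 1)) x
    (EuclideanSpace.single j 1)

theorem contDiff_fderiv_apply {V W : Type*} [NormedAddCommGroup V] [NormedSpace ℝ V]
    [NormedAddCommGroup W] [NormedSpace ℝ W] {u : V → W} (hu : ContDiff ℝ ∞ u) (v : V) :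
    ContDiff ℝ ∞ fun y => fderiv ℝ u y v :=
  (hu.fderiv_right (m := ∞) (by simp)).clm_apply contDiff_const

theorem hasCompactSupport_fderiv_apply {V W : Type*} [NormedAddCommGroup V] [NormedSpace ℝ V]
    [NormedAddCommGroup W] [NormedSpace ℝ W] {u : V → W} (hu : HasCompactSupport u) (v : V) :
    HasCompactSupport fun y => fderiv ℝ u y v :=
  hu.fderiv_apply (𝕜 := ℝ) v

theorem contDiff_partialHermiteOp (j : Fin n) {u : EuclideanSpace ℝ (Fin n) → G}
    (hu : ContDiff ℝ ∞ u) : ContDiff ℝ ∞ (partialHermiteOp j u) := by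
  have h1 : ContDiff ℝ ∞ fun x : EuclideanSpace ℝ (Fin n) => (x j) ^ 2 := by fun_prop
  exact (h1.smul hu).sub (contDiff_fderiv_apply (contDiff_fderiv_apply hu _) _)

theorem hasCompactSupport_partialHermiteOp (j : Fin n) {u : EuclideanSpace ℝ (Fin n) → G}
    (hu : HasCompactSupport u) : HasCompactSupport (partialHermiteOp j u) :=
  (hu.smul_left (f := fun x : EuclideanSpace ℝ (Fin n) => (x j) ^ 2)).sub
    (hasCompactSupport_fderiv_apply (hasCompactSupport_fderiv_apply hu _) _)

theorem fderiv_hermiteFunMulti_single (α : Fin n → ℕ) (j : Fin n) (x : EuclideanSpace ℝ (Fin n)) :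
    fderiv ℝ (hermiteFunMulti α) x (EuclideanSpace.single j 1) =
      deriv (hermiteFun (α j)) (x j) * ∏ i ∈ Finset.univ.erase j, hermiteFun (α i) (x i) := by
  have hd := (contDiff_hermiteFunMulti α).differentiable (by simp) x
  rw [← hd.lineDeriv_eq_fderiv]
  refine HasLineDerivAt.lineDeriv ?_
  unfold HasLineDerivAt
  simp only [hermiteFunMulti_add_single]
  have := (hasDerivAt_hermiteFun (α j) (x j)).differentiableAt.hasDerivAt
  exact (HasDerivAt.comp_const_add (x j) 0 (by simpa using this)).mul_const _

theorem fderiv_fderiv_hermiteFunMulti_single (α : Fin n → ℕ) (j : Fin n)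
    (x : EuclideanSpace ℝ (Fin n)) :
    fderiv ℝ (fun y => fderiv ℝ (hermiteFunMulti α) y (EuclideanSpace.single j 1)) x
      (EuclideanSpace.single j 1) = ((x j) ^ 2 - (2 * α j + 1)) * hermiteFunMulti α x := by
  have hd := (contDiff_fderiv_apply (contDiff_hermiteFunMulti α)
    (EuclideanSpace.single j 1)).differentiable (by simp) x
  rw [← hd.lineDeriv_eq_fderiv]
  refine HasLineDerivAt.lineDeriv ?_
  unfold HasLineDerivAt
  have e : hermiteFunMulti α x =
      hermiteFun (α j) (x j) * ∏ i ∈ Finset.univ.erase j, hermiteFun (α i) (x i) :=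
    (Finset.mul_prod_erase _ _ (Finset.mem_univ j)).symm
  rw [e, ← mul_assoc]
  simp only [fderiv_hermiteFunMulti_single]
  have h1 : ∀ s : ℝ, ∏ i ∈ Finset.univ.erase j,
      hermiteFun (α i) ((x + s • EuclideanSpace.single j (1 : ℝ)) i) =
      ∏ i ∈ Finset.univ.erase j, hermiteFun (α i) (x i) := fun s =>
    Finset.prod_congr rfl fun i hi => by simp [Finset.ne_of_mem_erase hi]
  have h2 : ∀ s : ℝ, (x + s • EuclideanSpace.single j (1 : ℝ)) j = x j + s := by simp
  simp only [h1, h2]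
  have := hasDerivAt_deriv_hermiteFun (α j) (x j)
  exact (HasDerivAt.comp_const_add (x j) 0 (by simpa using this)).mul_const _

/-- Two integrations by parts move the operator onto $h_\alpha$, an eigenfunction with eigenvalue
$2\alpha_j+1$. -/
theorem hermCoeff_partialHermiteOp (j : Fin n) {u : EuclideanSpace ℝ (Fin n) → G}
    (hu : ContDiff ℝ ∞ u) (hu' : HasCompactSupport u) (α : Fin n → ℕ) :
    hermCoeff (partialHermiteOp j u) α = (2 * (α j : ℝ) + 1) • hermCoeff u α := by
  set e : EuclideanSpace ℝ (Fin n) := EuclideanSpace.single j 1 with he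
  have ch := contDiff_hermiteFunMulti α
  have ch1 := contDiff_fderiv_apply ch e
  have ch2 := contDiff_fderiv_apply ch1 e
  have cu1 := contDiff_fderiv_apply hu e
  have cu2 := contDiff_fderiv_apply cu1 e
  have su1 := hasCompactSupport_fderiv_apply hu' e
  have su2 := hasCompactSupport_fderiv_apply su1 e
  have int : ∀ {a : EuclideanSpace ℝ (Fin n) → ℝ} {b : EuclideanSpace ℝ (Fin n) → G},
      Continuous a → Continuous b → HasCompactSupport b → Integrable fun x => a x • b x :=
    fun ha hb hb' => (ha.smul hb).integrable_of_hasCompactSupport hb'.smul_left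
  have i1 := integral_smul_fderiv_eq_neg_fderiv_smul_of_integrable (μ := volume) (v := e)
    (int ch1.continuous cu1.continuous su1) (int ch.continuous cu2.continuous su2)
    (int ch.continuous cu1.continuous su1) (fun x _ => ch.differentiable (by simp) x)
    (fun x _ => cu1.differentiable (by simp) x)
  have i2 := integral_smul_fderiv_eq_neg_fderiv_smul_of_integrable (μ := volume) (v := e)
    (int ch2.continuous hu.continuous hu') (int ch1.continuous cu1.continuous su1)
    (int ch1.continuous hu.continuous hu') (fun x _ => ch1.differentiable (by simp) x)
    (fun x _ => hu.differentiable (by simp) x)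
  rw [i2, neg_neg] at i1
  have cx : Continuous fun x : EuclideanSpace ℝ (Fin n) => hermiteFunMulti α x * (x j) ^ 2 := by
    have := ch.continuous
    fun_prop
  have e1 : hermCoeff (partialHermiteOp j u) α =
      (∫ x, (hermiteFunMulti α x * (x j) ^ 2) • u x) -
        ∫ x, hermiteFunMulti α x • fderiv ℝ (fun y => fderiv ℝ u y e) x e := by
    rw [← integral_sub (int cx hu.continuous hu') (int ch.continuous cu2.continuous su2)]
    refine integral_congr_ae (Eventually.of_forall fun x => ?_)
    simp only [partialHermiteOp, smul_sub, mul_smul, he]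
  rw [e1, i1, ← integral_sub (int cx hu.continuous hu') (int ch2.continuous hu.continuous hu'),
    hermCoeff, ← integral_smul]
  refine integral_congr_ae (Eventually.of_forall fun x => ?_)
  simp only [he, fderiv_fderiv_hermiteFunMulti_single]
  module

/-- Composing the partial operators multiplies their eigenvalues, and the product over all
coordinates dominates `hermWeight` directly. -/
theorem exists_hermCoeff_eq_prod_smul (s : Finset (Fin n)) {u : EuclideanSpace ℝ (Fin n) → G}
    (hu : ContDiff ℝ ∞ u) (hu' : HasCompactSupport u) :
    ∃ v : EuclideanSpace ℝ (Fin n) → G, ContDiff ℝ ∞ v ∧ HasCompactSupport v ∧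
      ∀ α, hermCoeff v α = (∏ j ∈ s, (2 * (α j : ℝ) + 1)) • hermCoeff u α := by
  classical
  induction s using Finset.induction_on with
  | empty => exact ⟨u, hu, hu', fun α => by simp⟩
  | insert j s hj ih =>
    obtain ⟨v, hv, hv', e⟩ := ih
    refine ⟨_, contDiff_partialHermiteOp j hv, hasCompactSupport_partialHermiteOp j hv',
      fun α => ?_⟩
    rw [hermCoeff_partialHermiteOp j hv hv', e, Finset.prod_insert hj, mul_smul]

theorem exists_hermCoeff_eq_pow_smul (k : ℕ) {u : EuclideanSpace ℝ (Fin n) → G}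
    (hu : ContDiff ℝ ∞ u) (hu' : HasCompactSupport u) :
    ∃ v : EuclideanSpace ℝ (Fin n) → G, ContDiff ℝ ∞ v ∧ HasCompactSupport v ∧
      ∀ α, hermCoeff v α = (∏ j, (2 * (α j : ℝ) + 1)) ^ k • hermCoeff u α := by
  induction k with
  | zero => exact ⟨u, hu, hu', fun α => by simp⟩
  | succ k ih =>
    obtain ⟨v, hv, hv', e⟩ := ih
    obtain ⟨w, hw, hw', e'⟩ := exists_hermCoeff_eq_prod_smul Finset.univ hv hv'
    refine ⟨w, hw, hw', fun α => ?_⟩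
    rw [e', e, pow_succ', mul_smul]

/-- The Hermite coefficients of a test function decay rapidly. -/
theorem dampedSummable_zero_hermCoeff {u : EuclideanSpace ℝ (Fin n) → G}
    (hu : ContDiff ℝ ∞ u) (hu' : HasCompactSupport u) : DampedSummable 0 (hermCoeff u) := by
  -- Here $15=9+6$: nine powers of decay are wanted, and the coefficients of $v$ may themselves grow
  -- like the sixth power.
  obtain ⟨v, hv, hv', e⟩ := exists_hermCoeff_eq_pow_smul 15 hu hu'
  obtain ⟨C, hC⟩ := exists_norm_hermCoeff_le (hv.continuous.integrable_of_hasCompactSupport hv')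
  refine dampedSummable_zero_of_le (C := C) fun α => ?_
  have hw := hermWeight_pos α
  have h1 : hermWeight α ≤ ∏ j, (2 * (α j : ℝ) + 1) :=
    Finset.prod_le_prod (fun j _ => by positivity) fun j _ => by
      have : (0 : ℝ) ≤ α j := Nat.cast_nonneg _
      linarith
  have h2 := hC α
  rw [e, norm_smul, norm_pow, Real.norm_of_nonneg (hw.le.trans h1)] at h2
  have h3 : hermWeight α ^ 15 * ‖hermCoeff u α‖ ≤ C * hermWeight α ^ 6 :=
    le_trans (by gcongr) h2
  refine le_of_mul_le_mul_right (le_trans (le_of_eq ?_) h3) (pow_pos hw 6)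
  ring

end HermiteCoefficients

/-! ### Completeness of the Hermite functions and inversion -/

section HermiteCompleteness

open MeasureTheory Filter Topology

variable {n : ℕ}

theorem integrable_bounded_smul {G : Type*} [NormedAddCommGroup G] [NormedSpace ℝ G]
    {ψ : EuclideanSpace ℝ (Fin n) → ℝ} {u : EuclideanSpace ℝ (Fin n) → G}
    (h1 : Continuous ψ) {C : ℝ} (h2 : ∀ x, |ψ x| ≤ C) (hu : Integrable u) :
    Integrable fun x => ψ x • u x :=
  hu.bdd_smul C h1.aestronglyMeasurable (Eventually.of_forall h2)

theorem exists_abs_hermiteFunMulti_le (α : Fin n → ℕ) : ∃ C, ∀ x, |hermiteFunMulti α x| ≤ C := by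
  obtain ⟨C, hC0, hC⟩ := exists_hermiteFunMulti_le (n := n)
  have hw := hermWeight_pos α
  exact ⟨C * hermWeight α ^ 6, fun x => (hC α x).trans
    (mul_le_of_le_one_right (by positivity) (decayWeight_le_one x))⟩

theorem integral_hermiteFunMulti_mul (α β : Fin n → ℕ) :
    ∫ x, hermiteFunMulti β x * hermiteFunMulti α x = if α = β then 1 else 0 := by
  simp only [hermiteFunMulti, ← Finset.prod_mul_distrib]
  rw [integral_euclidean_prod fun j y => hermiteFun (β j) y * hermiteFun (α j) y]
  simp only [integral_hermiteFun_mul]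
  split_ifs with h
  · simp [h]
  · obtain ⟨j, hj⟩ := Function.ne_iff.1 h
    exact Finset.prod_eq_zero (Finset.mem_univ j) (if_neg (Ne.symm hj))

section Real

variable {G : Type*} [NormedAddCommGroup G] [NormedSpace ℝ G] [CompleteSpace G]

theorem continuous_hermSeries_zero (hn : 1 ≤ n) {a : (Fin n → ℕ) → G} (ha : DampedSummable 0 a) :
    Continuous fun x : EuclideanSpace ℝ (Fin n) => hermSeries a (x, 0) := by
  obtain ⟨C, hC0, hC⟩ := exists_iteratedFDeriv_hermMode_le hn (k := 0) (by norm_num)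
  refine continuous_tsum (u := fun α => C * (hermWeight α ^ 7 * Real.exp (-0 * hermFreq α) * ‖a α‖))
    (fun α => ?_) (ha.mul_left C) fun α x => ?_
  · have := (contDiff_hermMode α).continuous
    fun_prop
  · have := hC α (x, 0)
    rw [norm_iteratedFDeriv_zero] at this
    rw [norm_smul]
    calc _ ≤ C * hermWeight α ^ 7 * Real.exp (-0 * hermFreq α) * ‖a α‖ := by gcongr
      _ = _ := by ring

theorem integrable_hermSeries_zero (hn : 1 ≤ n) {a : (Fin n → ℕ) → G} (ha : DampedSummable 0 a) :
    Integrable fun x : EuclideanSpace ℝ (Fin n) => hermSeries a (x, 0) := by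
  obtain ⟨C, hC0, hC⟩ := exists_norm_hermSeries_le hn ha
  refine (integrable_decayWeight.const_mul C).mono'
    (continuous_hermSeries_zero hn ha).aestronglyMeasurable (Eventually.of_forall fun x => ?_)
  simpa using hC (x, 0) le_rfl

/-- Absolute summability with an integrable spatial weight permits termwise integration;
orthonormality leaves one term. -/
theorem hermCoeff_hermSeries_zero (hn : 1 ≤ n) {a : (Fin n → ℕ) → G} (ha : DampedSummable 0 a)
    (β : Fin n → ℕ) : hermCoeff (fun x => hermSeries a (x, 0)) β = a β := by
  obtain ⟨C, hC0, hC⟩ := exists_hermiteFunMulti_le (n := n)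
  obtain ⟨D, hD⟩ := exists_abs_hermiteFunMulti_le β
  have hD0 : 0 ≤ D := (abs_nonneg _).trans (hD 0)
  have ha' : Summable fun α => hermWeight α ^ 7 * ‖a α‖ := by simpa [DampedSummable] using ha
  have mode0 : ∀ (α : Fin n → ℕ) (x : EuclideanSpace ℝ (Fin n)), hermMode α (x, (0 : ℝ)) = hermiteFunMulti α x := fun α x => by
    simp [hermMode]
  have cα := continuous_hermiteFunMulti (n := n)
  have bd : ∀ α x, ‖hermiteFunMulti β x • hermMode α (x, (0 : ℝ)) • a α‖ ≤
      (D * C * (hermWeight α ^ 7 * ‖a α‖)) * decayWeight x := fun α x => by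
    have hw := one_le_hermWeight α
    have hρ := decayWeight_pos x
    have h1 : |hermiteFunMulti α x| ≤ C * hermWeight α ^ 7 * decayWeight x :=
      (hC α x).trans (by gcongr <;> norm_num)
    rw [mode0, norm_smul, norm_smul, Real.norm_eq_abs, Real.norm_eq_abs]
    calc _ ≤ D * ((C * hermWeight α ^ 7 * decayWeight x) * ‖a α‖) := by
          gcongr; exact hD x
      _ = _ := by ring
  have hs := hasSum_integral_of_dominated_convergence (μ := volume)
    (F := fun α x => hermiteFunMulti β x • hermMode α (x, (0 : ℝ)) • a α)
    (f := fun x => hermiteFunMulti β x • hermSeries a (x, 0))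
    (fun α x => (D * C * (hermWeight α ^ 7 * ‖a α‖)) * decayWeight x)
    (fun α => by
      simp only [mode0]
      exact ((cα β).smul ((cα α).smul continuous_const)).aestronglyMeasurable)
    (fun α => Eventually.of_forall (bd α))
    (Eventually.of_forall fun x => (ha'.mul_left (D * C)).mul_right _)
    (by simp only [tsum_mul_right]; exact integrable_decayWeight.const_mul _)
    (Eventually.of_forall fun x => (summable_hermMode_smul hn (z := (x, 0)) ha).hasSum.const_smul _)
  have e : ∀ α, ∫ x, hermiteFunMulti β x • hermMode α (x, (0 : ℝ)) • a α =
      if α = β then a β else 0 := fun α => by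
    simp only [mode0, smul_smul]
    rw [integral_smul_const, integral_hermiteFunMulti_mul]
    split_ifs with h
    · rw [h, one_smul]
    · rw [zero_smul]
  simp only [e] at hs
  exact hs.unique (hasSum_ite_eq β (a β))

/-- The span of the Hermite functions. -/
noncomputable def hermiteSpan (n : ℕ) : Submodule ℝ (EuclideanSpace ℝ (Fin n) → ℝ) :=
  Submodule.span ℝ (Set.range hermiteFunMulti)

/-- The three-term recurrence in the coordinate $j$; when $\alpha_j=0$ the truncated index carries
the coefficient zero. -/
theorem coord_mul_hermiteFunMulti_mem (j : Fin n) (α : Fin n → ℕ) :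
    (fun x : EuclideanSpace ℝ (Fin n) => x j * hermiteFunMulti α x) ∈ hermiteSpan n := by
  have e : (fun x : EuclideanSpace ℝ (Fin n) => x j * hermiteFunMulti α x) =
      (√(2 * ((α j : ℝ) + 1)) / 2) • hermiteFunMulti (Function.update α j (α j + 1)) +
        (√(2 * (α j : ℝ)) / 2) • hermiteFunMulti (Function.update α j (α j - 1)) := by
    funext x
    have h1 : ∀ k, hermiteFunMulti (Function.update α j k) x =
        hermiteFun k (x j) * ∏ i ∈ Finset.univ.erase j, hermiteFun (α i) (x i) := fun k => by
      unfold hermiteFunMulti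
      rw [← Finset.mul_prod_erase _ _ (Finset.mem_univ j), Function.update_self]
      congr 1
      exact Finset.prod_congr rfl fun i hi => by
        rw [Function.update_of_ne (Finset.ne_of_mem_erase hi)]
    have h2 := h1 (α j)
    rw [Function.update_eq_self] at h2
    simp only [Pi.add_apply, Pi.smul_apply, smul_eq_mul, h1, h2]
    linear_combination (∏ i ∈ Finset.univ.erase j, hermiteFun (α i) (x i)) / 2 *
      hermiteFun_recurrence (α j) (x j)
  rw [e]
  exact add_mem (Submodule.smul_mem _ _ (Submodule.subset_span ⟨_, rfl⟩))
    (Submodule.smul_mem _ _ (Submodule.subset_span ⟨_, rfl⟩))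

theorem coord_mul_mem_hermiteSpan (j : Fin n) {ψ : EuclideanSpace ℝ (Fin n) → ℝ}
    (hψ : ψ ∈ hermiteSpan n) :
    (fun x : EuclideanSpace ℝ (Fin n) => x j * ψ x) ∈ hermiteSpan n := by
  let T : (EuclideanSpace ℝ (Fin n) → ℝ) →ₗ[ℝ] (EuclideanSpace ℝ (Fin n) → ℝ) :=
    LinearMap.mulLeft ℝ fun x => x j
  have : hermiteSpan n ≤ (hermiteSpan n).comap T :=
    Submodule.span_le.2 (by
      rintro _ ⟨α, rfl⟩
      exact coord_mul_hermiteFunMulti_mem j α)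
  exact this hψ

/-- Up to constants these are the terms of the power series of the Fourier kernel multiplied by the
Gaussian $h_0$. -/
theorem inner_pow_mul_mem_hermiteSpan (ξ : EuclideanSpace ℝ (Fin n)) (k : ℕ) :
    (fun x : EuclideanSpace ℝ (Fin n) => inner ℝ x ξ ^ k * hermiteFunMulti 0 x) ∈
      hermiteSpan n := by
  induction k with
  | zero =>
    simp only [pow_zero, one_mul]
    exact Submodule.subset_span (Set.mem_range_self 0)
  | succ k ih =>
    have e : (fun x : EuclideanSpace ℝ (Fin n) => inner ℝ x ξ ^ (k + 1) * hermiteFunMulti 0 x) =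
        ∑ j, ξ j • fun x : EuclideanSpace ℝ (Fin n) =>
          x j * (inner ℝ x ξ ^ k * hermiteFunMulti 0 x) := by
      funext x
      rw [pow_succ', mul_assoc]
      nth_rw 1 [PiLp.inner_apply]
      simp [Finset.sum_mul, mul_assoc]
    rw [e]
    exact sum_mem fun j _ => Submodule.smul_mem _ _ (coord_mul_mem_hermiteSpan j ih)

theorem integral_hermiteSpan_smul_eq_zero {u : EuclideanSpace ℝ (Fin n) → G} (hu : Integrable u)
    (h0 : ∀ α, hermCoeff u α = 0) {ψ : EuclideanSpace ℝ (Fin n) → ℝ} (hψ : ψ ∈ hermiteSpan n) :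
    Integrable (fun x => ψ x • u x) ∧ ∫ x, ψ x • u x = 0 := by
  induction hψ using Submodule.span_induction with
  | mem ψ hψ =>
    obtain ⟨α, rfl⟩ := hψ
    obtain ⟨C, hC⟩ := exists_abs_hermiteFunMulti_le α
    exact ⟨integrable_bounded_smul (continuous_hermiteFunMulti α) hC hu, h0 α⟩
  | zero => simp
  | add ψ₁ ψ₂ _ _ h1 h2 =>
    simp only [Pi.add_apply, add_smul]
    exact ⟨h1.1.add h2.1, by rw [integral_add h1.1 h2.1, h1.2, h2.2, add_zero]⟩
  | smul c ψ₁ _ h1 =>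
    simp only [Pi.smul_apply, smul_assoc]
    exact ⟨h1.1.smul c, by rw [integral_smul, h1.2, smul_zero]⟩

end Real

theorem hermiteFunMulti_zero (x : EuclideanSpace ℝ (Fin n)) :
    hermiteFunMulti 0 x = (√√Real.pi)⁻¹ ^ n * Real.exp (-‖x‖ ^ 2 / 2) := by
  simp only [hermiteFunMulti, Pi.zero_apply, hermiteFun_zero, Finset.prod_mul_distrib,
    Finset.prod_const, Finset.card_univ, Fintype.card_fin, ← Real.exp_sum]
  rw [EuclideanSpace.real_norm_sq_eq]
  simp [Finset.sum_div, neg_div]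

theorem hermiteFunMulti_zero_pos (x : EuclideanSpace ℝ (Fin n)) : 0 < hermiteFunMulti 0 x := by
  rw [hermiteFunMulti_zero]
  have := Real.pi_pos
  positivity

open Complex in
/-- A continuous integrable function orthogonal to all the Hermite functions vanishes. -/
theorem eq_zero_of_hermCoeff_eq_zero {E : Type*} [NormedAddCommGroup E] [NormedSpace ℂ E]
    [CompleteSpace E] {u : EuclideanSpace ℝ (Fin n) → E} (huc : Continuous u) (hu : Integrable u)
    (h0 : ∀ α, hermCoeff u α = 0) : u = 0 := by
  set v : EuclideanSpace ℝ (Fin n) → E := fun x => hermiteFunMulti 0 x • u x with hv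
  have hvc : Continuous v := (continuous_hermiteFunMulti 0).smul huc
  obtain ⟨C, hC⟩ := exists_abs_hermiteFunMulti_le (0 : Fin n → ℕ)
  have hvi : Integrable v := integrable_bounded_smul (continuous_hermiteFunMulti 0) hC hu
  -- Expand the exponential kernel: every term integrates to zero by orthogonality. Exchanging sum
  -- and integral is licensed by $e^{c|x|}h_0$ being bounded, since
  -- $c|x|\le\frac12c^2+\frac12|x|^2$. Fourier inversion then gives $v=0$, and $h_0>0$ gives $u=0$.
  have hF : FourierTransform.fourier v = (0 : EuclideanSpace ℝ (Fin n) → E) := by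
    funext ξ
    rw [Real.fourier_eq' v ξ]
    have e1 : ∀ (k : ℕ) (x : EuclideanSpace ℝ (Fin n)),
        (((k ! : ℂ)⁻¹ * (((-2 * Real.pi * inner ℝ x ξ : ℝ) : ℂ) * I) ^ k)) • v x =
          ((k ! : ℂ)⁻¹ * (((-2 * Real.pi : ℝ) : ℂ) * I) ^ k) •
            ((inner ℝ x ξ ^ k * hermiteFunMulti 0 x) • u x) := fun k x => by
      rw [hv]
      simp only [← Complex.coe_smul, smul_smul]
      congr 1
      push_cast
      ring
    have e2 : ∀ k : ℕ, ∫ x, (((k ! : ℂ)⁻¹ * (((-2 * Real.pi * inner ℝ x ξ : ℝ) : ℂ) * I) ^ k)) • v x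
        = 0 := fun k => by
      simp only [e1]
      have hz := (integral_hermiteSpan_smul_eq_zero hu h0 (inner_pow_mul_mem_hermiteSpan ξ k)).2
      rw [MeasureTheory.integral_smul]
      exact (congrArg _ hz).trans (smul_zero _)
    set c := 2 * Real.pi * ‖ξ‖ with hc
    have hc0 : 0 ≤ c := by have := Real.pi_pos; positivity
    have hsum : ∀ x : EuclideanSpace ℝ (Fin n),
        HasSum (fun k : ℕ => (k ! : ℝ)⁻¹ * (c * ‖x‖) ^ k * ‖v x‖) (Real.exp (c * ‖x‖) * ‖v x‖) :=
      fun x => by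
        have := (NormedSpace.expSeries_div_hasSum_exp (c * ‖x‖)).mul_right ‖v x‖
        rw [← Real.exp_eq_exp_ℝ] at this
        simpa only [div_eq_inv_mul] using this
    have hs := hasSum_integral_of_dominated_convergence (μ := volume)
      (F := fun (k : ℕ) x =>
        (((k ! : ℂ)⁻¹ * (((-2 * Real.pi * inner ℝ x ξ : ℝ) : ℂ) * I) ^ k)) • v x)
      (f := fun x => Complex.exp (((-2 * Real.pi * inner ℝ x ξ : ℝ) : ℂ) * I) • v x)
      (fun k x => (k ! : ℝ)⁻¹ * (c * ‖x‖) ^ k * ‖v x‖)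
      (fun k => by
        refine Continuous.aestronglyMeasurable ?_
        fun_prop)
      (fun k => Eventually.of_forall fun x => by
        rw [norm_smul, norm_mul, norm_pow, norm_mul, norm_I, mul_one, norm_inv, Complex.norm_natCast,
          Complex.norm_real, norm_mul, norm_mul, norm_neg, Real.norm_two,
          Real.norm_of_nonneg Real.pi_pos.le]
        have h1 : ‖(inner ℝ x ξ : ℝ)‖ ≤ ‖x‖ * ‖ξ‖ := norm_inner_le_norm x ξ
        have h2 : 2 * Real.pi * ‖(inner ℝ x ξ : ℝ)‖ ≤ c * ‖x‖ := by
          have := mul_le_mul_of_nonneg_left h1 (by positivity : 0 ≤ 2 * Real.pi)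
          rw [hc]; linarith
        gcongr)
      (Eventually.of_forall fun x => (hsum x).summable)
      (by
        simp only [fun x => (hsum x).tsum_eq]
        have hb : ∀ x : EuclideanSpace ℝ (Fin n),
            |Real.exp (c * ‖x‖) * hermiteFunMulti 0 x| ≤
              (√√Real.pi)⁻¹ ^ n * Real.exp (c ^ 2 / 2) := fun x => by
          rw [abs_of_nonneg (mul_nonneg (Real.exp_pos _).le (hermiteFunMulti_zero_pos x).le),
            hermiteFunMulti_zero, mul_left_comm, ← Real.exp_add]
          refine mul_le_mul_of_nonneg_left (Real.exp_le_exp.2 ?_) (by positivity)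
          nlinarith [sq_nonneg (c - ‖x‖)]
        have hcont : Continuous fun x : EuclideanSpace ℝ (Fin n) =>
            Real.exp (c * ‖x‖) * hermiteFunMulti 0 x := by
          have := continuous_hermiteFunMulti (0 : Fin n → ℕ)
          fun_prop
        refine (integrable_bounded_smul hcont hb hu.norm).congr (Eventually.of_forall fun x => ?_)
        simp only [hv, norm_smul, Real.norm_of_nonneg (hermiteFunMulti_zero_pos x).le, smul_eq_mul]
        ring)
      (Eventually.of_forall fun x => by
        have := (NormedSpace.expSeries_div_hasSum_exp
          (((-2 * Real.pi * inner ℝ x ξ : ℝ) : ℂ) * I)).smul_const (v x)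
        rw [← Complex.exp_eq_exp_ℂ] at this
        simpa only [div_eq_inv_mul] using this)
    simp only [e2] at hs
    exact hs.unique hasSum_zero
  have inv := hvc.fourierInv_fourier_eq hvi (by rw [hF]; exact integrable_zero _ _ _)
  rw [hF] at inv
  funext x
  have hx := congrFun inv x
  rw [Real.fourierInv_eq'] at hx
  simp only [Pi.zero_apply, smul_zero, integral_zero] at hx
  exact (smul_eq_zero.1 hx.symm).resolve_left (hermiteFunMulti_zero_pos x).ne'

/-- The Hermite expansion of a test function converges to it. -/
theorem hermSeries_hermCoeff_zero {E : Type*} [NormedAddCommGroup E] [NormedSpace ℂ E]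
    [CompleteSpace E] (hn : 1 ≤ n) {u : EuclideanSpace ℝ (Fin n) → E} (hu : ContDiff ℝ ∞ u)
    (hu' : HasCompactSupport u) (x : EuclideanSpace ℝ (Fin n)) :
    hermSeries (hermCoeff u) (x, 0) = u x := by
  have ha := dampedSummable_zero_hermCoeff hu hu'
  have i1 := hu.continuous.integrable_of_hasCompactSupport hu' (μ := volume)
  have i2 := integrable_hermSeries_zero hn ha
  have := eq_zero_of_hermCoeff_eq_zero (u := fun x => hermSeries (hermCoeff u) (x, 0) - u x)
    ((continuous_hermSeries_zero hn ha).sub hu.continuous) (i2.sub i1) fun α => by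
      obtain ⟨C, hC⟩ := exists_abs_hermiteFunMulti_le α
      have ch := continuous_hermiteFunMulti α
      have e : ∫ y, hermiteFunMulti α y • hermSeries (hermCoeff u) (y, 0) =
          ∫ y, hermiteFunMulti α y • u y := hermCoeff_hermSeries_zero hn ha α
      change ∫ y, hermiteFunMulti α y • (hermSeries (hermCoeff u) (y, 0) - u y) = 0
      simp only [smul_sub]
      rw [integral_sub (integrable_bounded_smul ch hC i2) (integrable_bounded_smul ch hC i1), e,
        sub_self]
  exact sub_eq_zero.1 (congrFun this x)

end HermiteCompleteness

/-! ### Fatou's lemma and discrete integration by parts in time -/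

section FatouArgument

open MeasureTheory Filter Topology

/-- Fatou's lemma for real functions bounded below by an integrable function. -/
theorem integrable_and_integral_le_of_ae_tendsto {Z : Type*} [MeasurableSpace Z] {μ : Measure Z}
    {u : ℕ → Z → ℝ} {v m : Z → ℝ} {B : ℝ} (hm : Integrable m μ) (hu : ∀ k, Integrable (u k) μ)
    (hlb : ∀ k, ∀ᵐ z ∂μ, -m z ≤ u k z)
    (lim : ∀ᵐ z ∂μ, Tendsto (fun k => u k z) atTop (𝓝 (v z)))
    (hB : ∀ ε > 0, ∀ᶠ k in atTop, ∫ z, u k z ∂μ ≤ B + ε) :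
    Integrable v μ ∧ ∫ z, v z ∂μ ≤ B := by
  have hv : AEStronglyMeasurable v μ :=
    aestronglyMeasurable_of_tendsto_ae atTop (fun k => (hu k).1) lim
  have pos : ∀ᵐ z ∂μ, 0 ≤ v z + m z := by
    filter_upwards [lim, ae_all_iff.2 hlb] with z hz hz'
    have := ge_of_tendsto' hz hz'
    linarith
  have fatou : ∫⁻ z, ENNReal.ofReal (v z + m z) ∂μ ≤
      liminf (fun k => ∫⁻ z, ENNReal.ofReal (u k z + m z) ∂μ) atTop := by
    refine le_trans (le_of_eq (lintegral_congr_ae ?_)) (lintegral_liminf_le' fun k =>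
      ((hu k).add hm).1.aemeasurable.ennreal_ofReal)
    filter_upwards [lim] with z hz
    exact (ENNReal.tendsto_ofReal (hz.add_const (m z))).liminf_eq.symm
  have bound : ∀ ε > 0, ∫⁻ z, ENNReal.ofReal (v z + m z) ∂μ ≤
      ENNReal.ofReal (B + ε + ∫ z, m z ∂μ) := fun ε hε => by
    refine fatou.trans (liminf_le_of_frequently_le' (Eventually.frequently ?_))
    filter_upwards [hB ε hε] with k hk
    have hum : Integrable (fun z => u k z + m z) μ := (hu k).add hm
    rw [← ofReal_integral_eq_lintegral_ofReal hum (by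
      filter_upwards [hlb k] with z hz
      simp only [Pi.zero_apply]
      linarith)]
    refine ENNReal.ofReal_le_ofReal ?_
    rw [integral_add (hu k) hm]
    linarith
  have hvm : Integrable (fun z => v z + m z) μ := by
    refine ⟨hv.add hm.1, ?_⟩
    rw [hasFiniteIntegral_iff_ofReal pos]
    exact (bound 1 one_pos).trans_lt ENNReal.ofReal_lt_top
  have hvi : Integrable v μ :=
    (hvm.sub hm).congr (Eventually.of_forall fun z => by simp)
  refine ⟨hvi, le_of_forall_pos_le_add fun ε hε => ?_⟩
  have h1 := bound ε hε
  rw [← ofReal_integral_eq_lintegral_ofReal hvm pos, integral_add hvi hm] at h1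
  -- `ENNReal.ofReal` truncates at zero, so real integrals can be compared only once the right side
  -- is known to be nonnegative.
  have hB0 : 0 ≤ B + ε + ∫ z, m z ∂μ := by
    obtain ⟨k, hk⟩ := (hB ε hε).exists
    have : -∫ z, m z ∂μ ≤ ∫ z, u k z ∂μ := by
      rw [← integral_neg]
      exact integral_mono_ae hm.neg (hu k) (hlb k)
    linarith
  have := (ENNReal.ofReal_le_ofReal_iff hB0).1 h1
  linarith

variable {n : ℕ}

instance isAddRightInvariant_volume_prod :
    (volume : Measure (EuclideanSpace ℝ (Fin n) × ℝ)).IsAddRightInvariant :=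
  inferInstanceAs
    ((volume : Measure (EuclideanSpace ℝ (Fin n))).prod (volume : Measure ℝ)).IsAddRightInvariant

instance isAddHaarMeasure_volume_prod :
    (volume : Measure (EuclideanSpace ℝ (Fin n) × ℝ)).IsAddHaarMeasure :=
  inferInstanceAs
    ((volume : Measure (EuclideanSpace ℝ (Fin n))).prod (volume : Measure ℝ)).IsAddHaarMeasure

/-- The discrete Laplacian is symmetric. -/
theorem integral_mul_secondDiff {w C : EuclideanSpace ℝ (Fin n) × ℝ → ℝ}
    (H : ∀ v, Integrable fun z => w (z + v) * C z) (h : ℝ) :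
    Integrable (fun z => w z * secondDiff C h z) ∧ Integrable (fun z => secondDiff w h z * C z) ∧
      ∫ z, w z * secondDiff C h z = ∫ z, secondDiff w h z * C z := by
  have H' : ∀ v, Integrable (fun z => w z * C (z + v)) ∧
      ∫ z, w z * C (z + v) = ∫ z, w (z - v) * C z := fun v => by
    have e : (fun z => w z * C (z + v)) = fun z => (fun z => w (z - v) * C z) (z + v) := by
      funext z; simp
    rw [e]
    refine ⟨?_, integral_add_right_eq_self (fun z => w (z - v) * C z) v⟩
    have := H (-v)
    simp only [← sub_eq_add_neg] at this
    exact this.comp_add_right v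
  have h0 := H 0
  simp only [add_zero] at h0
  have dir : ∀ d, Integrable (fun z => w z * secondDiffDir C h d z) ∧
      Integrable (fun z => secondDiffDir w h d z * C z) ∧
      ∫ z, w z * secondDiffDir C h d z = ∫ z, secondDiffDir w h d z * C z := fun d => by
    have a1 := H' (h • d)
    have a2 := H' (-(h • d))
    have b1 := H (h • d)
    have b2 := H (-(h • d))
    simp only [← sub_eq_add_neg, sub_neg_eq_add] at a2 b2
    have e1 : (fun z => w z * secondDiffDir C h d z) = fun z => (h⁻¹) ^ 2 *
        (w z * C (z + h • d) + w z * C (z - h • d) - 2 * (w z * C z)) := by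
      funext z; simp only [secondDiffDir, smul_eq_mul]; ring
    have e2 : (fun z => secondDiffDir w h d z * C z) = fun z => (h⁻¹) ^ 2 *
        (w (z - h • d) * C z + w (z + h • d) * C z - 2 * (w z * C z)) := by
      funext z; simp only [secondDiffDir, smul_eq_mul]; ring
    have s1 : Integrable fun z => w z * C (z + h • d) + w z * C (z - h • d) := a1.1.add a2.1
    have s2 : Integrable fun z => w (z - h • d) * C z + w (z + h • d) * C z := b2.add b1
    rw [e1, e2]
    refine ⟨(s1.sub (h0.const_mul 2)).const_mul _, (s2.sub (h0.const_mul 2)).const_mul _, ?_⟩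
    rw [integral_const_mul, integral_const_mul, integral_sub s1 (h0.const_mul 2),
      integral_sub s2 (h0.const_mul 2), integral_add a1.1 a2.1, integral_add b2 b1, a1.2,
      a2.2]
  simp only [secondDiff, Finset.mul_sum, Finset.sum_mul]
  refine ⟨integrable_finsetSum _ fun i _ => (dir _).1, integrable_finsetSum _ fun i _ => (dir _).2.1,
    ?_⟩
  rw [integral_finsetSum _ fun i _ => (dir _).1, integral_finsetSum _ fun i _ => (dir _).2.1]
  exact Finset.sum_congr rfl fun i _ => (dir _).2.2

/-- The truncated time weight `t 1_{t > h}`. -/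
noncomputable def timeWeight (h : ℝ) (z : EuclideanSpace ℝ (Fin n) × ℝ) : ℝ :=
  if h < z.2 then z.2 else 0

theorem measurable_timeWeight (h : ℝ) : Measurable (timeWeight (n := n) h) :=
  Measurable.ite (measurableSet_lt measurable_const measurable_snd) measurable_snd measurable_const

theorem abs_timeWeight_le (h : ℝ) (z : EuclideanSpace ℝ (Fin n) × ℝ) :
    |timeWeight h z| ≤ |z.2| := by
  unfold timeWeight
  split_ifs
  · exact le_rfl
  · simp

theorem secondDiff_timeWeight {h : ℝ} (z : EuclideanSpace ℝ (Fin n) × ℝ) :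
    secondDiff (timeWeight h) h z = (h⁻¹) ^ 2 * ((if h < z.2 + h then z.2 + h else 0) +
      (if h < z.2 - h then z.2 - h else 0) - 2 * (if h < z.2 then z.2 else 0)) := by
  rw [secondDiff, Fintype.sum_option, Finset.sum_eq_zero, add_zero]
  · simp [secondDiffDir, coordDir, timeWeight]
  · intro i _
    simp only [secondDiffDir, coordDir, timeWeight, Prod.snd_add, Prod.snd_sub, Prod.smul_snd,
      smul_zero, add_zero, sub_zero]
    split_ifs <;> simp [two_mul]

/-- On $0<t\le h$ only the forward value survives and the difference is $h^{-2}(t+h)\le2/h$; for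
$t>h$ it is nonpositive and is discarded. -/
theorem secondDiff_timeWeight_mul_le {h : ℝ} (hh : 0 < h) (z : EuclideanSpace ℝ (Fin n) × ℝ)
    {c : ℝ} (hc : 0 ≤ c) (hz : z.2 ≤ 0 → c = 0) :
    secondDiff (timeWeight h) h z * c ≤
      Set.indicator {z : EuclideanSpace ℝ (Fin n) × ℝ | z.2 ∈ Set.Ioc 0 h}
        (fun _ => 2 * h⁻¹ * c) z := by
  rcases le_or_gt z.2 0 with h0 | h0
  · rw [hz h0, mul_zero, mul_zero, Set.indicator_zero]
  rw [secondDiff_timeWeight]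
  rcases le_or_gt z.2 h with h1 | h1
  · rw [Set.indicator_of_mem (show z ∈ {z : EuclideanSpace ℝ (Fin n) × ℝ | z.2 ∈ Set.Ioc 0 h}
      from ⟨h0, h1⟩), if_pos (by linarith), if_neg (by linarith), if_neg (by linarith)]
    refine mul_le_mul_of_nonneg_right ?_ hc
    calc _ ≤ (h⁻¹) ^ 2 * (2 * h) := by gcongr; linarith
      _ = _ := by field_simp
  · rw [Set.indicator_of_notMem (fun h => absurd h.2 (not_le.2 h1)), if_pos (by linarith),
      if_pos h1]
    refine mul_nonpos_of_nonpos_of_nonneg (mul_nonpos_of_nonneg_of_nonpos (by positivity) ?_) hc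
    split_ifs <;> linarith

/-- The discrete form of integrating $t\,\partial_t^2C$ by parts. The spatial differences of the
weight vanish, and truncation at $h$ keeps the stencil of $C$ inside $t>0$. -/
theorem integral_timeWeight_mul_secondDiff_le {C : EuclideanSpace ℝ (Fin n) × ℝ → ℝ}
    (hC : Integrable C) (hC' : Integrable fun z => z.2 * C z) (hC0 : ∀ z, 0 ≤ C z)
    (hCt : ∀ z, z.2 ≤ 0 → C z = 0) {h : ℝ} (hh : 0 < h) :
    Integrable (fun z => timeWeight h z * secondDiff C h z) ∧
      ∫ z, timeWeight h z * secondDiff C h z ≤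
        2 * h⁻¹ * ∫ z in {z : EuclideanSpace ℝ (Fin n) × ℝ | z.2 ∈ Set.Ioc 0 h}, C z := by
  have H : ∀ v, Integrable fun z => timeWeight h (z + v) * C z := fun v => by
    refine (hC'.abs.add (hC.abs.const_mul |v.2|)).mono'
      (((measurable_timeWeight h).comp (measurable_add_const v)).aestronglyMeasurable.mul hC.1)
      (Eventually.of_forall fun z => ?_)
    rw [norm_mul, Real.norm_eq_abs, Real.norm_eq_abs, Pi.add_apply, abs_mul, ← add_mul]
    refine mul_le_mul_of_nonneg_right ?_ (abs_nonneg _)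
    exact (abs_timeWeight_le h _).trans (abs_add_le _ _)
  obtain ⟨i1, i2, e⟩ := integral_mul_secondDiff H h
  refine ⟨i1, ?_⟩
  have hS : MeasurableSet {z : EuclideanSpace ℝ (Fin n) × ℝ | z.2 ∈ Set.Ioc 0 h} :=
    measurable_snd measurableSet_Ioc
  rw [e, ← integral_const_mul, ← integral_indicator hS]
  refine integral_mono i2 ((hC.const_mul _).indicator hS) fun z => ?_
  have := secondDiff_timeWeight_mul_le hh z (hC0 z) (hCt z)
  simpa only [Set.indicator_apply] using this

theorem integrable_time_mul_exp_mul_decayWeight :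
    Integrable fun z : EuclideanSpace ℝ (Fin n) × ℝ => Set.indicator {z | 0 < z.2}
      (fun z => z.2 * (Real.exp (-z.2) * decayWeight z.1)) z := by
  have h1 : IntegrableOn (fun t : ℝ => t * Real.exp (-t)) (Set.Ioi 0) := by
    have := Real.GammaIntegral_convergent (s := 2) two_pos
    refine this.congr_fun (fun t _ => ?_) measurableSet_Ioi
    norm_num
    ring
  have := integrable_decayWeight (n := n).mul_prod ((integrable_indicator_iff measurableSet_Ioi).2 h1)
  refine this.congr (Eventually.of_forall fun z => ?_)
  simp only [Set.indicator_apply, Set.mem_Ioi, Set.mem_ofPred_eq]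
  split_ifs <;> ring

theorem integrable_exp_mul_decayWeight :
    Integrable fun z : EuclideanSpace ℝ (Fin n) × ℝ => Set.indicator {z | 0 < z.2}
      (fun z => Real.exp (-z.2) * decayWeight z.1) z := by
  have := integrable_decayWeight (n := n).mul_prod
    ((integrable_indicator_iff measurableSet_Ioi).2 (integrableOn_exp_neg_Ioi 0))
  refine this.congr (Eventually.of_forall fun z => ?_)
  simp only [Set.indicator_apply, Set.mem_Ioi, Set.mem_ofPred_eq]
  split_ifs <;> ring

end FatouArgument

/-! ### The convex part along the Hermite-Poisson flow -/

section BellmanFlow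

open MeasureTheory Filter Topology

variable {n : ℕ} {E F : Type*} [NormedAddCommGroup E] [NormedSpace ℝ E] [CompleteSpace E]
  [NormedAddCommGroup F] [NormedSpace ℝ F] [CompleteSpace F] {p q : ℝ}
  {a : (Fin n → ℕ) → E} {a' : (Fin n → ℕ) → F}

/-- The function `Φ` along the flow of two Hermite series. -/
noncomputable def bellmanFlow (p q : ℝ) (a : (Fin n → ℕ) → E) (a' : (Fin n → ℕ) → F)
    (z : EuclideanSpace ℝ (Fin n) × ℝ) : ℝ :=
  bellmanPhi p q (hermSeries a z) (hermSeries a' z)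

theorem bellmanFlow_nonneg (hp : 2 ≤ p) (hpq : p.HolderConjugate q) (hq2 : q ≤ 2)
    (a : (Fin n → ℕ) → E) (a' : (Fin n → ℕ) → F) (z : EuclideanSpace ℝ (Fin n) × ℝ) :
    0 ≤ bellmanFlow p q a a' z :=
  bellmanPhi_nonneg hp hpq hq2 _ _

theorem exp_mul_decayWeight_le_one {z : EuclideanSpace ℝ (Fin n) × ℝ} (hz : 0 ≤ z.2) :
    Real.exp (-z.2) * decayWeight z.1 ≤ 1 :=
  mul_le_one₀ (Real.exp_le_one_iff.2 (neg_nonpos.2 hz)) (decayWeight_pos _).le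
    (decayWeight_le_one _)

theorem exp_mul_decayWeight_pos (z : EuclideanSpace ℝ (Fin n) × ℝ) :
    0 < Real.exp (-z.2) * decayWeight z.1 :=
  mul_pos (Real.exp_pos _) (decayWeight_pos _)

/-- Both series are bounded by a multiple of $y=e^{-t}\,$`decayWeight`$\le1$, and powers at least 1
of $y$ are at most $y$. -/
theorem exists_bellmanFlow_le (hn : 1 ≤ n) (hpq : p.HolderConjugate q) (hq2 : q ≤ 2)
    (ha : DampedSummable 0 a) (ha' : DampedSummable 0 a') :
    ∃ C, 0 ≤ C ∧ ∀ z : EuclideanSpace ℝ (Fin n) × ℝ, 0 ≤ z.2 →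
      bellmanFlow p q a a' z ≤ C * (Real.exp (-z.2) * decayWeight z.1) := by
  obtain ⟨C, hC0, hC⟩ := exists_norm_hermSeries_le hn ha
  obtain ⟨D, hD0, hD⟩ := exists_norm_hermSeries_le hn ha'
  refine ⟨5 / 4 * (C ^ p + D ^ q), by positivity, fun z hz => ?_⟩
  have y1 := exp_mul_decayWeight_le_one hz
  have y0 := (exp_mul_decayWeight_pos z).le
  set y := Real.exp (-z.2) * decayWeight z.1
  have pw : ∀ {r K s : ℝ}, 1 ≤ r → 0 ≤ K → 0 ≤ s → s ≤ K * y → s ^ r ≤ K ^ r * y := by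
    intro r K s hr hK hs h
    calc s ^ r ≤ (K * y) ^ r := Real.rpow_le_rpow hs h (by linarith)
      _ = K ^ r * y ^ r := Real.mul_rpow hK y0
      _ ≤ K ^ r * y := by
        refine mul_le_mul_of_nonneg_left ?_ (Real.rpow_nonneg hK _)
        simpa using Real.rpow_le_rpow_of_exponent_ge' y0 y1 zero_le_one hr
  have h1 := pw hpq.lt.le hC0 (norm_nonneg _) (hC z hz)
  have h2 := pw hpq.symm.lt.le hD0 (norm_nonneg _) (hD z hz)
  calc _ ≤ 5 / 4 * (‖hermSeries a z‖ ^ p + ‖hermSeries a' z‖ ^ q) := bellmanPhi_le hpq hq2 _ _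
    _ ≤ 5 / 4 * (C ^ p * y + D ^ q * y) := by gcongr
    _ = _ := by ring

/-- Apply the subgradient inequality based at $z$ at both points $z\pm hd$ and add: the affine terms
assemble into second differences of the series. -/
theorem le_secondDiff_bellmanFlow {z : EuclideanSpace ℝ (Fin n) × ℝ} {σ : E →L[ℝ] ℝ}
    {τ : F →L[ℝ] ℝ} (H : ∀ ζ' η', bellmanPhi p q (hermSeries a z) (hermSeries a' z) +
      (σ (ζ' - hermSeries a z) + τ (η' - hermSeries a' z)) ≤ bellmanPhi p q ζ' η') (h : ℝ) :
    σ (secondDiff (hermSeries a) h z) + τ (secondDiff (hermSeries a') h z) ≤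
      secondDiff (bellmanFlow p q a a') h z := by
  simp only [secondDiff, map_sum, ← Finset.sum_add_distrib]
  refine Finset.sum_le_sum fun i _ => ?_
  set d := coordDir (n := n) i
  have h1 := H (hermSeries a (z + h • d)) (hermSeries a' (z + h • d))
  have h2 := H (hermSeries a (z - h • d)) (hermSeries a' (z - h • d))
  simp only [map_sub] at h1 h2
  simp only [secondDiffDir, map_smul, map_sub, map_add, smul_eq_mul, bellmanFlow]
  rw [← mul_add]
  refine mul_le_mul_of_nonneg_left ?_ (by positivity)
  linarith

/-- Supplies the minorant for Fatou's lemma: the series stay in a bounded set, so one bound serves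
all subgradients. -/
theorem exists_secondDiff_bellmanFlow_ge (hn : 1 ≤ n) (hp : 2 ≤ p) (hpq : p.HolderConjugate q)
    (hq2 : q ≤ 2) (ha : DampedSummable 0 a) (ha' : DampedSummable 0 a') :
    ∃ C, 0 ≤ C ∧ ∀ (z : EuclideanSpace ℝ (Fin n) × ℝ) (h : ℝ), 0 < h → h ≤ 1 → h ≤ z.2 →
      -(C * (Real.exp (-z.2) * decayWeight z.1)) ≤ secondDiff (bellmanFlow p q a a') h z := by
  obtain ⟨C, hC0, hC⟩ := exists_norm_hermSeries_le hn ha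
  obtain ⟨D, hD0, hD⟩ := exists_norm_hermSeries_le hn ha'
  obtain ⟨C', hC0', hC'⟩ := exists_norm_secondDiff_hermSeries_le hn ha
  obtain ⟨D', hD0', hD'⟩ := exists_norm_secondDiff_hermSeries_le hn ha'
  obtain ⟨K, hK0, hK⟩ := bellmanPhi_subgradient (E := E) (F := F) hp hpq hq2 (max C D)
  refine ⟨K * C' + K * D', by positivity, fun z h hh h1 hz => ?_⟩
  have hz0 : 0 ≤ z.2 := hh.le.trans hz
  have y1 := exp_mul_decayWeight_le_one hz0
  obtain ⟨σ, τ, hσ, hτ, H⟩ := hK (hermSeries a z) (hermSeries a' z)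
    (((hC z hz0).trans (mul_le_of_le_one_right hC0 y1)).trans (le_max_left _ _))
    (((hD z hz0).trans (mul_le_of_le_one_right hD0 y1)).trans (le_max_right _ _))
  refine le_trans ?_ (le_secondDiff_bellmanFlow H h)
  set y := Real.exp (-z.2) * decayWeight z.1
  have e1 : |σ (secondDiff (hermSeries a) h z)| ≤ K * (C' * y) :=
    (σ.le_opNorm _).trans (mul_le_mul hσ (hC' z h hh h1 hz) (norm_nonneg _) hK0)
  have e2 : |τ (secondDiff (hermSeries a') h z)| ≤ K * (D' * y) :=
    (τ.le_opNorm _).trans (mul_le_mul hτ (hD' z h hh h1 hz) (norm_nonneg _) hK0)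
  have := neg_le_of_abs_le e1
  have := neg_le_of_abs_le e2
  linarith

/-- The limit of the discrete Laplacians of `Φ` along the flow dominates `|x|² Φ`. -/
theorem norm_sq_mul_bellmanFlow_le (hn : 1 ≤ n) (hp : 2 ≤ p) (hpq : p.HolderConjugate q)
    (hq2 : q ≤ 2) (ha : DampedSummable 0 a) (ha' : DampedSummable 0 a')
    {z : EuclideanSpace ℝ (Fin n) × ℝ} (hz : 0 < z.2) {l : ℝ}
    (hl : Tendsto (fun h => secondDiff (bellmanFlow p q a a') h z) (𝓝[>] 0) (𝓝 l)) :
    ‖z.1‖ ^ 2 * bellmanFlow p q a a' z ≤ l := by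
  obtain ⟨K, hK0, hK⟩ := bellmanPhi_subgradient (E := E) (F := F) hp hpq hq2
    (max ‖hermSeries a z‖ ‖hermSeries a' z‖)
  obtain ⟨σ, τ, -, -, H⟩ := hK (hermSeries a z) (hermSeries a' z) (le_max_left _ _)
    (le_max_right _ _)
  have t1 := (σ.continuous.tendsto _).comp (tendsto_secondDiff_hermSeries hn hz ha)
  have t2 := (τ.continuous.tendsto _).comp (tendsto_secondDiff_hermSeries hn hz ha')
  have h1 := le_of_tendsto_of_tendsto' (t1.add t2) hl fun h => le_secondDiff_bellmanFlow H h
  -- Testing at the origin, where $\Phi=0$, gives $\Phi(\zeta,\eta)\le\sigma\zeta+\tau\eta$.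
  have h2 := H 0 0
  rw [bellmanPhi_zero hpq] at h2
  simp only [zero_sub, map_neg] at h2
  simp only [map_smul, smul_eq_mul] at h1
  refine le_trans ?_ h1
  rw [← mul_add]
  refine mul_le_mul_of_nonneg_left ?_ (by positivity)
  unfold bellmanFlow
  linarith

theorem continuousOn_hermSeries (hn : 1 ≤ n) (ha : DampedSummable 0 a) :
    ContinuousOn (hermSeries a) {z : EuclideanSpace ℝ (Fin n) × ℝ | 0 < z.2} := fun _ hz =>
  (hermSeries_twice_differentiable hn ha hz).1.continuousAt.continuousWithinAt

theorem continuousOn_bellmanFlow (hn : 1 ≤ n) (hp : 2 ≤ p) (hpq : p.HolderConjugate q)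
    (hq2 : q ≤ 2) (ha : DampedSummable 0 a) (ha' : DampedSummable 0 a') :
    ContinuousOn (bellmanFlow p q a a') {z : EuclideanSpace ℝ (Fin n) × ℝ | 0 < z.2} :=
  (continuous_bellmanPhi hp hpq hq2).comp_continuousOn
    ((continuousOn_hermSeries hn ha).prodMk (continuousOn_hermSeries hn ha'))

theorem measurableSet_timePos :
    MeasurableSet {z : EuclideanSpace ℝ (Fin n) × ℝ | 0 < z.2} :=
  measurableSet_lt measurable_const measurable_snd

/-- Integrability of a weight times `Φ` over positive times. -/
theorem integrable_indicator_mul_bellmanFlow (hn : 1 ≤ n) (hp : 2 ≤ p)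
    (hpq : p.HolderConjugate q) (hq2 : q ≤ 2) (ha : DampedSummable 0 a)
    (ha' : DampedSummable 0 a') {w : EuclideanSpace ℝ (Fin n) × ℝ → ℝ} (hw : Continuous w)
    (hwi : Integrable (Set.indicator {z : EuclideanSpace ℝ (Fin n) × ℝ | 0 < z.2}
      fun z => |w z| * (Real.exp (-z.2) * decayWeight z.1))) :
    Integrable (Set.indicator {z : EuclideanSpace ℝ (Fin n) × ℝ | 0 < z.2}
      fun z => w z * bellmanFlow p q a a' z) := by
  obtain ⟨C, hC0, hC⟩ := exists_bellmanFlow_le hn hpq hq2 ha ha'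
  refine (hwi.const_mul C).mono' ?_ (Eventually.of_forall fun z => ?_)
  · rw [aestronglyMeasurable_indicator_iff measurableSet_timePos]
    exact (hw.continuousOn.mul (continuousOn_bellmanFlow hn hp hpq hq2 ha ha')).aestronglyMeasurable
      measurableSet_timePos
  · by_cases hz : 0 < z.2
    · rw [Set.indicator_of_mem (by exact hz), Set.indicator_of_mem (by exact hz), norm_mul,
        Real.norm_eq_abs, Real.norm_of_nonneg (bellmanFlow_nonneg hp hpq hq2 a a' _)]
      calc _ ≤ |w z| * (C * (Real.exp (-z.2) * decayWeight z.1)) := by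
            gcongr; exact hC z hz.le
        _ = _ := by ring
    · rw [Set.indicator_of_notMem (by exact hz), Set.indicator_of_notMem (by exact hz)]
      simp

theorem tendsto_integral_bellmanFlow (hn : 1 ≤ n) (hp : 2 ≤ p) (hpq : p.HolderConjugate q)
    (hq2 : q ≤ 2) (ha : DampedSummable 0 a) (ha' : DampedSummable 0 a') :
    Tendsto (fun t => ∫ x, bellmanFlow p q a a' (x, t)) (𝓝[>] 0)
      (𝓝 (∫ x, bellmanFlow p q a a' (x, 0))) := by
  obtain ⟨C, hC0, hC⟩ := exists_bellmanFlow_le hn hpq hq2 ha ha'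
  refine tendsto_integral_filter_of_dominated_convergence (fun x => C * decayWeight x) ?_ ?_
    (integrable_decayWeight.const_mul C) (Eventually.of_forall fun x => ?_)
  · filter_upwards [self_mem_nhdsWithin] with t ht
    refine Continuous.aestronglyMeasurable ?_
    exact (continuousOn_bellmanFlow hn hp hpq hq2 ha ha').comp_continuous (by fun_prop)
      fun x => ht
  · filter_upwards [self_mem_nhdsWithin] with t ht
    refine Eventually.of_forall fun x => ?_
    rw [Real.norm_of_nonneg (bellmanFlow_nonneg hp hpq hq2 a a' _)]
    refine (hC (x, t) (le_of_lt ht)).trans (mul_le_mul_of_nonneg_left ?_ hC0)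
    refine mul_le_of_le_one_left (decayWeight_pos x).le (Real.exp_le_one_iff.2 ?_)
    exact neg_nonpos.2 (le_of_lt ht)
  · exact ((continuous_bellmanPhi hp hpq hq2).tendsto _).comp
      ((tendsto_hermSeries_zero hn ha x).prodMk_nhds (tendsto_hermSeries_zero hn ha' x))

theorem setIntegral_timeSlab {f : EuclideanSpace ℝ (Fin n) × ℝ → ℝ} {s : Set ℝ}
    (hf : IntegrableOn f (Set.univ ×ˢ s)) :
    ∫ z in Set.univ ×ˢ s, f z = ∫ t in s, ∫ x, f (x, t) := by
  have e : (volume : Measure (EuclideanSpace ℝ (Fin n) × ℝ)).restrict (Set.univ ×ˢ s) =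
      (volume : Measure (EuclideanSpace ℝ (Fin n))).prod (volume.restrict s) := by
    rw [Measure.volume_eq_prod, ← Measure.prod_restrict, Measure.restrict_univ]
  rw [IntegrableOn, e] at hf
  rw [e, integral_prod_symm _ hf]

/-- By Fubini the slab integral is an integral over $(0,h]$ of slice integrals, which converge to
the one at $t=0$. -/
theorem eventually_setIntegral_bellmanFlow_le (hn : 1 ≤ n) (hp : 2 ≤ p)
    (hpq : p.HolderConjugate q) (hq2 : q ≤ 2) (ha : DampedSummable 0 a)
    (ha' : DampedSummable 0 a') {ε : ℝ} (hε : 0 < ε) :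
    ∀ᶠ h in 𝓝[>] (0 : ℝ),
      ∫ z in {z : EuclideanSpace ℝ (Fin n) × ℝ | z.2 ∈ Set.Ioc 0 h},
        Set.indicator {z | 0 < z.2} (bellmanFlow p q a a') z ≤
      h * ((∫ x, bellmanFlow p q a a' (x, 0)) + ε) := by
  have hJ := (tendsto_integral_bellmanFlow hn hp hpq hq2 ha ha').eventually
    (eventually_lt_nhds (lt_add_of_pos_right _ hε))
  obtain ⟨δ, hδ, hJ⟩ := mem_nhdsGT_iff_exists_Ioo_subset.1 hJ
  have hi := integrable_indicator_mul_bellmanFlow hn hp hpq hq2 ha ha'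
    (w := fun _ => 1) continuous_const (by simpa using integrable_exp_mul_decayWeight)
  simp only [one_mul] at hi
  filter_upwards [Ioo_mem_nhdsGT hδ] with h hh
  have es : {z : EuclideanSpace ℝ (Fin n) × ℝ | z.2 ∈ Set.Ioc 0 h} =
      Set.univ ×ˢ Set.Ioc 0 h := Set.univ_prod.symm
  rw [es, setIntegral_timeSlab hi.integrableOn]
  refine (Real.le_norm_self _).trans ((norm_setIntegral_le_of_norm_le_const
    (C := (∫ x, bellmanFlow p q a a' (x, 0)) + ε) measure_Ioc_lt_top fun t ht => ?_).trans ?_)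
  · have e : ∀ x, Set.indicator {z : EuclideanSpace ℝ (Fin n) × ℝ | 0 < z.2}
        (bellmanFlow p q a a') (x, t) = bellmanFlow p q a a' (x, t) := fun x =>
      Set.indicator_of_mem (by exact ht.1) _
    simp only [e]
    rw [Real.norm_of_nonneg (integral_nonneg fun x => bellmanFlow_nonneg hp hpq hq2 a a' _)]
    exact le_of_lt (hJ ⟨ht.1, ht.2.trans_lt hh.2⟩)
  · rw [Real.volume_real_Ioc_of_le hh.1.le, sub_zero, mul_comm]

theorem secondDiff_indicator_timePos {c : EuclideanSpace ℝ (Fin n) × ℝ → ℝ} {h : ℝ} (hh : 0 < h)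
    {z : EuclideanSpace ℝ (Fin n) × ℝ} (hz : h < z.2) :
    secondDiff (Set.indicator {z | 0 < z.2} c) h z = secondDiff c h z := by
  have hz0 : 0 < z.2 := hh.trans hz
  unfold secondDiff
  refine Finset.sum_congr rfl fun i _ => ?_
  have h1 : 0 < (z + h • coordDir i).2 := by cases i <;> simp [coordDir] <;> linarith
  have h2 : 0 < (z - h • coordDir i).2 := by cases i <;> simp [coordDir] <;> linarith
  unfold secondDiffDir
  rw [Set.indicator_of_mem (by exact h1), Set.indicator_of_mem (by exact h2),
    Set.indicator_of_mem (by exact hz0)]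

/-- The bilinear embedding inequality in terms of the limits of the discrete Laplacians of `Φ`. -/
theorem integral_time_mul_laplacian_bellmanFlow_le (hn : 1 ≤ n) (hp : 2 ≤ p)
    (hpq : p.HolderConjugate q) (hq2 : q ≤ 2) (ha : DampedSummable 0 a)
    (ha' : DampedSummable 0 a') {l : EuclideanSpace ℝ (Fin n) × ℝ → ℝ}
    (hl : ∀ᵐ z, 0 < z.2 →
      Tendsto (fun h => secondDiff (bellmanFlow p q a a') h z) (𝓝[>] 0) (𝓝 (l z))) :
    Integrable (Set.indicator {z : EuclideanSpace ℝ (Fin n) × ℝ | 0 < z.2}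
        fun z => z.2 * l z) ∧
      ∫ z, Set.indicator {z : EuclideanSpace ℝ (Fin n) × ℝ | 0 < z.2} (fun z => z.2 * l z) z ≤
        2 * ∫ x, bellmanFlow p q a a' (x, 0) := by
  set T := {z : EuclideanSpace ℝ (Fin n) × ℝ | 0 < z.2} with hT
  set c := Set.indicator T (bellmanFlow p q a a') with hc
  obtain ⟨C, hC0, hC⟩ := exists_secondDiff_bellmanFlow_ge hn hp hpq hq2 ha ha'
  have i1 : Integrable c := by
    simpa using integrable_indicator_mul_bellmanFlow hn hp hpq hq2 ha ha'
      (w := fun _ => 1) continuous_const (by simpa using integrable_exp_mul_decayWeight)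
  have i2 : Integrable fun z => z.2 * c z := by
    refine (integrable_indicator_mul_bellmanFlow hn hp hpq hq2 ha ha' (w := fun z => z.2)
      continuous_snd ?_).congr (Eventually.of_forall fun z => ?_)
    · refine integrable_time_mul_exp_mul_decayWeight.congr (Eventually.of_forall fun z => ?_)
      simp only [Set.indicator_apply, Set.mem_ofPred_eq]
      split_ifs with h
      · rw [abs_of_pos h]
      · rfl
    · simp only [hc, hT, Set.indicator_apply, Set.mem_ofPred_eq]
      split_ifs <;> simp
  have c0 : ∀ z, 0 ≤ c z := fun z =>
    Set.indicator_nonneg (fun z _ => bellmanFlow_nonneg hp hpq hq2 a a' _) z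
  have ct : ∀ z : EuclideanSpace ℝ (Fin n) × ℝ, z.2 ≤ 0 → c z = 0 := fun z hz =>
    Set.indicator_of_notMem (show z ∉ T from fun h : 0 < z.2 => absurd h (not_lt.2 hz)) _
  -- Fatou's lemma runs along a sequence; $s_k\le1$ keeps the uniform lower bound applicable.
  let s : ℕ → ℝ := fun k => 1 / ((k : ℝ) + 1)
  have hs0 : ∀ k, 0 < s k := fun k => by positivity
  have hs1 : ∀ k, s k ≤ 1 := fun k => by
    rw [div_le_one (by positivity)]
    have : (0 : ℝ) ≤ k := Nat.cast_nonneg k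
    linarith
  have hs : Tendsto s atTop (𝓝 0) := tendsto_one_div_add_atTop_nhds_zero_nat
  have hs' : Tendsto s atTop (𝓝[>] 0) :=
    tendsto_nhdsWithin_iff.2 ⟨hs, Eventually.of_forall hs0⟩
  refine integrable_and_integral_le_of_ae_tendsto
    (u := fun k z => timeWeight (s k) z * secondDiff c (s k) z)
    (integrable_time_mul_exp_mul_decayWeight.const_mul C)
    (fun k => (integral_timeWeight_mul_secondDiff_le i1 i2 c0 ct (hs0 k)).1)
    (fun k => Eventually.of_forall fun z => ?_) ?_ fun ε hε => ?_
  · by_cases hz : s k < z.2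
    · have hz0 : 0 < z.2 := (hs0 k).trans hz
      rw [Set.indicator_of_mem (by exact hz0), timeWeight, if_pos hz,
        secondDiff_indicator_timePos (hs0 k) hz]
      have := mul_le_mul_of_nonneg_left (hC z (s k) (hs0 k) (hs1 k) hz.le) hz0.le
      linarith
    · rw [timeWeight, if_neg hz, zero_mul, Left.neg_nonpos_iff]
      refine mul_nonneg hC0 (Set.indicator_nonneg (fun z hz => ?_) z)
      exact mul_nonneg (le_of_lt hz) (exp_mul_decayWeight_pos z).le
  · filter_upwards [hl] with z hz
    by_cases hz0 : 0 < z.2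
    · rw [Set.indicator_of_mem (by exact hz0)]
      refine (((hz hz0).comp hs').const_mul z.2).congr' ?_
      filter_upwards [hs.eventually (eventually_lt_nhds hz0)] with k hk
      rw [timeWeight, if_pos hk, secondDiff_indicator_timePos (hs0 k) hk]
      rfl
    · rw [Set.indicator_of_notMem (by exact hz0)]
      refine tendsto_const_nhds.congr fun k => ?_
      rw [timeWeight, if_neg (fun h => hz0 ((hs0 k).trans h)), zero_mul]
  · filter_upwards [hs'.eventually (eventually_setIntegral_bellmanFlow_le hn hp hpq hq2 ha ha'
      (half_pos hε))] with k hk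
    refine (integral_timeWeight_mul_secondDiff_le i1 i2 c0 ct (hs0 k)).2.trans ?_
    have h0 := (hs0 k).ne'
    calc _ ≤ 2 * (s k)⁻¹ * (s k * ((∫ x, bellmanFlow p q a a' (x, 0)) + ε / 2)) :=
          mul_le_mul_of_nonneg_left hk (by have := hs0 k; positivity)
      _ = _ := by field_simp

end BellmanFlow

/-! ### Assembly of the dissipation estimate -/

section MainTheorem

open MeasureTheory Filter Topology

section TwiceDifferentiable

variable {V : Type*} [NormedAddCommGroup V] [NormedSpace ℝ V] {B B' : V → ℝ} {z : V}

theorem TwiceDifferentiableAt.linear_combination (hB : TwiceDifferentiableAt B z)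
    (hB' : TwiceDifferentiableAt B' z) (r s : ℝ) :
    TwiceDifferentiableAt (fun w => r * B w + s * B' w) z := by
  refine ⟨?_, ?_⟩
  · filter_upwards [hB.1, hB'.1] with w h1 h2
    exact (h1.const_mul r).add (h2.const_mul s)
  · refine ((hB.2.const_smul r).add (hB'.2.const_smul s)).congr_of_eventuallyEq ?_
    filter_upwards [hB.1, hB'.1] with w h1 h2
    exact ((h1.hasFDerivAt.const_mul r).add (h2.hasFDerivAt.const_mul s)).fderiv

end TwiceDifferentiable

variable {n : ℕ}

theorem secondDiff_linear_combination (B B' : EuclideanSpace ℝ (Fin n) × ℝ → ℝ) (r s h : ℝ)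
    (z : EuclideanSpace ℝ (Fin n) × ℝ) :
    secondDiff (fun w => r * B w + s * B' w) h z =
      r * secondDiff B h z + s * secondDiff B' h z := by
  simp only [secondDiff, Finset.mul_sum, ← Finset.sum_add_distrib]
  refine Finset.sum_congr rfl fun i _ => ?_
  simp only [secondDiffDir, smul_eq_mul]
  ring

theorem twiceDifferentiableAt_hermSeries (hn : 1 ≤ n) {a : (Fin n → ℕ) → ℝ}
    (ha : ∀ τ > 0, DampedSummable τ a) {z : EuclideanSpace ℝ (Fin n) × ℝ} (hz : 0 < z.2) :
    TwiceDifferentiableAt (hermSeries a) z := by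
  refine ⟨?_, (hermSeries_twice_differentiable hn (ha _ (half_pos hz)) (half_lt_self hz)).2⟩
  filter_upwards [(isOpen_timeAbove 0).mem_nhds hz] with w hw
  have hw : 0 < w.2 := hw
  exact (hermSeries_twice_differentiable hn (ha _ (half_pos hw)) (half_lt_self hw)).1

theorem integrable_norm_rpow {E : Type*} [NormedAddCommGroup E] {r : ℝ} (hr : 0 < r)
    {f : EuclideanSpace ℝ (Fin n) → E} (hf : Continuous f) (hf' : HasCompactSupport f) :
    Integrable fun y => ‖f y‖ ^ r :=
  (hf.norm.rpow_const fun _ => Or.inr hr.le).integrable_of_hasCompactSupport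
    (hf'.norm.comp_left (g := fun s : ℝ => s ^ r) (Real.zero_rpow hr.ne'))

/-- The dissipation estimate for the Bellman function with exponent `p ≥ 2`. -/
theorem bellmanQ_flow_estimate {M N : ℕ} (hn : 1 ≤ n) {p q : ℝ} (hp : 2 ≤ p)
    (hpq : p.HolderConjugate q) (hq2 : q ≤ 2)
    (f : EuclideanSpace ℝ (Fin n) → EuclideanSpace ℂ (Fin M))
    (g : EuclideanSpace ℝ (Fin n) → EuclideanSpace ℂ (Fin N))
    (hf : ContDiff ℝ ∞ f) (hf' : HasCompactSupport f)
    (hg : ContDiff ℝ ∞ g) (hg' : HasCompactSupport g)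
    {b : EuclideanSpace ℝ (Fin n) → ℝ → ℝ}
    (hb : b = fun x t => bellmanQ p q (hermitePoisson t f x) (hermitePoisson t g x)
      (hermitePoisson t (fun y => ‖f y‖ ^ p) x) (hermitePoisson t (fun y => ‖g y‖ ^ q) x)) :
    (∀ᵐ z : EuclideanSpace ℝ (Fin n) × ℝ ∂(volume.restrict (Set.univ ×ˢ Set.Ioi (0 : ℝ))),
      TwiceDifferentiableAt (fun w : EuclideanSpace ℝ (Fin n) × ℝ => b w.1 w.2) z) ∧
    IntegrableOn (fun z : EuclideanSpace ℝ (Fin n) × ℝ => hermiteOpExt b z.1 z.2 * z.2)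
      (Set.univ ×ˢ Set.Ioi (0 : ℝ)) volume ∧
    -∫ t in Set.Ioi (0 : ℝ), ∫ x, hermiteOpExt b x t * t ≤
      6 * ((∫ x, ‖f x‖ ^ p) + ∫ x, ‖g x‖ ^ q) := by
  set c := bellmanFlow p q (hermCoeff f) (hermCoeff g) with hc
  set P := hermSeries (hermCoeff fun y => ‖f y‖ ^ p) with hP
  set R := hermSeries (hermCoeff fun y => ‖g y‖ ^ q) with hR
  set T := {z : EuclideanSpace ℝ (Fin n) × ℝ | 0 < z.2} with hT
  have hTS : Set.univ ×ˢ Set.Ioi (0 : ℝ) = T := Set.univ_prod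
  have hTm : MeasurableSet T := measurableSet_timePos
  have ha := dampedSummable_zero_hermCoeff hf hf'
  have ha' := dampedSummable_zero_hermCoeff hg hg'
  have iF := integrable_norm_rpow hpq.pos hf.continuous hf'
  have iG := integrable_norm_rpow hpq.symm.pos hg.continuous hg'
  -- Unlike $f$, the function $\|f\|^p$ need not be smooth, so only positive damping is available.
  -- This suffices: its extension is used solely through $L'P=0$ at $t>0$, never through boundary
  -- values.
  have sP : ∀ τ > 0, DampedSummable τ (hermCoeff fun y => ‖f y‖ ^ p) := fun τ hτ =>
    dampedSummable_hermCoeff hn hτ iF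
  have sR : ∀ τ > 0, DampedSummable τ (hermCoeff fun y => ‖g y‖ ^ q) := fun τ hτ =>
    dampedSummable_hermCoeff hn hτ iG
  have eb : (fun w : EuclideanSpace ℝ (Fin n) × ℝ => b w.1 w.2) =
      fun w => 2 * (1 * P w + 1 * R w) + (-1) * c w := by
    funext w
    rw [hb]
    simp only [bellmanQ_eq, hermitePoisson_eq_hermSeries]
    rw [hP, hR, hc, bellmanFlow]
    ring
  have tP : ∀ z ∈ T, TwiceDifferentiableAt P z := fun z hz =>
    twiceDifferentiableAt_hermSeries hn sP hz
  have tR : ∀ z ∈ T, TwiceDifferentiableAt R z := fun z hz =>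
    twiceDifferentiableAt_hermSeries hn sR hz
  have tc : ∀ᵐ z : EuclideanSpace ℝ (Fin n) × ℝ, z ∈ T → TwiceDifferentiableAt c z :=
    ae_twiceDifferentiableAt_bellmanPhi hp hpq hq2 (isOpen_timeAbove 0)
      (fun z hz => (hermSeries_twice_differentiable hn ha hz).1)
      (fun z hz => (hermSeries_twice_differentiable hn ha hz).2)
      (fun z hz => (hermSeries_twice_differentiable hn ha' hz).1)
      (fun z hz => (hermSeries_twice_differentiable hn ha' hz).2)
  have tb : ∀ᵐ z : EuclideanSpace ℝ (Fin n) × ℝ, z ∈ T →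
      TwiceDifferentiableAt (fun w : EuclideanSpace ℝ (Fin n) × ℝ => b w.1 w.2) z := by
    filter_upwards [tc] with z hz hzT
    rw [eb]
    exact ((tP z hzT).linear_combination (tR z hzT) 1 1).linear_combination (hz hzT) 2 (-1)
  -- Since $b=2(P+R)-c$ and $L'$ annihilates $P$ and $R$, this is the value that the discrete
  -- Laplacians of $c$ must approach.
  let l : EuclideanSpace ℝ (Fin n) × ℝ → ℝ := fun z => ‖z.1‖ ^ 2 * c z - hermiteOpExt b z.1 z.2
  have hl : ∀ᵐ z : EuclideanSpace ℝ (Fin n) × ℝ, 0 < z.2 →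
      Tendsto (fun h => secondDiff c h z) (𝓝[>] 0) (𝓝 (l z)) := by
    filter_upwards [tb] with z hz hz0
    have l1 := tendsto_secondDiff_hermSeries hn (half_lt_self hz0) (sP _ (half_pos hz0))
    have l2 := tendsto_secondDiff_hermSeries hn (half_lt_self hz0) (sR _ (half_pos hz0))
    have l3 := tendsto_secondDiff_hermiteOpExt b z.1 z.2 (hz hz0)
    have hbz : b z.1 z.2 = 2 * (1 * P z + 1 * R z) + (-1) * c z := congrFun eb z
    rw [hbz, eb] at l3
    have l4 := ((l1.add l2).const_mul 2).sub l3
    refine (l4.congr fun h => ?_).trans (le_of_eq ?_)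
    · rw [secondDiff_linear_combination, secondDiff_linear_combination]
      ring
    · congr 1
      simp only [l, smul_eq_mul]
      ring
  obtain ⟨il, bl⟩ := integral_time_mul_laplacian_bellmanFlow_le hn hp hpq hq2 ha ha' hl
  have pos : ∀ᵐ z : EuclideanSpace ℝ (Fin n) × ℝ, z ∈ T →
      0 ≤ -(hermiteOpExt b z.1 z.2 * z.2) ∧ -(hermiteOpExt b z.1 z.2 * z.2) ≤ z.2 * l z := by
    filter_upwards [hl] with z hz hzT
    have hz0 : 0 < z.2 := hzT
    have h1 := norm_sq_mul_bellmanFlow_le hn hp hpq hq2 ha ha' hz0 (hz hz0)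
    have h2 : 0 ≤ ‖z.1‖ ^ 2 * c z := mul_nonneg (by positivity) (bellmanFlow_nonneg hp hpq hq2 _ _ _)
    have h3 : hermiteOpExt b z.1 z.2 ≤ 0 := by simp only [l] at h1; linarith
    refine ⟨by nlinarith, ?_⟩
    simp only [l]
    nlinarith
  have pos' : ∀ᵐ z ∂(volume.restrict T),
      0 ≤ -(hermiteOpExt b z.1 z.2 * z.2) ∧ -(hermiteOpExt b z.1 z.2 * z.2) ≤ z.2 * l z :=
    (ae_restrict_iff' hTm).2 pos
  have il' : IntegrableOn (fun z => z.2 * l z) T := (integrable_indicator_iff hTm).1 il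
  have ib : IntegrableOn (fun z : EuclideanSpace ℝ (Fin n) × ℝ =>
      hermiteOpExt b z.1 z.2 * z.2) T := by
    refine il'.mono' ?_ ?_
    -- Measurability of $L'b$ is inherited from $l$, an almost everywhere limit, and the continuous
    -- $|x|^2c$.
    · have m1 : AEStronglyMeasurable (fun z => z.2 * (‖z.1‖ ^ 2 * c z)) (volume.restrict T) := by
        refine ContinuousOn.aestronglyMeasurable ?_ hTm
        have := continuousOn_bellmanFlow hn hp hpq hq2 ha ha'
        fun_prop
      refine (m1.sub il'.1).congr (Eventually.of_forall fun z => ?_)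
      simp only [l, Pi.sub_apply]
      ring
    · filter_upwards [pos'] with z hz
      rw [Real.norm_eq_abs, ← abs_neg, abs_of_nonneg hz.1]
      exact hz.2
  refine ⟨?_, hTS ▸ ib, ?_⟩
  · rw [hTS]
    exact (ae_restrict_iff' hTm).2 tb
  · have e := setIntegral_timeSlab (s := Set.Ioi (0 : ℝ))
      (f := fun z : EuclideanSpace ℝ (Fin n) × ℝ => hermiteOpExt b z.1 z.2 * z.2) (hTS ▸ ib)
    rw [← e, hTS, ← integral_neg]
    have b1 : ∫ z in T, -(hermiteOpExt b z.1 z.2 * z.2) ≤ ∫ z in T, z.2 * l z :=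
      integral_mono_ae ib.neg il' (pos'.mono fun z hz => hz.2)
    rw [integral_indicator hTm] at bl
    have b2 : ∫ x, bellmanFlow p q (hermCoeff f) (hermCoeff g) (x, 0) ≤
        5 / 4 * ((∫ x, ‖f x‖ ^ p) + ∫ x, ‖g x‖ ^ q) := by
      rw [← integral_add iF iG, ← integral_const_mul]
      refine integral_mono_of_nonneg (Eventually.of_forall fun x =>
        bellmanFlow_nonneg hp hpq hq2 _ _ _) ((iF.add iG).const_mul _)
        (Eventually.of_forall fun x => ?_)
      simp only [bellmanFlow, hermSeries_hermCoeff_zero hn hf hf', hermSeries_hermCoeff_zero hn hg hg']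
      exact bellmanPhi_le hpq hq2 _ _
    have b3 : 0 ≤ (∫ x, ‖f x‖ ^ p) + ∫ x, ‖g x‖ ^ q :=
      add_nonneg (integral_nonneg fun x => Real.rpow_nonneg (norm_nonneg _) _)
        (integral_nonneg fun x => Real.rpow_nonneg (norm_nonneg _) _)
    -- The factor 2 from the time weight and $\frac54$ from the bound on $\Phi$ give $\frac52$, well
    -- below 6.
    linarith

end MainTheorem

theorem mainTheorem8 {n M N : ℕ} (hn : 1 ≤ n) (p q : ℝ) (hp : 1 < p) (hq : q = p / (p - 1))
    (f : EuclideanSpace ℝ (Fin n) → EuclideanSpace ℂ (Fin M))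
    (g : EuclideanSpace ℝ (Fin n) → EuclideanSpace ℂ (Fin N))
    (hf : ContDiff ℝ ∞ f) (hf' : HasCompactSupport f)
    (hg : ContDiff ℝ ∞ g) (hg' : HasCompactSupport g) :
    (∀ᵐ z : EuclideanSpace ℝ (Fin n) × ℝ
        ∂(MeasureTheory.volume.restrict (Set.univ ×ˢ Set.Ioi (0 : ℝ))),
      TwiceDifferentiableAt
        (fun w : EuclideanSpace ℝ (Fin n) × ℝ => bellmanExt p q f g w.1 w.2) z) ∧
    MeasureTheory.IntegrableOn
      (fun z : EuclideanSpace ℝ (Fin n) × ℝ =>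
        hermiteOpExt (bellmanExt p q f g) z.1 z.2 * z.2)
      (Set.univ ×ˢ Set.Ioi (0 : ℝ)) MeasureTheory.volume ∧
    -∫ t in Set.Ioi (0 : ℝ), ∫ x, hermiteOpExt (bellmanExt p q f g) x t * t ≤
      6 * ((∫ x, ‖f x‖ ^ p) + ∫ x, ‖g x‖ ^ q) := by
  have hpq : p.HolderConjugate q := (Real.holderConjugate_iff_eq_conjExponent hp).2 hq
  have hp0 : 0 < p - 1 := sub_pos.2 hp
  rcases le_or_gt 2 p with h2 | h2
  · have hq2 : q ≤ 2 := by rw [hq, div_le_iff₀ hp0]; linarith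
    refine bellmanQ_flow_estimate hn h2 hpq hq2 f g hf hf' hg hg' ?_
    funext x t
    rw [bellmanExt, if_pos h2]
  -- For $p<2$ the conjugate exponent exceeds 2, and the same estimate applies with the two pairs
  -- exchanged; the right side is symmetric.
  · have hq2 : 2 ≤ q := by rw [hq, le_div_iff₀ hp0]; linarith
    rw [add_comm (∫ x, ‖f x‖ ^ p)]
    refine bellmanQ_flow_estimate hn hq2 hpq.symm h2.le g f hg hg' hf hf' ?_
    funext x t
    rw [bellmanExt, if_neg (not_le.2 h2)]
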